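/- Let $\mathbb T^d=\mathbb R^d/\mathbb Z^d$ be the flat torus with its geodesic distance, let $1<p,q<\infty$ with $\frac1p+\frac1q=1$, and let $\mathscr P(\mathbb T^d)$ be the set of Borel probability measures on $\mathbb T^d$, with the Wasserstein distance $W_p$. For $x,y\in\mathbb T^d$ let $y-x\in(-\frac12,\frac12]^d$ denote the shortest displacement vector. For $\mu\in\mathscr P(\mathbb T^d)$ and a Borel vector field $\phi:\mathbb T^d\to\mathbb R^d$ with $\phi\in L^p_\mu$, the transport map variation generated by $\phi$ is the family of plans $\pi_t=(\mathrm{Id},\mathrm{Id}+t\phi)_\sharp\mu$. Let $U:\mathscr P(\mathbb T^d)\to\mathbb R$ be $W_p$-Lipschitz continuous, and suppose that there is a Borel map $(\mu,x)\mapsto p_\mu(x)\in\mathbb R^d$ on $\mathscr P(\mathbb T^d)\times\mathbb T^d$ with $p_\mu\in L^q_\mu$ for every $\mu$, such that for every $\mu$ the map $p_\mu$ is a derivative of $U$ at $\mu$ along every transport map variation $(\pi_t)$ from $\mu$, that is, $$\lim_{t\to0^+}\frac1t\left|U(\mathrm{pr}_{2\,\sharp}\pi_t)-U(\mu)-\iint\langle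 p_\mu(x),y-x\rangle\,d\pi_t(x,y)\right|=0 .$$ Let $I\subset\mathbb R$ be a compact interval and let $(\mu_\tau)_{\tau\in I}$ be a $W_p$-absolutely continuous curve, i.e. $W_p(\mu_s,\mu_t)\le\int_s^t g(\tau)\,d\tau$ for all $s\le t$ in $I$ and some $g\in L^1(I)$; let $|\dot\mu_t|$ be its metric derivative. Then there is a Borel vector field $v=v_t(x)$ such that (i) $\int_I\int_{\mathbb T^d}|v_t|\,d\mu_t\,dt<\infty$, and the continuity equation $\partial_t\mu_t+\mathrm{div}(v_t\mu_t)=0$ holds in the sense of distributions in the interior of $I$; (ii) for a.e. $t\in I$ the metric derivative $|\dot\mu_t|$ exists, $v_t\in L^p_{\mu_t}$ and $\|v_t\|_{L^p_{\mu_t}}\le|\dot\mu_t|$. It is unique: if $v,w$ both satisfy (i) and (ii), then $v_t=w_t$ $\mu_t$-a.e. for a.e. $t\in I$. Moreover, the function $\langle p_{\mu_\tau},v_\tau\rangle$ is $\mu_\tau$-integrable for a.e. $\tau\in I$, the function $\tau\mapsto\int_{\mathbb T^d}\langle p_{\mu_\tau},v_\tau\rangle\,d\mu_\tau$ is integrable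 on $I$, and for all $s,t\in I$ $$U(\mu_t)-U(\mu_s)=\int_s^t\int_{\mathbb T^d}\langle p_{\mu_\tau}(x),v_\tau(x)\rangle\,d\mu_\tau(x)\,d\tau .$$ -/

import Mathlib

open MeasureTheory Filter Topology Set
open scoped ENNReal NNReal

/-- The flat torus `ℝᵈ / ℤᵈ`. -/
abbrev Torus (d : ℕ) : Type := UnitAddTorus (Fin d)

/-- Tangent vectors: `ℝᵈ` with the Euclidean norm. -/
abbrev Tangent (d : ℕ) : Type := EuclideanSpace ℝ (Fin d)

/-- The quotient map `ℝᵈ → ℝᵈ / ℤᵈ`. -/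
def torusProj {d : ℕ} (u : Tangent d) : Torus d := fun i => ((u i : ℝ) : UnitAddCircle)

/-- The representative in `(-1/2, 1/2]ᵈ` of a point of the torus. -/
noncomputable def torusLift {d : ℕ} (x : Torus d) : Tangent d :=
  WithLp.toLp 2 fun i => ((AddCircle.equivIoc (1 : ℝ) (-(1 / 2)) (x i) : ℝ))

/-- The displacement `y - x`, as a tangent vector: a shortest vector that leads from `x` to `y`. -/
noncomputable def torusDisp {d : ℕ} (x y : Torus d) : Tangent d := torusLift (y - x)

/-- The flat (geodesic) distance of the torus. (The metric that Mathlib puts on a product of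
circles is the sup metric, so it is not used here; the topology and the Borel sets agree.) -/
noncomputable def torusDist {d : ℕ} (x y : Torus d) : ℝ := ‖torusDisp x y‖

/-- The gradient of a function on the torus, computed on `ℝᵈ` through the quotient map. -/
noncomputable def torusGrad {d : ℕ} (f : Torus d → ℝ) (x : Torus d) : Tangent d :=
  gradient (fun u : Tangent d => f (torusProj u)) (torusLift x)

/-- The `p`-cost `(∬ dist(x,y)^p dπ(x,y))^{1/p}` of a plan. -/
noncomputable def planCost {d : ℕ} (p : ℝ) (π : ProbabilityMeasure (Torus d × Torus d)) : ℝ≥0∞ :=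
  (∫⁻ z, ENNReal.ofReal (torusDist z.1 z.2) ^ p ∂(π : Measure (Torus d × Torus d))) ^ (1 / p)

/-- `π` is a transport plan between `μ` and `ν`. -/
def IsTransportPlan {d : ℕ} (π : ProbabilityMeasure (Torus d × Torus d))
    (μ ν : ProbabilityMeasure (Torus d)) : Prop :=
  π.map measurable_fst.aemeasurable = μ ∧ π.map measurable_snd.aemeasurable = ν

/-- The Wasserstein distance `W_p` on the probability measures of the torus. -/
noncomputable def wasserstein {d : ℕ} (p : ℝ) (μ ν : ProbabilityMeasure (Torus d)) : ℝ≥0∞ :=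
  ⨅ (π : ProbabilityMeasure (Torus d × Torus d)) (_ : IsTransportPlan π μ ν), planCost p π

/-- `U` is Lipschitz continuous with respect to `W_p`. -/
def IsWassersteinLipschitz {d : ℕ} (p : ℝ) (U : ProbabilityMeasure (Torus d) → ℝ) : Prop :=
  ∃ L : ℝ≥0, ∀ μ ν, ENNReal.ofReal |U μ - U ν| ≤ L * wasserstein p μ ν

/-- The transport map variation `π_t = (Id, Id + tφ)♯μ` generated by a Borel vector field `φ`. -/
noncomputable def transportVariation {d : ℕ} (μ : ProbabilityMeasure (Torus d))
    (φ : Torus d → Tangent d) (hφ : Measurable φ) (t : ℝ) :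
    ProbabilityMeasure (Torus d × Torus d) :=
  μ.map (f := fun x => (x, x + torusProj (t • φ x))) (by
    refine Measurable.aemeasurable (measurable_id.prodMk (measurable_id.add ?_))
    refine measurable_pi_lambda _ fun i => ?_
    have h : Measurable fun x => (t • φ x) i :=
      (EuclideanSpace.proj (𝕜 := ℝ) i).continuous.measurable.comp (hφ.const_smul t)
    exact (AddCircle.continuous_mk' (1 : ℝ)).measurable.comp h)

/-- `P` is a derivative of `U` at `μ` along the family of plans `π_t` (that start from `μ`):
`(1/t) |U(pr₂♯π_t) - U(μ) - ∬ ⟨P(x), y - x⟩ dπ_t(x,y)| → 0` as `t → 0⁺`. -/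
def IsDerivativeAlong {d : ℕ} (U : ProbabilityMeasure (Torus d) → ℝ)
    (μ : ProbabilityMeasure (Torus d)) (π : ℝ → ProbabilityMeasure (Torus d × Torus d))
    (P : Torus d → Tangent d) : Prop :=
  Tendsto (fun t : ℝ => (1 / t) * |U ((π t).map measurable_snd.aemeasurable) - U μ -
      ∫ z, inner ℝ (P z.1) (torusDisp z.1 z.2) ∂(π t : Measure (Torus d × Torus d))|)
    (𝓝[>] 0) (𝓝 0)

/-- `(μ, x) ↦ P μ x` is a Borel map, where the probability measures carry the Borel sets of the
topology of weak convergence. -/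
def IsJointlyBorel {d : ℕ} (P : ProbabilityMeasure (Torus d) → Torus d → Tangent d) : Prop :=
  @Measurable (ProbabilityMeasure (Torus d) × Torus d) (Tangent d)
    (@Prod.instMeasurableSpace _ _ (borel (ProbabilityMeasure (Torus d))) inferInstance) _
    (Function.uncurry P)

/-- `U` is differentiable along every transport map variation that is generated by a Borel vector
field of class `L^p`, and `P μ`, of class `L^q`, is a derivative at `μ` along all of them. -/
structure IsTransportDerivative {d : ℕ} (p q : ℝ) (U : ProbabilityMeasure (Torus d) → ℝ)
    (P : ProbabilityMeasure (Torus d) → Torus d → Tangent d) : Prop where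
  borel : IsJointlyBorel P
  memLp : ∀ μ : ProbabilityMeasure (Torus d),
    MemLp (P μ) (ENNReal.ofReal q) (μ : Measure (Torus d))
  deriv : ∀ (μ : ProbabilityMeasure (Torus d)) (φ : Torus d → Tangent d) (hφ : Measurable φ),
    MemLp φ (ENNReal.ofReal p) (μ : Measure (Torus d)) →
      IsDerivativeAlong U μ (transportVariation μ φ hφ) (P μ)

/-- The curve `μ` is `W_p`-absolutely continuous on `[a, b]`. -/
def IsWassersteinAC {d : ℕ} (p a b : ℝ) (μ : ℝ → ProbabilityMeasure (Torus d)) : Prop :=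
  ∃ g : ℝ → ℝ, IntegrableOn g (Icc a b) ∧ ∀ s ∈ Icc a b, ∀ t ∈ Icc a b, s ≤ t →
    wasserstein p (μ s) (μ t) ≤ ENNReal.ofReal (∫ τ in s..t, g τ)

/-- `m` is the metric derivative of the curve `μ` at the time `t`. -/
def HasMetricDerivAt {d : ℕ} (p : ℝ) (μ : ℝ → ProbabilityMeasure (Torus d)) (m : ℝ≥0∞) (t : ℝ) :
    Prop :=
  Tendsto (fun s : ℝ => wasserstein p (μ s) (μ t) / ENNReal.ofReal |s - t|) (𝓝[≠] t) (𝓝 m)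

/-- Test functions: smooth functions on `(a, b) × Torus d` with compact support. -/
structure IsTestFunction {d : ℕ} (a b : ℝ) (ψ : ℝ → Torus d → ℝ) : Prop where
  smooth : ContDiff ℝ ((⊤ : ℕ∞) : WithTop ℕ∞) fun z : ℝ × Tangent d => ψ z.1 (torusProj z.2)
  support : ∃ a' b' : ℝ, a < a' ∧ b' < b ∧ ∀ t, t ∉ Icc a' b' → ψ t = 0

/-- The continuity equation `∂_t μ_t + div(v_t μ_t) = 0` on `(a, b) × Torus d`, in the sense of
distributions, for a Borel vector field with `∫_a^b ∫ |v_t| dμ_t dt < ∞`. -/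
structure SolvesContinuityEquation {d : ℕ} (a b : ℝ) (μ : ℝ → ProbabilityMeasure (Torus d))
    (v : ℝ → Torus d → Tangent d) : Prop where
  borel : Measurable (Function.uncurry v)
  integrable : ∫⁻ t in Icc a b, ∫⁻ x, ‖v t x‖ₑ ∂(μ t : Measure (Torus d)) < ∞
  equation : ∀ ψ : ℝ → Torus d → ℝ, IsTestFunction a b ψ →
    ∫ t in Icc a b, ∫ x, (deriv (fun τ => ψ τ x) t + inner ℝ (torusGrad (ψ t) x) (v t x))
      ∂(μ t : Measure (Torus d)) = 0

/-- `v` is a Borel vector field that drives the curve `μ` through the continuity equation and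
satisfies `v_t ∈ L^p(μ_t)`, `‖v_t‖_{L^p(μ_t)} ≤ |μ̇_t|` for almost every `t ∈ [a, b]`. -/
structure IsMinimalVelocity {d : ℕ} (p a b : ℝ) (μ : ℝ → ProbabilityMeasure (Torus d))
    (v : ℝ → Torus d → Tangent d) : Prop where
  continuityEquation : SolvesContinuityEquation a b μ v
  norm_le : ∀ᵐ t ∂(volume.restrict (Icc a b)),
    MemLp (v t) (ENNReal.ofReal p) (μ t : Measure (Torus d)) ∧
      ∃ m : ℝ≥0∞, HasMetricDerivAt p μ m t ∧
        eLpNorm (v t) (ENNReal.ofReal p) (μ t : Measure (Torus d)) ≤ m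

section TorusGeometry

variable {d : ℕ}

theorem torusProj_add (u w : Tangent d) : torusProj (u + w) = torusProj u + torusProj w := rfl

theorem torusProj_zero : torusProj (0 : Tangent d) = 0 := rfl

theorem torusProj_neg (u : Tangent d) : torusProj (-u) = -torusProj u := rfl

theorem torusProj_sub (u w : Tangent d) : torusProj (u - w) = torusProj u - torusProj w := rfl

theorem continuous_torusProj : Continuous (torusProj : Tangent d → Torus d) :=
  continuous_pi fun i =>
    (AddCircle.continuous_mk' (1 : ℝ)).comp (EuclideanSpace.proj (𝕜 := ℝ) i).continuous

@[simp] theorem torusProj_torusLift (x : Torus d) : torusProj (torusLift x) = x := by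
  funext i
  exact AddCircle.coe_equivIoc

theorem isOpenQuotientMap_torusProj : IsOpenQuotientMap (torusProj : Tangent d → Torus d) := by
  have h : IsOpenQuotientMap (Pi.map fun (_ : Fin d) (r : ℝ) => (r : UnitAddCircle)) :=
    IsOpenQuotientMap.piMap fun _ => QuotientAddGroup.isOpenQuotientMap_mk
  exact h.comp (EuclideanSpace.equiv (Fin d) ℝ).toHomeomorph.isOpenQuotientMap

@[simp] theorem add_torusProj_torusDisp (x y : Torus d) : x + torusProj (torusDisp x y) = y := by
  simp [torusDisp]

theorem abs_torusLift_apply (x : Torus d) (i : Fin d) : |torusLift x i| = ‖x i‖ := by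
  have h := (AddCircle.equivIoc (1 : ℝ) (-(1 / 2)) (x i)).2
  have h2 : ((torusLift x i : ℝ) : UnitAddCircle) = x i := congrFun (torusProj_torusLift x) i
  have h3 : ‖((torusLift x i : ℝ) : UnitAddCircle)‖ = |torusLift x i| := by
    refine (AddCircle.norm_coe_eq_abs_iff _ one_ne_zero).2 ?_
    change _ < torusLift x i ∧ torusLift x i ≤ _ at h
    rw [abs_le, abs_one]
    constructor <;> linarith [h.1, h.2]
  rw [← h3, h2]

theorem norm_torusLift (x : Torus d) : ‖torusLift x‖ = √(∑ i, ‖x i‖ ^ 2) := by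
  rw [EuclideanSpace.norm_eq]
  simp [abs_torusLift_apply]

theorem continuous_norm_torusLift : Continuous fun x : Torus d => ‖torusLift x‖ := by
  simp only [norm_torusLift]
  fun_prop

theorem norm_coe_unitAddCircle_le (r : ℝ) : ‖(r : UnitAddCircle)‖ ≤ ‖r‖ := by
  rw [UnitAddCircle.norm_eq]
  simpa using round_le r 0

theorem norm_torusLift_torusProj_le (w : Tangent d) : ‖torusLift (torusProj w)‖ ≤ ‖w‖ := by
  rw [norm_torusLift, EuclideanSpace.norm_eq]
  gcongr with i
  exact norm_coe_unitAddCircle_le (w i)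

theorem torusLift_torusProj {w : Tangent d} (hw : ‖w‖ < 1 / 2) : torusLift (torusProj w) = w := by
  ext i
  have h1 : |w i| ≤ ‖w‖ := by simpa using PiLp.norm_apply_le w i
  have h2 := abs_lt.1 (h1.trans_lt hw)
  exact AddCircle.equivIoc_coe_of_mem ⟨h2.1, by linarith [h2.2]⟩

theorem norm_torusLift_neg (x : Torus d) : ‖torusLift (-x)‖ = ‖torusLift x‖ := by
  simp [norm_torusLift]

theorem torusDist_comm (x y : Torus d) : torusDist x y = torusDist y x := by
  rw [torusDist, torusDist, torusDisp, torusDisp, ← norm_torusLift_neg, neg_sub]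

theorem torusDist_nonneg (x y : Torus d) : 0 ≤ torusDist x y := norm_nonneg _

theorem continuous_torusDist : Continuous fun z : Torus d × Torus d => torusDist z.1 z.2 :=
  continuous_norm_torusLift.comp (continuous_snd.sub continuous_fst)

theorem torusDist_add_torusProj_le (x : Torus d) (w : Tangent d) :
    torusDist x (x + torusProj w) ≤ ‖w‖ := by
  simpa [torusDist, torusDisp] using norm_torusLift_torusProj_le w

theorem torusDist_add_left_le (x y : Torus d) (w : Tangent d) :
    torusDist (x + torusProj w) y ≤ ‖torusDisp x y - w‖ := by
  have h : x + torusProj w + torusProj (torusDisp x y - w) = y := by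
    rw [torusProj_sub, add_assoc, add_sub_cancel, add_torusProj_torusDisp]
  simpa only [h] using torusDist_add_torusProj_le (x + torusProj w) (torusDisp x y - w)

theorem torusDisp_add_torusProj {x : Torus d} {w : Tangent d} (hw : ‖w‖ < 1 / 2) :
    torusDisp x (x + torusProj w) = w := by
  simp [torusDisp, torusLift_torusProj hw]

theorem measurable_torusLift : Measurable (torusLift : Torus d → Tangent d) := by
  refine (WithLp.measurable_toLp 2 _).comp (measurable_pi_lambda _ fun i => ?_)
  have h := (AddCircle.measurableEquivIoc (1 : ℝ) (-(1 / 2))).measurable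
  exact measurable_subtype_coe.comp (h.comp (measurable_pi_apply i))

theorem measurable_torusDisp :
    Measurable fun z : Torus d × Torus d => torusDisp z.1 z.2 :=
  measurable_torusLift.comp (measurable_snd.sub measurable_fst)

/-- `F` is `K`-Lipschitz for the flat distance of the torus. -/
def TorusLip {d : ℕ} (K : ℝ) (F : Torus d → ℝ) : Prop :=
  ∀ x w, F (x + torusProj w) ≤ F x + K * ‖w‖

theorem TorusLip.abs_sub_le {K : ℝ} {F : Torus d → ℝ} (h : TorusLip K F) (x : Torus d)
    (w : Tangent d) : |F (x + torusProj w) - F x| ≤ K * ‖w‖ := by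
  have h1 := h x w
  have h2 := h (x + torusProj w) (-w)
  rw [torusProj_neg, add_neg_cancel_right, norm_neg] at h2
  rw [abs_le]; constructor <;> linarith

theorem TorusLip.abs_sub_le_dist {K : ℝ} {F : Torus d → ℝ} (h : TorusLip K F) (x y : Torus d) :
    |F y - F x| ≤ K * torusDist x y := by
  simpa [torusDist] using h.abs_sub_le x (torusDisp x y)

theorem TorusLip.mono {K L : ℝ} {F : Torus d → ℝ} (h : TorusLip K F) (hKL : K ≤ L) :
    TorusLip L F := fun x w => (h x w).trans (by gcongr)

theorem TorusLip.continuous {K : ℝ} {F : Torus d → ℝ} (h : TorusLip K F) : Continuous F := by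
  refine isOpenQuotientMap_torusProj.isQuotientMap.continuous_iff.2 ?_
  refine (LipschitzWith.of_dist_le_mul (K := K.toNNReal) fun u w => ?_).continuous
  have := h.abs_sub_le (torusProj w) (u - w)
  rw [← torusProj_add, add_sub_cancel] at this
  rw [Real.dist_eq, dist_eq_norm]
  exact this.trans (by gcongr; exact Real.le_coe_toNNReal K)

theorem LipschitzWith.torusLip {K : ℝ≥0} {F : Torus d → ℝ} (h : LipschitzWith K F) :
    TorusLip K F := fun x w => by
  have h1 := h.dist_le_mul (x + torusProj w) x
  have h2 : dist (x + torusProj w) x ≤ ‖w‖ := by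
    rw [dist_eq_norm, add_sub_cancel_left, pi_norm_le_iff_of_nonneg (norm_nonneg w)]
    intro i
    refine le_trans ?_ (PiLp.norm_apply_le w i)
    exact norm_coe_unitAddCircle_le (w i)
  rw [Real.dist_eq] at h1
  have h3 := (le_abs_self _).trans h1
  nlinarith [mul_le_mul_of_nonneg_left h2 K.2]

theorem exists_bound_of_continuous {E : Type*} [NormedAddCommGroup E] {F : Torus d → E}
    (hF : Continuous F) : ∃ C, 0 ≤ C ∧ ∀ x, ‖F x‖ ≤ C := by
  obtain ⟨C, hC⟩ := isCompact_univ.exists_bound_of_continuousOn hF.continuousOn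
  exact ⟨C, (norm_nonneg _).trans (hC 0 trivial), fun x => hC x trivial⟩

theorem exists_bound_torusDist (d : ℕ) : ∃ D : ℝ, 0 ≤ D ∧ ∀ x y : Torus d, torusDist x y ≤ D := by
  obtain ⟨C, hC, h⟩ := exists_bound_of_continuous (continuous_norm_torusLift (d := d))
  exact ⟨C, hC, fun x y => by simpa [torusDist, torusDisp] using h (y - x)⟩

end TorusGeometry

section TorusCalculus

variable {d : ℕ}

/-- Smooth functions on the torus. -/
def TorusSmooth {d : ℕ} (ψ : Torus d → ℝ) : Prop :=
  ContDiff ℝ ((⊤ : ℕ∞) : WithTop ℕ∞) fun u : Tangent d => ψ (torusProj u)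

theorem torusGrad_torusProj (f : Torus d → ℝ) (u : Tangent d) :
    torusGrad f (torusProj u) = gradient (fun u : Tangent d => f (torusProj u)) u := by
  set n := torusLift (torusProj u) - u with hn
  have h0 : torusProj n = 0 := by rw [hn, torusProj_sub, torusProj_torusLift, sub_self]
  have h1 : (fun u : Tangent d => f (torusProj (u + n))) = fun u => f (torusProj u) := by
    funext w; rw [torusProj_add, h0, add_zero]
  have h2 : torusLift (torusProj u) = u + n := by rw [hn]; abel
  rw [torusGrad, h2, gradient, gradient, ← fderiv_comp_add_right, h1]

namespace TorusSmooth

variable {φ ψ : Torus d → ℝ}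

theorem differentiable (hψ : TorusSmooth ψ) :
    Differentiable ℝ fun u : Tangent d => ψ (torusProj u) :=
  ContDiff.differentiable hψ (by simp)

theorem continuous (hψ : TorusSmooth ψ) : Continuous ψ :=
  isOpenQuotientMap_torusProj.isQuotientMap.continuous_iff.2 (ContDiff.continuous hψ)

theorem hasGradientAt (hψ : TorusSmooth ψ) (u : Tangent d) :
    HasGradientAt (fun u : Tangent d => ψ (torusProj u)) (torusGrad ψ (torusProj u)) u := by
  rw [torusGrad_torusProj]
  exact (hψ.differentiable u).hasGradientAt

theorem continuous_grad (hψ : TorusSmooth ψ) : Continuous (torusGrad ψ) := by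
  refine isOpenQuotientMap_torusProj.isQuotientMap.continuous_iff.2 ?_
  have h : torusGrad ψ ∘ torusProj = gradient fun u : Tangent d => ψ (torusProj u) :=
    funext fun u => torusGrad_torusProj ψ u
  rw [h]
  exact (InnerProductSpace.toDual ℝ (Tangent d)).symm.continuous.comp
    (ContDiff.continuous_fderiv hψ (by simp))

theorem exists_norm_grad_le (hψ : TorusSmooth ψ) : ∃ K, 0 ≤ K ∧ ∀ x, ‖torusGrad ψ x‖ ≤ K :=
  exists_bound_of_continuous hψ.continuous_grad

theorem add (hφ : TorusSmooth φ) (hψ : TorusSmooth ψ) : TorusSmooth fun x => φ x + ψ x :=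
  ContDiff.add hφ hψ

theorem sub (hφ : TorusSmooth φ) (hψ : TorusSmooth ψ) : TorusSmooth fun x => φ x - ψ x :=
  ContDiff.sub hφ hψ

theorem const_mul (c : ℝ) (hψ : TorusSmooth ψ) : TorusSmooth fun x => c * ψ x :=
  ContDiff.mul contDiff_const hψ

theorem grad_eq {x : Torus d} {g : Tangent d} {u : Tangent d} (hu : torusProj u = x)
    (h : HasGradientAt (fun u : Tangent d => ψ (torusProj u)) g u) : torusGrad ψ x = g := by
  rw [← hu, torusGrad_torusProj, h.gradient]

theorem grad_add (hφ : TorusSmooth φ) (hψ : TorusSmooth ψ) (x : Torus d) :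
    torusGrad (fun x => φ x + ψ x) x = torusGrad φ x + torusGrad ψ x := by
  refine grad_eq (torusProj_torusLift x) ?_
  have h := (hφ.hasGradientAt (torusLift x)).hasFDerivAt.add
    (hψ.hasGradientAt (torusLift x)).hasFDerivAt
  rw [← map_add] at h
  rw [torusProj_torusLift] at h
  exact hasGradientAt_iff_hasFDerivAt.2 h

theorem grad_const_mul (c : ℝ) (hψ : TorusSmooth ψ) (x : Torus d) :
    torusGrad (fun x => c * ψ x) x = c • torusGrad ψ x := by
  refine grad_eq (torusProj_torusLift x) ?_
  have h := (hψ.hasGradientAt (torusLift x)).hasFDerivAt.const_mul c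
  rw [torusProj_torusLift] at h
  rw [hasGradientAt_iff_hasFDerivAt]
  rwa [map_smulₛₗ, RCLike.conj_to_real]

theorem grad_sub (hφ : TorusSmooth φ) (hψ : TorusSmooth ψ) (x : Torus d) :
    torusGrad (fun x => φ x - ψ x) x = torusGrad φ x - torusGrad ψ x := by
  have h := hφ.grad_add (hψ.const_mul (-1)) x
  rw [hψ.grad_const_mul] at h
  simpa [sub_eq_add_neg] using h

theorem torusLip (hψ : TorusSmooth ψ) {K : ℝ} (hK : ∀ x, ‖torusGrad ψ x‖ ≤ K) :
    TorusLip K ψ := by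
  intro x w
  obtain ⟨u, rfl⟩ := isOpenQuotientMap_torusProj.surjective x
  have h := convex_univ.norm_image_sub_le_of_norm_hasFDerivWithin_le
    (fun v _ => (hψ.hasGradientAt v).hasFDerivAt.hasFDerivWithinAt)
    (C := K) (fun v _ => by simpa using hK (torusProj v)) (mem_univ u) (mem_univ (u + w))
  rw [torusProj_add, add_sub_cancel_left] at h
  linarith [(le_abs_self _).trans h]

theorem hasDerivAt_line (hψ : TorusSmooth ψ) (x : Torus d) (w : Tangent d) :
    HasDerivAt (fun τ : ℝ => ψ (x + torusProj (τ • w))) (inner ℝ (torusGrad ψ x) w) 0 := by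
  obtain ⟨u, rfl⟩ := isOpenQuotientMap_torusProj.surjective x
  have h1 : HasDerivAt (fun τ : ℝ => u + τ • w) w 0 := by
    simpa using ((hasDerivAt_id (0 : ℝ)).smul_const w).const_add u
  have h2 := (hψ.hasGradientAt u).hasFDerivAt
  have h3 : u = u + (0 : ℝ) • w := by simp
  rw [h3] at h2
  have h4 := h2.comp_hasDerivAt (0 : ℝ) h1
  simpa [Function.comp_def, torusProj_add] using h4

theorem taylor (hψ : TorusSmooth ψ) {p : ℝ} (hp : 1 ≤ p) {ε : ℝ} (hε : 0 < ε) :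
    ∃ C, 0 ≤ C ∧ ∀ x w,
      |ψ (x + torusProj w) - ψ x - inner ℝ (torusGrad ψ x) w| ≤ ε * ‖w‖ + C * ‖w‖ ^ p := by
  obtain ⟨K, hK0, hK⟩ := hψ.exists_norm_grad_le
  have huc : UniformContinuous fun u : Tangent d => torusGrad ψ (torusProj u) := by
    refine (CompactSpace.uniformContinuous_of_continuous hψ.continuous_grad).comp ?_
    refine uniformContinuous_of_continuousAt_zero
      (AddMonoidHom.mk' (torusProj : Tangent d → Torus d) torusProj_add) ?_
    exact continuous_torusProj.continuousAt
  obtain ⟨δ, hδ, hδ'⟩ := Metric.uniformContinuous_iff.1 huc ε hε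
  refine ⟨2 * K * (1 / δ) ^ (p - 1), by positivity, fun x w => ?_⟩
  have hL := (hψ.torusLip hK).abs_sub_le x w
  have hI := (abs_real_inner_le_norm (torusGrad ψ x) w).trans
    (mul_le_mul_of_nonneg_right (hK x) (norm_nonneg w))
  rcases lt_or_ge ‖w‖ δ with hw | hw
  · obtain ⟨u, rfl⟩ := isOpenQuotientMap_torusProj.surjective x
    have h := (convex_ball u δ).norm_image_sub_le_of_norm_hasFDerivWithin_le'
      (φ := InnerProductSpace.toDual ℝ (Tangent d) (torusGrad ψ (torusProj u)))
      (fun v _ => (hψ.hasGradientAt v).hasFDerivAt.hasFDerivWithinAt)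
      (C := ε) (fun v hv => by
        rw [← map_sub, LinearIsometryEquiv.norm_map, ← dist_eq_norm]
        exact (hδ' hv).le) (Metric.mem_ball_self hδ)
      (y := u + w) (by simpa using hw)
    rw [torusProj_add, add_sub_cancel_left, InnerProductSpace.toDual_apply_apply] at h
    have h5 : 0 ≤ 2 * K * (1 / δ) ^ (p - 1) * ‖w‖ ^ p := by positivity
    rw [← Real.norm_eq_abs]
    linarith
  · have hw0 : 0 < ‖w‖ := hδ.trans_le hw
    have h6 : ‖w‖ ≤ (1 / δ) ^ (p - 1) * ‖w‖ ^ p := by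
      have h7 : ‖w‖ ^ p = ‖w‖ ^ (p - 1) * ‖w‖ := by
        rw [← Real.rpow_add_one hw0.ne', sub_add_cancel]
      rw [h7, ← mul_assoc, ← Real.mul_rpow (by positivity) hw0.le]
      have h8 : 1 ≤ 1 / δ * ‖w‖ := by
        rw [one_div, inv_mul_eq_div, one_le_div hδ]; exact hw
      have h9 := Real.one_le_rpow h8 (sub_nonneg.2 hp)
      nlinarith
    have h10 := abs_sub (ψ (x + torusProj w) - ψ x) (inner ℝ (torusGrad ψ x) w)
    have h11 : 2 * K * ‖w‖ ≤ 2 * K * ((1 / δ) ^ (p - 1) * ‖w‖ ^ p) := by gcongr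
    have h12 : 0 ≤ ε * ‖w‖ := by positivity
    linarith

end TorusSmooth

/-- Mollification of a function on the torus by a bump function. -/
noncomputable def torusMollify {d : ℕ} (ρ : ContDiffBump (0 : Tangent d)) (F : Torus d → ℝ)
    (x : Torus d) : ℝ :=
  ∫ z, ρ.normed volume z * F (x - torusProj z)

section Mollify

variable (ρ : ContDiffBump (0 : Tangent d)) {F G : Torus d → ℝ}

theorem integrable_torusMollify (hF : Continuous F) (x : Torus d) :
    Integrable fun z => ρ.normed volume z * F (x - torusProj z) := by
  refine Continuous.integrable_of_hasCompactSupport ?_ ?_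
  · exact ρ.continuous_normed.mul (hF.comp (continuous_const.sub continuous_torusProj))
  · exact ρ.hasCompactSupport_normed.mul_right

theorem torusSmooth_torusMollify (hF : Continuous F) : TorusSmooth (torusMollify ρ F) := by
  have h := ρ.hasCompactSupport_normed.contDiff_convolution_left (μ := volume)
    (ContinuousLinearMap.lsmul ℝ ℝ) (ρ.contDiff_normed (μ := volume) (n := (⊤ : ℕ∞)))
    (hF.comp continuous_torusProj).locallyIntegrable
  exact h

theorem torusMollify_sub (hF : Continuous F) (hG : Continuous G) (x : Torus d) :
    torusMollify ρ (fun y => F y - G y) x = torusMollify ρ F x - torusMollify ρ G x := by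
  simp only [torusMollify]
  rw [← integral_sub (integrable_torusMollify ρ hF x) (integrable_torusMollify ρ hG x)]
  simp only [mul_sub]

theorem torusMollify_le_add (hF : Continuous F) (hG : Continuous G) {x y : Torus d} {c : ℝ}
    (h : ∀ z, ‖z‖ < ρ.rOut → F (x - torusProj z) ≤ G (y - torusProj z) + c) :
    torusMollify ρ F x ≤ torusMollify ρ G y + c := by
  have hc : c = ∫ z, ρ.normed volume z * c := by
    rw [integral_mul_const, ρ.integral_normed, one_mul]
  have hi : Integrable fun z => ρ.normed volume z * c := ρ.integrable_normed.mul_const c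
  rw [hc, torusMollify, torusMollify, ← integral_add (integrable_torusMollify ρ hG y) hi]
  refine integral_mono (integrable_torusMollify ρ hF x)
    ((integrable_torusMollify ρ hG y).add hi) fun z => ?_
  simp only [← mul_add]
  by_cases hz : ‖z‖ < ρ.rOut
  · exact mul_le_mul_of_nonneg_left (h z hz) (ρ.nonneg_normed z)
  · have : ρ.normed volume z = 0 := by
      rw [← Function.notMem_support, ρ.support_normed_eq]
      simpa using hz
    simp [this]

theorem torusMollify_torusLip {K : ℝ} (hF : TorusLip K F) : TorusLip K (torusMollify ρ F) :=
  fun x w => torusMollify_le_add ρ hF.continuous hF.continuous fun z _ => by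
    rw [add_sub_right_comm]; exact hF _ w

theorem abs_torusMollify_sub_le (hF : Continuous F) {ε : ℝ}
    (h : ∀ x z, ‖z‖ < ρ.rOut → |F (x - torusProj z) - F x| ≤ ε) (x : Torus d) :
    |torusMollify ρ F x - F x| ≤ ε := by
  have hc : ∀ c, torusMollify ρ (fun _ : Torus d => c) x = c := fun c => by
    rw [torusMollify, integral_mul_const, ρ.integral_normed, one_mul]
  have h1 := torusMollify_le_add ρ hF (continuous_const (y := F x)) (x := x) (y := x) (c := ε)
    fun z hz => by linarith [(abs_le.1 (h x z hz)).2]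
  have h2 := torusMollify_le_add ρ (continuous_const (y := F x)) hF (x := x) (y := x) (c := ε)
    fun z hz => by linarith [(abs_le.1 (h x z hz)).1]
  rw [hc] at h1 h2
  rw [abs_le]; constructor <;> linarith

theorem exists_torusMollify_torusLip :
    ∃ L, 0 ≤ L ∧ ∀ (C : ℝ) (F : Torus d → ℝ), Continuous F → (∀ x, |F x| ≤ C) →
      TorusLip (L * C) (torusMollify ρ F) := by
  obtain ⟨K, hK⟩ := (ρ.contDiff_normed (μ := volume) (n := 1)).lipschitzWith_of_hasCompactSupport
    ρ.hasCompactSupport_normed (by simp)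
  set B : Set (Tangent d) := Metric.ball 0 ρ.rOut with hB
  have hBi : Integrable (B.indicator fun _ => (1 : ℝ)) :=
    (integrable_indicator_iff measurableSet_ball).2
      (integrableOn_const measure_ball_lt_top.ne)
  set I := ∫ z, B.indicator (fun _ => (1 : ℝ)) z with hI
  have hI0 : 0 ≤ I := integral_nonneg fun z => indicator_nonneg (fun _ _ => zero_le_one) z
  refine ⟨K * (I + I), by positivity, fun C F hF hC x w => ?_⟩
  have hC0 : 0 ≤ C := (abs_nonneg _).trans (hC 0)
  have h1 : torusMollify ρ F (x + torusProj w) =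
      ∫ z, ρ.normed volume (z + w) * F (x - torusProj z) := by
    rw [torusMollify, ← integral_add_right_eq_self _ w]
    congr 1; ext z
    rw [torusProj_add, add_sub_add_right_eq_sub]
  have hint : Integrable fun z => ρ.normed volume (z + w) * F (x - torusProj z) := by
    have := (integrable_torusMollify ρ hF (x + torusProj w)).comp_add_right w
    simpa [torusProj_add] using this
  have hBw : Integrable fun z => B.indicator (fun _ => (1 : ℝ)) (z + w) := hBi.comp_add_right w
  rw [h1, ← sub_le_iff_le_add', torusMollify, ← integral_sub hint (integrable_torusMollify ρ hF x)]
  have h2 : ∀ z, ρ.normed volume (z + w) * F (x - torusProj z) -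
      ρ.normed volume z * F (x - torusProj z) ≤
      K * ‖w‖ * C * (B.indicator (fun _ => (1 : ℝ)) z + B.indicator (fun _ => (1 : ℝ)) (z + w)) := by
    intro z
    have hl : |ρ.normed volume (z + w) - ρ.normed volume z| ≤ K * ‖w‖ := by
      simpa [Real.dist_eq] using hK.dist_le_mul (z + w) z
    have hsupp : ∀ z, z ∉ B → ρ.normed volume z = 0 := fun z hz => by
      rwa [← Function.notMem_support, ρ.support_normed_eq]
    rw [← sub_mul]
    have ha := le_abs_self ((ρ.normed volume (z + w) - ρ.normed volume z) * F (x - torusProj z))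
    rw [abs_mul] at ha
    refine ha.trans ?_
    have hb := mul_le_mul hl (hC (x - torusProj z)) (abs_nonneg _) (by positivity)
    have hpos : 0 ≤ K * ‖w‖ * C := by positivity
    by_cases hz : z ∈ B <;> by_cases hzw : z + w ∈ B <;>
      simp only [hz, hzw, indicator_of_mem, indicator_of_notMem, not_false_eq_true]
    · linarith
    · linarith
    · linarith
    · rw [hsupp z hz, hsupp _ hzw]; simp
  refine (integral_mono (hint.sub (integrable_torusMollify ρ hF x))
    ((hBi.add hBw).const_mul (K * ‖w‖ * C)) h2).trans (le_of_eq ?_)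
  simp only [Pi.add_apply]
  rw [integral_const_mul, integral_add hBi hBw, integral_add_right_eq_self (fun z => _) w]
  ring

theorem exists_smooth_approx (hF : Continuous F) {ε : ℝ} (hε : 0 < ε) :
    ∃ ψ : Torus d → ℝ, TorusSmooth ψ ∧ ∀ x, |ψ x - F x| ≤ ε := by
  have huc := CompactSpace.uniformContinuous_of_continuous hF
  obtain ⟨δ, hδ, h⟩ := Metric.uniformContinuous_iff.1 huc ε hε
  have hcont : ContinuousAt (torusProj : Tangent d → Torus d) 0 :=
    continuous_torusProj.continuousAt
  obtain ⟨r, hr, h'⟩ := Metric.continuousAt_iff.1 hcont δ hδ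
  let ρ : ContDiffBump (0 : Tangent d) := ⟨r / 2, r, by positivity, by linarith⟩
  refine ⟨torusMollify ρ F, torusSmooth_torusMollify ρ hF,
    abs_torusMollify_sub_le ρ hF fun x z hz => ?_⟩
  rw [← Real.dist_eq]
  refine (h ?_).le
  have := h' (x := z) (by simpa using hz)
  rw [torusProj_zero, dist_zero_right] at this
  rwa [dist_eq_norm, sub_sub_cancel_left, norm_neg]

end Mollify

end TorusCalculus

section RealLpNorm

variable {Ω : Type*} [MeasurableSpace Ω] {d : ℕ}

/-- The `L^p` norm of a vector field, as a real number. -/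
noncomputable def lpn (p : ℝ) (X : Ω → Tangent d) (m : Measure Ω) : ℝ :=
  (∫ x, ‖X x‖ ^ p ∂m) ^ (1 / p)

variable {p q : ℝ} {m : Measure Ω} {X Y : Ω → Tangent d}

theorem integral_norm_rpow_nonneg : 0 ≤ ∫ x, ‖X x‖ ^ p ∂m :=
  integral_nonneg fun _ => by positivity

theorem lpn_nonneg : 0 ≤ lpn p X m := Real.rpow_nonneg integral_norm_rpow_nonneg _

theorem lpn_rpow (hp : 0 < p) : lpn p X m ^ p = ∫ x, ‖X x‖ ^ p ∂m := by
  rw [lpn, ← Real.rpow_mul integral_norm_rpow_nonneg, one_div_mul_cancel hp.ne', Real.rpow_one]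

theorem lpn_le_iff (hp : 0 < p) {c : ℝ} (hc : 0 ≤ c) :
    lpn p X m ≤ c ↔ ∫ x, ‖X x‖ ^ p ∂m ≤ c ^ p := by
  rw [← lpn_rpow hp]
  exact (Real.rpow_le_rpow_iff lpn_nonneg hc hp).symm

theorem MeasureTheory.MemLp.integrable_rpow (hp : 0 < p) (hX : MemLp X (ENNReal.ofReal p) m) :
    Integrable (fun x => ‖X x‖ ^ p) m := by
  have := hX.integrable_norm_rpow (by simpa using hp) ENNReal.ofReal_ne_top
  rwa [ENNReal.toReal_ofReal hp.le] at this

theorem memLp_of_integrable_rpow (hp : 0 < p) (hX : AEStronglyMeasurable X m)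
    (h : Integrable (fun x => ‖X x‖ ^ p) m) : MemLp X (ENNReal.ofReal p) m := by
  rw [← integrable_norm_rpow_iff hX (by simpa using hp) ENNReal.ofReal_ne_top,
    ENNReal.toReal_ofReal hp.le]
  exact h

theorem eLpNorm_eq_lpn (hp : 0 < p) (hX : MemLp X (ENNReal.ofReal p) m) :
    eLpNorm X (ENNReal.ofReal p) m = ENNReal.ofReal (lpn p X m) := by
  rw [hX.eLpNorm_eq_integral_rpow_norm (by simpa using hp) ENNReal.ofReal_ne_top,
    ENNReal.toReal_ofReal hp.le, lpn, one_div]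

theorem integrable_inner_of_memLp (hpq : p.HolderConjugate q)
    (hX : MemLp X (ENNReal.ofReal p) m) (hY : MemLp Y (ENNReal.ofReal q) m) :
    Integrable (fun x => inner ℝ (X x) (Y x)) m := by
  have : ENNReal.HolderConjugate (ENNReal.ofReal p) (ENNReal.ofReal q) := hpq.ennrealOfReal
  have h := hX.norm.integrable_mul hY.norm
  exact h.mono' (hX.1.inner hY.1) (ae_of_all _ fun x => norm_inner_le_norm _ _)

theorem abs_integral_inner_le (hpq : p.HolderConjugate q)
    (hX : MemLp X (ENNReal.ofReal p) m) (hY : MemLp Y (ENNReal.ofReal q) m) :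
    |∫ x, inner ℝ (X x) (Y x) ∂m| ≤ lpn p X m * lpn q Y m := by
  have : ENNReal.HolderConjugate (ENNReal.ofReal p) (ENNReal.ofReal q) := hpq.ennrealOfReal
  refine abs_integral_le_integral_abs.trans ?_
  refine le_trans (integral_mono (integrable_inner_of_memLp hpq hX hY).norm
    (hX.norm.integrable_mul hY.norm) fun x => norm_inner_le_norm (𝕜 := ℝ) (X x) (Y x)) ?_
  have := integral_mul_le_Lp_mul_Lq_of_nonneg hpq (μ := m) (f := fun x => ‖X x‖)
    (g := fun x => ‖Y x‖) (ae_of_all _ fun x => norm_nonneg _) (ae_of_all _ fun x => norm_nonneg _)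
    hX.norm hY.norm
  exact this

theorem lpn_add_le (hp : 1 ≤ p) (hX : MemLp X (ENNReal.ofReal p) m)
    (hY : MemLp Y (ENNReal.ofReal p) m) :
    lpn p (fun x => X x + Y x) m ≤ lpn p X m + lpn p Y m := by
  have hp0 : 0 < p := by linarith
  have h := eLpNorm_add_le hX.1 hY.1 (p := ENNReal.ofReal p) (by simpa using hp)
  rw [eLpNorm_eq_lpn hp0 hX, eLpNorm_eq_lpn hp0 hY, eLpNorm_eq_lpn hp0 (hX.add hY),
    ← ENNReal.ofReal_add lpn_nonneg lpn_nonneg,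
    ENNReal.ofReal_le_ofReal_iff (add_nonneg lpn_nonneg lpn_nonneg)] at h
  exact h

theorem lpn_sub_comm : lpn p (fun x => X x - Y x) m = lpn p (fun x => Y x - X x) m := by
  simp [lpn, norm_sub_rev]

theorem lpn_le_add_sub (hp : 1 ≤ p) (hX : MemLp X (ENNReal.ofReal p) m)
    (hY : MemLp Y (ENNReal.ofReal p) m) :
    lpn p X m ≤ lpn p Y m + lpn p (fun x => X x - Y x) m := by
  have : lpn p (fun x => Y x + (X x - Y x)) m ≤ _ := lpn_add_le hp hY (hX.sub hY)
  simp only [add_sub_cancel] at this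
  exact this

theorem lpn_smul (hp : 0 < p) (c : ℝ) : lpn p (fun x => c • X x) m = |c| * lpn p X m := by
  have h : ∀ x, ‖c • X x‖ ^ p = |c| ^ p * ‖X x‖ ^ p := fun x => by
    rw [norm_smul, Real.mul_rpow (norm_nonneg _) (norm_nonneg _), Real.norm_eq_abs]
  simp only [lpn, h]
  rw [integral_const_mul, Real.mul_rpow (by positivity) integral_norm_rpow_nonneg,
    ← Real.rpow_mul (abs_nonneg c), mul_one_div_cancel hp.ne', Real.rpow_one]

theorem lpn_le_of_norm_le (hp : 0 < p) [IsProbabilityMeasure m] {K : ℝ} (hK0 : 0 ≤ K)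
    (hK : ∀ x, ‖X x‖ ≤ K) : lpn p X m ≤ K := by
  rw [lpn_le_iff hp hK0]
  calc ∫ x, ‖X x‖ ^ p ∂m ≤ ∫ _, K ^ p ∂m :=
        integral_mono_of_nonneg (ae_of_all _ fun x => by positivity) (integrable_const _)
          (ae_of_all _ fun x => Real.rpow_le_rpow (norm_nonneg _) (hK x) hp.le)
    _ = K ^ p := by simp

theorem integral_norm_le_lpn (hp : 1 ≤ p) [IsProbabilityMeasure m]
    (hX : MemLp X (ENNReal.ofReal p) m) : ∫ x, ‖X x‖ ∂m ≤ lpn p X m := by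
  have hp0 : 0 < p := by linarith
  have h := eLpNorm_le_eLpNorm_of_exponent_le (μ := m) (p := 1) (q := ENNReal.ofReal p)
    (by simpa using hp) hX.1
  have h1 : MemLp X 1 m := hX.mono_exponent (by simpa using hp)
  rw [eLpNorm_eq_lpn hp0 hX, eLpNorm_one_eq_lintegral_enorm,
    ← ofReal_integral_norm_eq_lintegral_enorm (memLp_one_iff_integrable.1 h1),
    ENNReal.ofReal_le_ofReal_iff lpn_nonneg] at h
  exact h

theorem lpn_map {Ω' : Type*} [MeasurableSpace Ω'] {f : Ω' → Ω} {m' : Measure Ω'}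
    (hf : AEMeasurable f m') (hX : AEStronglyMeasurable X (m'.map f)) :
    lpn p X (m'.map f) = lpn p (fun x => X (f x)) m' := by
  rw [lpn, lpn, integral_map hf]
  exact (hX.norm.aemeasurable.pow_const p).aestronglyMeasurable

end RealLpNorm

section Plans

variable {d : ℕ} {p : ℝ} {μ ν : ProbabilityMeasure (Torus d)}
  {π : ProbabilityMeasure (Torus d × Torus d)}

theorem memLp_of_bounded {Ω : Type*} [MeasurableSpace Ω] {m : Measure Ω} [IsFiniteMeasure m]
    {r : ℝ≥0∞} {X : Ω → Tangent d} (hX : Measurable X) {K : ℝ} (hK : ∀ x, ‖X x‖ ≤ K) :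
    MemLp X r m :=
  MemLp.of_bound hX.aestronglyMeasurable K (ae_of_all _ hK)

theorem memLp_torusDisp (m : Measure (Torus d × Torus d)) [IsFiniteMeasure m] (r : ℝ≥0∞) :
    MemLp (fun z : Torus d × Torus d => torusDisp z.1 z.2) r m := by
  obtain ⟨D, -, hD⟩ := exists_bound_torusDist d
  exact memLp_of_bounded measurable_torusDisp fun z => hD z.1 z.2

/-- The `p`-cost of a plan, as a real number. -/
noncomputable def planCostR {d : ℕ} (p : ℝ) (π : ProbabilityMeasure (Torus d × Torus d)) : ℝ :=
  lpn p (fun z : Torus d × Torus d => torusDisp z.1 z.2) (π : Measure (Torus d × Torus d))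

theorem planCost_eq (hp : 0 < p) : planCost p π = ENNReal.ofReal (planCostR p π) := by
  rw [planCostR, ← eLpNorm_eq_lpn hp (memLp_torusDisp _ _), planCost,
    eLpNorm_eq_lintegral_rpow_enorm_toReal (by simpa using hp) ENNReal.ofReal_ne_top,
    ENNReal.toReal_ofReal hp.le]
  simp only [torusDist, ofReal_norm]

theorem isTransportPlan_prod (μ ν : ProbabilityMeasure (Torus d)) :
    IsTransportPlan (μ.prod ν) μ ν :=
  ⟨ProbabilityMeasure.map_fst_prod μ ν, ProbabilityMeasure.map_snd_prod μ ν⟩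

theorem wasserstein_ne_top (hp : 0 < p) : wasserstein p μ ν ≠ ∞ := by
  refine ne_top_of_le_ne_top ?_ (iInf₂_le (μ.prod ν) (isTransportPlan_prod μ ν))
  rw [planCost_eq hp]
  exact ENNReal.ofReal_ne_top

/-- The Wasserstein distance, as a real number. -/
noncomputable def wdist {d : ℕ} (p : ℝ) (μ ν : ProbabilityMeasure (Torus d)) : ℝ :=
  (wasserstein p μ ν).toReal

theorem wdist_nonneg : 0 ≤ wdist p μ ν := ENNReal.toReal_nonneg

theorem wasserstein_eq (hp : 0 < p) : wasserstein p μ ν = ENNReal.ofReal (wdist p μ ν) :=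
  (ENNReal.ofReal_toReal (wasserstein_ne_top hp)).symm

theorem wdist_le_of_plan (hp : 0 < p) (h : IsTransportPlan π μ ν) :
    wdist p μ ν ≤ planCostR p π := by
  have h1 : wasserstein p μ ν ≤ planCost p π := iInf₂_le π h
  rw [wasserstein_eq hp, planCost_eq hp] at h1
  exact (ENNReal.ofReal_le_ofReal_iff lpn_nonneg).1 h1

theorem exists_plan_lt (hp : 0 < p) {c : ℝ} (hc : wdist p μ ν < c) :
    ∃ π, IsTransportPlan π μ ν ∧ planCostR p π < c := by
  have h1 : wasserstein p μ ν < ENNReal.ofReal c := by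
    rw [wasserstein_eq hp]
    exact (ENNReal.ofReal_lt_ofReal_iff_of_nonneg wdist_nonneg).2 hc
  simp only [wasserstein, iInf_lt_iff] at h1
  obtain ⟨π, hπ, h2⟩ := h1
  rw [planCost_eq hp] at h2
  exact ⟨π, hπ, (ENNReal.ofReal_lt_ofReal_iff_of_nonneg lpn_nonneg).1 h2⟩

theorem IsTransportPlan.map_fst (h : IsTransportPlan π μ ν) :
    (π : Measure (Torus d × Torus d)).map Prod.fst = μ := by
  rw [← h.1]; rfl

theorem IsTransportPlan.map_snd (h : IsTransportPlan π μ ν) :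
    (π : Measure (Torus d × Torus d)).map Prod.snd = ν := by
  rw [← h.2]; rfl

theorem IsTransportPlan.integral_fst {E : Type*} [NormedAddCommGroup E] [NormedSpace ℝ E]
    (h : IsTransportPlan π μ ν) {f : Torus d → E}
    (hf : AEStronglyMeasurable f (μ : Measure (Torus d))) :
    ∫ z, f z.1 ∂(π : Measure (Torus d × Torus d)) = ∫ x, f x ∂(μ : Measure (Torus d)) := by
  rw [← h.map_fst] at hf ⊢
  rw [integral_map measurable_fst.aemeasurable hf]

theorem IsTransportPlan.integral_snd {E : Type*} [NormedAddCommGroup E] [NormedSpace ℝ E]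
    (h : IsTransportPlan π μ ν) {f : Torus d → E}
    (hf : AEStronglyMeasurable f (ν : Measure (Torus d))) :
    ∫ z, f z.2 ∂(π : Measure (Torus d × Torus d)) = ∫ x, f x ∂(ν : Measure (Torus d)) := by
  rw [← h.map_snd] at hf ⊢
  rw [integral_map measurable_snd.aemeasurable hf]

theorem IsTransportPlan.memLp_fst (h : IsTransportPlan π μ ν) {r : ℝ≥0∞} {f : Torus d → Tangent d}
    (hf : MemLp f r (μ : Measure (Torus d))) :
    MemLp (fun z : Torus d × Torus d => f z.1) r (π : Measure (Torus d × Torus d)) := by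
  rw [← h.map_fst] at hf
  exact hf.comp_of_map measurable_fst.aemeasurable

theorem IsTransportPlan.lpn_fst (h : IsTransportPlan π μ ν) {r : ℝ} {f : Torus d → Tangent d}
    (hf : AEStronglyMeasurable f (μ : Measure (Torus d))) :
    lpn r (fun z : Torus d × Torus d => f z.1) (π : Measure (Torus d × Torus d)) =
      lpn r f (μ : Measure (Torus d)) := by
  rw [← h.map_fst] at hf ⊢
  rw [lpn_map measurable_fst.aemeasurable hf]

theorem IsTransportPlan.swap (h : IsTransportPlan π μ ν) :
    IsTransportPlan (π.map measurable_swap.aemeasurable) ν μ := by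
  constructor
  · rw [← h.2]
    ext1
    simp only [ProbabilityMeasure.toMeasure_map]
    rw [Measure.map_map measurable_fst measurable_swap]
    rfl
  · rw [← h.1]
    ext1
    simp only [ProbabilityMeasure.toMeasure_map]
    rw [Measure.map_map measurable_snd measurable_swap]
    rfl

theorem planCostR_swap :
    planCostR p (π.map (f := Prod.swap) measurable_swap.aemeasurable) = planCostR p π := by
  rw [planCostR, ProbabilityMeasure.toMeasure_map,
    lpn_map measurable_swap.aemeasurable measurable_torusDisp.aestronglyMeasurable]
  simp only [planCostR, lpn, Prod.fst_swap, Prod.snd_swap]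
  congr 2; ext z
  exact congrArg (· ^ p) (torusDist_comm z.2 z.1)

theorem wdist_comm (hp : 0 < p) (μ ν : ProbabilityMeasure (Torus d)) :
    wdist p μ ν = wdist p ν μ := by
  have key : ∀ μ ν : ProbabilityMeasure (Torus d), wdist p μ ν ≤ wdist p ν μ := fun μ ν =>
    le_of_forall_gt fun c hc => by
      obtain ⟨π, hπ, h⟩ := exists_plan_lt hp hc
      exact (wdist_le_of_plan hp hπ.swap).trans_lt (planCostR_swap.trans_lt h)
  exact le_antisymm (key μ ν) (key ν μ)

theorem TorusLip.abs_integral_sub_le_plan (hp : 1 ≤ p) {K : ℝ} (hK : 0 ≤ K) {F : Torus d → ℝ}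
    (hF : TorusLip K F) (h : IsTransportPlan π μ ν) :
    |∫ x, F x ∂(ν : Measure (Torus d)) - ∫ x, F x ∂(μ : Measure (Torus d))| ≤
      K * planCostR p π := by
  have hFc := hF.continuous
  obtain ⟨C, -, hC⟩ := exists_bound_of_continuous hFc
  have h1 : Integrable (fun z : Torus d × Torus d => F z.1) (π : Measure (Torus d × Torus d)) :=
    Integrable.of_bound (hFc.comp continuous_fst).aestronglyMeasurable C (ae_of_all _ fun z => hC _)
  have h2 : Integrable (fun z : Torus d × Torus d => F z.2) (π : Measure (Torus d × Torus d)) :=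
    Integrable.of_bound (hFc.comp continuous_snd).aestronglyMeasurable C (ae_of_all _ fun z => hC _)
  rw [← h.integral_fst hFc.aestronglyMeasurable, ← h.integral_snd hFc.aestronglyMeasurable,
    ← integral_sub h2 h1]
  have hL := memLp_torusDisp (d := d) (π : Measure (Torus d × Torus d)) (ENNReal.ofReal p)
  have hi : Integrable (fun z : Torus d × Torus d => ‖torusDisp z.1 z.2‖)
      (π : Measure (Torus d × Torus d)) :=
    (memLp_one_iff_integrable.1 (memLp_torusDisp _ 1)).norm
  calc |∫ z, (F z.2 - F z.1) ∂(π : Measure (Torus d × Torus d))|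
      ≤ ∫ z, |F z.2 - F z.1| ∂(π : Measure (Torus d × Torus d)) := abs_integral_le_integral_abs
    _ ≤ ∫ z, K * ‖torusDisp z.1 z.2‖ ∂(π : Measure (Torus d × Torus d)) :=
        integral_mono (h2.sub h1).abs (hi.const_mul K) fun z => hF.abs_sub_le_dist z.1 z.2
    _ ≤ K * planCostR p π := by
        rw [integral_const_mul]
        exact mul_le_mul_of_nonneg_left (integral_norm_le_lpn hp hL) hK

theorem TorusLip.abs_integral_sub_le (hp : 1 ≤ p) {K : ℝ} (hK : 0 ≤ K) {F : Torus d → ℝ}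
    (hF : TorusLip K F) (μ ν : ProbabilityMeasure (Torus d)) :
    |∫ x, F x ∂(ν : Measure (Torus d)) - ∫ x, F x ∂(μ : Measure (Torus d))| ≤
      K * wdist p μ ν := by
  refine le_of_forall_pos_le_add fun ε hε => ?_
  obtain ⟨π, hπ, h⟩ := exists_plan_lt (p := p) (by linarith) (c := wdist p μ ν + ε / (K + 1))
    (lt_add_of_pos_right _ (by positivity))
  refine (hF.abs_integral_sub_le_plan hp hK hπ).trans ?_
  have h1 := mul_le_mul_of_nonneg_left h.le hK
  have h2 : K * (ε / (K + 1)) ≤ ε := by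
    rw [mul_div_assoc', div_le_iff₀ (by positivity)]
    nlinarith
  linarith

theorem TorusSmooth.abs_integral_sub_sub_le (hp : 1 ≤ p) {ψ : Torus d → ℝ} (hψ : TorusSmooth ψ)
    {ε : ℝ} (hε : 0 < ε) : ∃ C, 0 ≤ C ∧ ∀ {μ ν : ProbabilityMeasure (Torus d)} {π},
      IsTransportPlan π μ ν →
      |∫ x, ψ x ∂(ν : Measure (Torus d)) - ∫ x, ψ x ∂(μ : Measure (Torus d)) -
        ∫ z, inner ℝ (torusGrad ψ z.1) (torusDisp z.1 z.2) ∂(π : Measure (Torus d × Torus d))| ≤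
      ε * planCostR p π + C * planCostR p π ^ p := by
  obtain ⟨C, hC0, hC⟩ := hψ.taylor hp hε
  refine ⟨C, hC0, fun {μ ν π} h => ?_⟩
  have hp0 : 0 < p := by linarith
  have hψc := hψ.continuous
  obtain ⟨B, -, hB⟩ := exists_bound_of_continuous hψc
  obtain ⟨K, hK0, hK⟩ := hψ.exists_norm_grad_le
  have h1 : Integrable (fun z : Torus d × Torus d => ψ z.1) (π : Measure (Torus d × Torus d)) :=
    Integrable.of_bound (hψc.comp continuous_fst).aestronglyMeasurable B (ae_of_all _ fun z => hB _)
  have h2 : Integrable (fun z : Torus d × Torus d => ψ z.2) (π : Measure (Torus d × Torus d)) :=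
    Integrable.of_bound (hψc.comp continuous_snd).aestronglyMeasurable B (ae_of_all _ fun z => hB _)
  have hL := memLp_torusDisp (d := d) (π : Measure (Torus d × Torus d)) (ENNReal.ofReal p)
  have hi : Integrable (fun z : Torus d × Torus d => ‖torusDisp z.1 z.2‖)
      (π : Measure (Torus d × Torus d)) :=
    (memLp_one_iff_integrable.1 (memLp_torusDisp _ 1)).norm
  have hip := hL.integrable_rpow hp0
  have h3 : Integrable (fun z : Torus d × Torus d =>
      inner ℝ (torusGrad ψ z.1) (torusDisp z.1 z.2)) (π : Measure (Torus d × Torus d)) := by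
    refine (hi.const_mul K).mono' ?_ (ae_of_all _ fun z => ?_)
    · exact ((hψ.continuous_grad.comp continuous_fst).measurable.inner
        measurable_torusDisp).aestronglyMeasurable
    · exact (norm_inner_le_norm _ _).trans (mul_le_mul_of_nonneg_right (hK _) (norm_nonneg _))
  rw [← h.integral_fst hψc.aestronglyMeasurable, ← h.integral_snd hψc.aestronglyMeasurable,
    ← integral_sub h2 h1]
  have h4 := integral_sub (h2.sub h1) h3
  simp only [Pi.sub_apply] at h4
  rw [← h4]
  calc _ ≤ ∫ z, |ψ z.2 - ψ z.1 - inner ℝ (torusGrad ψ z.1) (torusDisp z.1 z.2)|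
        ∂(π : Measure (Torus d × Torus d)) := abs_integral_le_integral_abs
    _ ≤ ∫ z, (ε * ‖torusDisp z.1 z.2‖ + C * ‖torusDisp z.1 z.2‖ ^ p)
        ∂(π : Measure (Torus d × Torus d)) := by
        refine integral_mono ((h2.sub h1).sub h3).abs ((hi.const_mul ε).add (hip.const_mul C))
          fun z => ?_
        simpa using hC z.1 (torusDisp z.1 z.2)
    _ ≤ ε * planCostR p π + C * planCostR p π ^ p := by
        rw [integral_add (hi.const_mul ε) (hip.const_mul C), integral_const_mul,
          integral_const_mul, planCostR, lpn_rpow hp0]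
        gcongr
        exact integral_norm_le_lpn hp hL

end Plans

section UniformConvexity

variable {E : Type*} [NormedAddCommGroup E] [InnerProductSpace ℝ E]

theorem norm_half_add_rpow_lt {p : ℝ} (hp : 1 < p) {a b : E} (hab : a ≠ b) :
    ‖(2⁻¹ : ℝ) • (a + b)‖ ^ p < 2⁻¹ * (‖a‖ ^ p + ‖b‖ ^ p) := by
  have hp0 : 0 < p := by linarith
  have hn : ‖(2⁻¹ : ℝ) • (a + b)‖ = 2⁻¹ * ‖a + b‖ := by
    rw [norm_smul]; norm_num
  rw [hn]
  by_cases h : ‖a‖ = ‖b‖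
  · have h1 : ‖a + b‖ < ‖a‖ + ‖b‖ := by
      refine lt_of_le_of_ne (norm_add_le a b) fun h2 => hab ?_
      have h3 := sameRay_iff_norm_add.2 h2
      have h4 := h3.norm_sub
      rw [h, sub_self, abs_zero, norm_eq_zero, sub_eq_zero] at h4
      exact h4
    have h2 : 2⁻¹ * ‖a + b‖ < ‖b‖ := by linarith
    calc (2⁻¹ * ‖a + b‖) ^ p < ‖b‖ ^ p := Real.rpow_lt_rpow (by positivity) h2 hp0
      _ = 2⁻¹ * (‖a‖ ^ p + ‖b‖ ^ p) := by rw [h]; ring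
  · have h1 := (strictConvexOn_rpow hp).2 (norm_nonneg a : ‖a‖ ∈ Ici (0 : ℝ))
      (norm_nonneg b : ‖b‖ ∈ Ici (0 : ℝ)) h
      (by norm_num : (0 : ℝ) < 2⁻¹) (by norm_num : (0 : ℝ) < 2⁻¹) (by norm_num)
    simp only [smul_eq_mul, ← mul_add] at h1
    refine lt_of_le_of_lt (Real.rpow_le_rpow (by positivity) ?_ hp0.le) h1
    gcongr
    exact norm_add_le a b

theorem exists_norm_sub_rpow_le [FiniteDimensional ℝ E] {p : ℝ} (hp : 1 < p) {ε : ℝ}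
    (hε : 0 < ε) :
    ∃ C, 0 ≤ C ∧ ∀ a b : E, ‖a - b‖ ^ p ≤ ε * (‖a‖ ^ p + ‖b‖ ^ p) +
      C * (2⁻¹ * (‖a‖ ^ p + ‖b‖ ^ p) - ‖(2⁻¹ : ℝ) • (a + b)‖ ^ p) := by
  have hp0 : 0 < p := by linarith
  have : ProperSpace E := FiniteDimensional.proper ℝ E
  have hc : Continuous fun r : ℝ => r ^ p := Real.continuous_rpow_const hp0.le
  let s : E × E → ℝ := fun z => ‖z.1‖ ^ p + ‖z.2‖ ^ p
  let f : E × E → ℝ := fun z => ‖z.1 - z.2‖ ^ p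
  let g : E × E → ℝ := fun z => 2⁻¹ * s z - ‖(2⁻¹ : ℝ) • (z.1 + z.2)‖ ^ p
  have hs : Continuous s := (hc.comp continuous_fst.norm).add (hc.comp continuous_snd.norm)
  have hf : Continuous f := hc.comp (continuous_fst.sub continuous_snd).norm
  have hg : Continuous g := (continuous_const.mul hs).sub
    (hc.comp ((continuous_fst.add continuous_snd).const_smul (2⁻¹ : ℝ)).norm)
  let T : Set (E × E) := {z | s z = 1 ∧ ε ≤ f z}
  have hTc : IsCompact T := by
    refine Metric.isCompact_of_isClosed_isBounded
      ((isClosed_eq hs continuous_const).inter (isClosed_le continuous_const hf))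
      (Metric.isBounded_closedBall (x := (0 : E × E)) (r := 1) |>.subset fun z hz => ?_)
    have h1 : ‖z.1‖ ^ p + ‖z.2‖ ^ p = 1 := hz.1
    have hle : ∀ r : ℝ, 0 ≤ r → r ^ p ≤ 1 → r ≤ 1 := fun r hr h => by
      by_contra! h2
      exact absurd h (not_le.2 (Real.one_lt_rpow h2 hp0))
    have h2 : 0 ≤ ‖z.1‖ ^ p := by positivity
    have h3 : 0 ≤ ‖z.2‖ ^ p := by positivity
    rw [mem_closedBall_zero_iff, Prod.norm_def]
    exact max_le (hle _ (norm_nonneg _) (by linarith)) (hle _ (norm_nonneg _) (by linarith))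
  have hgpos : ∀ z ∈ T, 0 < g z := fun z hz => by
    refine sub_pos.2 (norm_half_add_rpow_lt hp fun h => ?_)
    have h1 : ε ≤ ‖z.1 - z.2‖ ^ p := hz.2
    rw [h, sub_self, norm_zero, Real.zero_rpow hp0.ne'] at h1
    linarith
  have hg0 : ∀ a b : E, 0 ≤ 2⁻¹ * (‖a‖ ^ p + ‖b‖ ^ p) - ‖(2⁻¹ : ℝ) • (a + b)‖ ^ p := by
    intro a b
    rcases eq_or_ne a b with rfl | h
    · rw [← two_smul ℝ a, smul_smul]
      norm_num
      linarith
    · exact sub_nonneg.2 (norm_half_add_rpow_lt hp h).le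
  obtain ⟨C, hC0, hC⟩ : ∃ C, 0 ≤ C ∧ ∀ z ∈ T, f z ≤ C * g z := by
    obtain ⟨C, hC⟩ := hTc.exists_bound_of_continuousOn
      (f := fun z => f z / g z) (hf.continuousOn.div hg.continuousOn fun z hz => (hgpos z hz).ne')
    refine ⟨|C|, abs_nonneg C, fun z hz => ?_⟩
    rw [← div_le_iff₀ (hgpos z hz)]
    exact (le_abs_self _).trans ((hC z hz).trans (le_abs_self C))
  refine ⟨C, hC0, fun a b => ?_⟩
  rcases eq_or_ne (s (a, b)) 0 with h0 | h0
  · have h2 : 0 ≤ ‖a‖ ^ p := by positivity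
    have h3 : 0 ≤ ‖b‖ ^ p := by positivity
    have h1 : ‖a‖ ^ p + ‖b‖ ^ p = 0 := h0
    have h4 := (Real.rpow_eq_zero (norm_nonneg a) hp0.ne').1 (by linarith)
    have h5 := (Real.rpow_eq_zero (norm_nonneg b) hp0.ne').1 (by linarith)
    rw [norm_eq_zero] at h4 h5
    simp [h4, h5, Real.zero_rpow hp0.ne']
  · have hspos : 0 < s (a, b) := lt_of_le_of_ne
      (add_nonneg (by positivity) (by positivity)) h0.symm
    set l : ℝ := s (a, b) ^ (-(1 / p)) with hl
    have hlpos : 0 < l := Real.rpow_pos_of_pos hspos _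
    have hlp : l ^ p = (s (a, b))⁻¹ := by
      rw [hl, ← Real.rpow_mul hspos.le, ← Real.rpow_neg_one]
      congr 1; field_simp
    have hsc : ∀ x : E, ‖l • x‖ ^ p = (s (a, b))⁻¹ * ‖x‖ ^ p := fun x => by
      rw [norm_smul, Real.norm_of_nonneg hlpos.le, Real.mul_rpow hlpos.le (norm_nonneg x), hlp]
    have h1 : s (l • a, l • b) = 1 := by
      change ‖l • a‖ ^ p + ‖l • b‖ ^ p = 1
      rw [hsc, hsc, ← mul_add]
      exact inv_mul_cancel₀ h0
    have h2 : f (l • a, l • b) = (s (a, b))⁻¹ * f (a, b) := by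
      change ‖l • a - l • b‖ ^ p = _
      rw [← smul_sub, hsc]
    have h3 : g (l • a, l • b) = (s (a, b))⁻¹ * g (a, b) := by
      change 2⁻¹ * s (l • a, l • b) - ‖(2⁻¹ : ℝ) • (l • a + l • b)‖ ^ p =
        (s (a, b))⁻¹ * (2⁻¹ * s (a, b) - ‖(2⁻¹ : ℝ) • (a + b)‖ ^ p)
      rw [h1, ← smul_add, smul_comm, hsc]
      field_simp
    have h4 : f (l • a, l • b) ≤ ε * 1 + C * g (l • a, l • b) := by
      rcases le_or_gt ε (f (l • a, l • b)) with h | h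
      · linarith [hC _ ⟨h1, h⟩]
      · have : 0 ≤ C * g (l • a, l • b) := mul_nonneg hC0 (hg0 _ _)
        linarith
    rw [h2, h3] at h4
    have h5 := mul_le_mul_of_nonneg_left h4 hspos.le
    have h6 : s (a, b) * ((s (a, b))⁻¹ * f (a, b)) = f (a, b) := mul_inv_cancel_left₀ h0 _
    have h7 : s (a, b) * (ε * 1 + C * ((s (a, b))⁻¹ * g (a, b))) =
        ε * s (a, b) + C * g (a, b) := by
      field_simp
    rw [h6, h7] at h5
    exact h5

/-- The gradient of `‖v‖ ^ p / p`. -/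
noncomputable def pgrad (p : ℝ) (v : E) : E := ‖v‖ ^ (p - 2) • v

theorem norm_pgrad {p : ℝ} (hp : 1 < p) (v : E) : ‖pgrad p v‖ = ‖v‖ ^ (p - 1) := by
  rcases eq_or_ne v 0 with rfl | hv
  · simp [pgrad, Real.zero_rpow (sub_pos.2 hp).ne']
  · have : 0 < ‖v‖ := norm_pos_iff.2 hv
    rw [pgrad, norm_smul, Real.norm_of_nonneg (by positivity), ← Real.rpow_add_one this.ne']
    congr 1; ring

theorem inner_pgrad_self {p : ℝ} (hp : 1 < p) (v : E) : inner ℝ (pgrad p v) v = ‖v‖ ^ p := by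
  rcases eq_or_ne v 0 with rfl | hv
  · simp [pgrad, Real.zero_rpow (by linarith : p ≠ 0)]
  · have : 0 < ‖v‖ := norm_pos_iff.2 hv
    rw [pgrad, inner_smul_left, real_inner_self_eq_norm_sq, RCLike.conj_to_real,
      ← Real.rpow_natCast, ← Real.rpow_add this]
    congr 1; push_cast; ring

theorem norm_pgrad_rpow {p q : ℝ} (hpq : p.HolderConjugate q) (v : E) :
    ‖pgrad p v‖ ^ q = ‖v‖ ^ p := by
  rw [norm_pgrad hpq.lt, ← Real.rpow_mul (norm_nonneg v), hpq.sub_one_mul_conj]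

theorem pgrad_pgrad {p q : ℝ} (hpq : p.HolderConjugate q) (v : E) :
    pgrad q (pgrad p v) = v := by
  rcases eq_or_ne v 0 with rfl | hv
  · simp [pgrad]
  · have h0 : 0 < ‖v‖ := norm_pos_iff.2 hv
    rw [pgrad, norm_pgrad hpq.lt, pgrad, smul_smul, ← Real.rpow_mul h0.le, ← Real.rpow_add h0]
    have : (p - 1) * (q - 2) + (p - 2) = 0 := by
      have h1 := hpq.sub_one_mul_conj
      linarith [h1]
    rw [this, Real.rpow_zero, one_smul]

theorem continuous_pgrad {p : ℝ} (hp : 1 < p) : Continuous (pgrad p : E → E) := by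
  rw [continuous_iff_continuousAt]
  intro v
  rcases eq_or_ne v 0 with rfl | hv
  · have h0 : pgrad p (0 : E) = 0 := by simp [pgrad]
    rw [ContinuousAt, h0, tendsto_zero_iff_norm_tendsto_zero]
    simp only [norm_pgrad hp]
    have h1 := ((Real.continuous_rpow_const (sub_pos.2 hp).le).comp
      (continuous_norm (E := E))).tendsto 0
    simpa [Function.comp_def, Real.zero_rpow (sub_pos.2 hp).ne'] using h1
  · exact (continuousAt_id.norm.rpow_const (Or.inl (norm_ne_zero_iff.2 hv))).smul continuousAt_id

theorem norm_rpow_add_inner_pgrad_le {p : ℝ} (hp : 1 < p) (v x : E) :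
    ‖v‖ ^ p + p * inner ℝ (pgrad p v) (x - v) ≤ ‖x‖ ^ p := by
  have hpq := Real.HolderConjugate.conjExponent hp
  set q := p.conjExponent
  have h1 : inner ℝ (pgrad p v) x ≤ ‖v‖ ^ p / q + ‖x‖ ^ p / p := by
    refine (real_inner_le_norm _ _).trans ?_
    have := Real.young_inequality_of_nonneg (norm_nonneg (pgrad p v)) (norm_nonneg x) hpq.symm
    rwa [norm_pgrad_rpow hpq] at this
  rw [inner_sub_right, inner_pgrad_self hp]
  have h2 := mul_le_mul_of_nonneg_left h1 hpq.pos.le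
  have h3 : p * (‖v‖ ^ p / q + ‖x‖ ^ p / p) = (p - 1) * ‖v‖ ^ p + ‖x‖ ^ p := by
    have h4 : p / q = p - 1 := by
      rw [div_eq_iff hpq.symm.pos.ne', hpq.sub_one_mul_conj]
    rw [mul_add, mul_div_cancel₀ _ hpq.pos.ne', mul_div_left_comm, h4]
    ring
  rw [h3] at h2
  linarith

theorem exists_norm_sub_rpow_le_bregman [FiniteDimensional ℝ E] {p : ℝ} (hp : 1 < p) {ε : ℝ}
    (hε : 0 < ε) :
    ∃ C, 0 ≤ C ∧ ∀ x v : E, ‖x - v‖ ^ p ≤ ε * (‖x‖ ^ p + ‖v‖ ^ p) +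
      C * (‖x‖ ^ p - ‖v‖ ^ p - p * inner ℝ (pgrad p v) (x - v)) := by
  obtain ⟨C, hC0, hC⟩ := exists_norm_sub_rpow_le (E := E) hp hε
  refine ⟨C / 2, by positivity, fun x v => (hC x v).trans ?_⟩
  have h := norm_rpow_add_inner_pgrad_le hp v ((2⁻¹ : ℝ) • (x + v))
  have h1 : (2⁻¹ : ℝ) • (x + v) - v = (2⁻¹ : ℝ) • (x - v) := by module
  rw [h1, inner_smul_right] at h
  rw [div_mul_eq_mul_div, mul_div_assoc]
  gcongr
  linarith

end UniformConvexity

section IntegratedConvexity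

variable {Ω : Type*} [MeasurableSpace Ω] {d : ℕ} {m : Measure Ω} {p q : ℝ}

theorem MeasureTheory.MemLp.pgrad (hpq : p.HolderConjugate q) {v : Ω → Tangent d}
    (hv : MemLp v (ENNReal.ofReal p) m) :
    MemLp (fun x => pgrad p (v x)) (ENNReal.ofReal q) m := by
  refine memLp_of_integrable_rpow hpq.symm.pos
    ((continuous_pgrad hpq.lt).comp_aestronglyMeasurable hv.1) ?_
  simp only [norm_pgrad_rpow hpq]
  exact hv.integrable_rpow hpq.pos

theorem exists_integral_norm_sub_rpow_le (hp : 1 < p) {ε : ℝ} (hε : 0 < ε) (d : ℕ) :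
    ∃ C, 0 ≤ C ∧ ∀ (Ω : Type) [MeasurableSpace Ω] (m : Measure Ω) (X Y : Ω → Tangent d),
      MemLp X (ENNReal.ofReal p) m → MemLp Y (ENNReal.ofReal p) m →
      ∫ x, ‖X x - Y x‖ ^ p ∂m ≤ ε * (∫ x, ‖X x‖ ^ p ∂m + ∫ x, ‖Y x‖ ^ p ∂m) +
        C * (2⁻¹ * (∫ x, ‖X x‖ ^ p ∂m + ∫ x, ‖Y x‖ ^ p ∂m) -
          ∫ x, ‖(2⁻¹ : ℝ) • (X x + Y x)‖ ^ p ∂m) := by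
  have hp0 : 0 < p := by linarith
  obtain ⟨C, hC0, hC⟩ := exists_norm_sub_rpow_le (E := Tangent d) hp hε
  refine ⟨C, hC0, fun Ω _ m X Y hX hY => ?_⟩
  have h1 := hX.integrable_rpow hp0
  have h2 := hY.integrable_rpow hp0
  have h3 : Integrable (fun x => ‖(2⁻¹ : ℝ) • (X x + Y x)‖ ^ p) m :=
    ((hX.add hY).const_smul (2⁻¹ : ℝ)).integrable_rpow hp0
  have h4 : Integrable (fun x => ‖X x - Y x‖ ^ p) m := (hX.sub hY).integrable_rpow hp0
  have h12 : Integrable (fun x => ‖X x‖ ^ p + ‖Y x‖ ^ p) m := h1.add h2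
  have h5 : Integrable (fun x => 2⁻¹ * (‖X x‖ ^ p + ‖Y x‖ ^ p) -
      ‖(2⁻¹ : ℝ) • (X x + Y x)‖ ^ p) m := (h12.const_mul 2⁻¹).sub h3
  refine (integral_mono h4 ((h12.const_mul ε).add (h5.const_mul C))
    fun x => hC (X x) (Y x)).trans (le_of_eq ?_)
  simp only [Pi.add_apply]
  rw [integral_add (h12.const_mul ε) (h5.const_mul C), integral_const_mul, integral_const_mul,
    integral_sub (h12.const_mul 2⁻¹) h3, integral_const_mul, integral_add h1 h2]

theorem exists_integral_norm_sub_rpow_le_bregman (hpq : p.HolderConjugate q) {ε : ℝ} (hε : 0 < ε)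
    (d : ℕ) :
    ∃ C, 0 ≤ C ∧ ∀ (Ω : Type) [MeasurableSpace Ω] (m : Measure Ω) (X v : Ω → Tangent d),
      MemLp X (ENNReal.ofReal p) m → MemLp v (ENNReal.ofReal p) m →
      ∫ x, ‖X x - v x‖ ^ p ∂m ≤ ε * (∫ x, ‖X x‖ ^ p ∂m + ∫ x, ‖v x‖ ^ p ∂m) +
        C * (∫ x, ‖X x‖ ^ p ∂m - ∫ x, ‖v x‖ ^ p ∂m -
          p * (∫ x, inner ℝ (pgrad p (v x)) (X x) ∂m - ∫ x, ‖v x‖ ^ p ∂m)) := by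
  have hp0 := hpq.pos
  obtain ⟨C, hC0, hC⟩ := exists_norm_sub_rpow_le_bregman (E := Tangent d) hpq.lt hε
  refine ⟨C, hC0, fun Ω _ m X v hX hv => ?_⟩
  have h1 := hX.integrable_rpow hp0
  have h2 := hv.integrable_rpow hp0
  have h3 := integrable_inner_of_memLp hpq.symm (hv.pgrad hpq) hX
  have h4 : Integrable (fun x => ‖X x - v x‖ ^ p) m := (hX.sub hv).integrable_rpow hp0
  have h12 : Integrable (fun x => ‖X x‖ ^ p + ‖v x‖ ^ p) m := h1.add h2
  have h6 : Integrable (fun x => inner ℝ (pgrad p (v x)) (X x) - ‖v x‖ ^ p) m := h3.sub h2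
  have h7 : Integrable (fun x => ‖X x‖ ^ p - ‖v x‖ ^ p) m := h1.sub h2
  have h5 : Integrable (fun x => ‖X x‖ ^ p - ‖v x‖ ^ p -
      p * (inner ℝ (pgrad p (v x)) (X x) - ‖v x‖ ^ p)) m := h7.sub (h6.const_mul p)
  refine (integral_mono h4 ((h12.const_mul ε).add (h5.const_mul C)) fun x => ?_).trans
    (le_of_eq ?_)
  · have := hC (X x) (v x)
    rwa [inner_sub_right, inner_pgrad_self hpq.lt] at this
  · simp only [Pi.add_apply]
    rw [integral_add (h12.const_mul ε) (h5.const_mul C), integral_const_mul, integral_const_mul,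
      integral_sub h7 (h6.const_mul p), integral_const_mul, integral_add h1 h2,
      integral_sub h1 h2, integral_sub h3 h2]

end IntegratedConvexity

section Duality

variable {d : ℕ}

/-- The values of the relaxed dual problem with obstacle `h`. -/
def dualValues (μ ν : Measure (Torus d)) (c : C(Torus d × Torus d, ℝ)) (S : ℝ)
    (h : C(Torus d × Torus d, ℝ)) : Set ℝ :=
  {v | ∃ φ χ : C(Torus d, ℝ), ∃ r : ℝ, 0 ≤ r ∧ (∀ x y, h (x, y) ≤ φ x + χ y + r * c (x, y)) ∧
    v = ∫ x, φ x ∂μ + ∫ y, χ y ∂ν + r * S}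

variable {μ ν : ProbabilityMeasure (Torus d)} {c : C(Torus d × Torus d, ℝ)} {S : ℝ}

theorem ContinuousMap.integrable_torus (φ : C(Torus d, ℝ)) (m : Measure (Torus d))
    [IsFiniteMeasure m] : Integrable (fun x => φ x) m :=
  Integrable.of_bound φ.continuous.aestronglyMeasurable ‖φ‖ (ae_of_all _ fun x => φ.norm_coe_le_norm x)

theorem neg_norm_le_of_mem_dualValues
    (hS : ∀ φ χ : C(Torus d, ℝ), (∀ x y, φ x + χ y ≤ c (x, y)) →
      ∫ x, φ x ∂(μ : Measure (Torus d)) + ∫ y, χ y ∂(ν : Measure (Torus d)) ≤ S)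
    {h : C(Torus d × Torus d, ℝ)} {v : ℝ} (hv : v ∈ dualValues μ ν c S h) : -‖h‖ ≤ v := by
  obtain ⟨φ, χ, r, hr, hle, rfl⟩ := hv
  have hφ := φ.integrable_torus (μ : Measure (Torus d))
  have hχ := χ.integrable_torus (ν : Measure (Torus d))
  have hn : ∀ x y, -‖h‖ ≤ h (x, y) := fun x y => (abs_le.1 (h.norm_coe_le_norm (x, y))).1
  rcases hr.eq_or_lt with rfl | hr0
  · have h1 : ∀ y, -‖h‖ - χ y ≤ ∫ x, φ x ∂(μ : Measure (Torus d)) := fun y => by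
      have := integral_mono (integrable_const (-‖h‖ - χ y)) hφ (fun x => by
        have := hle x y
        have := hn x y
        simp only
        linarith)
      simpa using this
    have h2 := integral_mono (integrable_const (-‖h‖ - ∫ x, φ x ∂(μ : Measure (Torus d)))) hχ
      (fun y => by have := h1 y; simp only; linarith)
    simp only [integral_const, probReal_univ, one_smul] at h2
    linarith
  · have h1 := hS (r⁻¹ • (-φ - ContinuousMap.const _ ‖h‖)) (r⁻¹ • (-χ)) fun x y => by
      have h2 := hle x y
      have h3 := hn x y
      simp only [ContinuousMap.smul_apply, ContinuousMap.sub_apply, ContinuousMap.neg_apply,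
        ContinuousMap.const_apply, smul_eq_mul]
      rw [← mul_add, inv_mul_le_iff₀ hr0]
      linarith
    simp only [ContinuousMap.smul_apply, ContinuousMap.sub_apply, ContinuousMap.neg_apply,
      ContinuousMap.const_apply, smul_eq_mul] at h1
    rw [integral_const_mul, integral_const_mul,
      integral_sub (f := fun x => -φ x) hφ.neg (integrable_const _), integral_neg, integral_neg, ← mul_add, inv_mul_le_iff₀ hr0] at h1
    simp only [integral_const, probReal_univ, one_smul] at h1
    linarith

/-- Kantorovich duality on the torus, existence part. -/
theorem exists_plan_integral_le
    (hS : ∀ φ χ : C(Torus d, ℝ), (∀ x y, φ x + χ y ≤ c (x, y)) →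
      ∫ x, φ x ∂(μ : Measure (Torus d)) + ∫ y, χ y ∂(ν : Measure (Torus d)) ≤ S) :
    ∃ π, IsTransportPlan π μ ν ∧ ∫ z, c z ∂(π : Measure (Torus d × Torus d)) ≤ S := by
  let D := dualValues (μ : Measure (Torus d)) ν c S
  let N : C(Torus d × Torus d, ℝ) → ℝ := fun h => sInf (D h)
  have hne : ∀ h, (D h).Nonempty := fun h =>
    ⟨_, ContinuousMap.const _ ‖h‖, 0, 0, le_rfl, fun x y => by
      simpa using (le_abs_self _).trans (h.norm_coe_le_norm (x, y)), rfl⟩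
  have hbdd : ∀ h, BddBelow (D h) := fun h =>
    ⟨-‖h‖, fun v hv => neg_norm_le_of_mem_dualValues hS hv⟩
  have hN : ∀ h v, v ∈ D h → N h ≤ v := fun h v hv => csInf_le (hbdd h) hv
  have hsmul : ∀ r : ℝ, 0 < r → ∀ h, N (r • h) ≤ r * N h := by
    intro r hr h
    rw [← inv_mul_le_iff₀ hr]
    refine le_csInf (hne h) ?_
    rintro v ⟨φ, χ, s, hs, hle, rfl⟩
    rw [inv_mul_le_iff₀ hr]
    refine hN _ _ ⟨r • φ, r • χ, r * s, by positivity, fun x y => ?_, ?_⟩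
    · have := mul_le_mul_of_nonneg_left (hle x y) hr.le
      simp only [ContinuousMap.smul_apply, smul_eq_mul]
      linarith
    · simp only [ContinuousMap.smul_apply, smul_eq_mul]
      rw [integral_const_mul, integral_const_mul]
      ring
  have hhom : ∀ r : ℝ, 0 < r → ∀ h, N (r • h) = r * N h := by
    intro r hr h
    refine le_antisymm (hsmul r hr h) ?_
    have := hsmul r⁻¹ (inv_pos.2 hr) (r • h)
    rwa [smul_smul, inv_mul_cancel₀ hr.ne', one_smul, le_inv_mul_iff₀ hr] at this
  have hadd : ∀ h k, N (h + k) ≤ N h + N k := by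
    intro h k
    have key : ∀ v ∈ D h, ∀ w ∈ D k, N (h + k) ≤ v + w := by
      rintro v ⟨φ, χ, s, hs, hle, rfl⟩ w ⟨φ', χ', s', hs', hle', rfl⟩
      refine hN _ _ ⟨φ + φ', χ + χ', s + s', by positivity, fun x y => ?_, ?_⟩
      · have h1 := hle x y
        have h2 := hle' x y
        simp only [ContinuousMap.add_apply]
        linarith
      · simp only [ContinuousMap.add_apply]
        rw [integral_add (φ.integrable_torus _) (φ'.integrable_torus _),
          integral_add (χ.integrable_torus _) (χ'.integrable_torus _)]
        ring
    have h1 : ∀ w ∈ D k, N (h + k) - w ≤ N h := fun w hw =>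
      le_csInf (hne h) fun v hv => by linarith [key v hv w hw]
    have h2 : N (h + k) - N h ≤ N k := le_csInf (hne k) fun w hw => by linarith [h1 w hw]
    linarith
  obtain ⟨g, -, hg⟩ := exists_extension_of_le_sublinear
    (⊥ : C(Torus d × Torus d, ℝ) →ₗ.[ℝ] ℝ) N hhom hadd (fun x => by
      have hx : (x : C(Torus d × Torus d, ℝ)) = 0 := (Submodule.mem_bot ℝ).1 x.2
      have h0 : N 0 = 0 := by
        have := hhom 2 two_pos 0
        rw [smul_zero] at this
        linarith
      have hx' : x = 0 := Subtype.ext hx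
      rw [hx', LinearPMap.map_zero]
      simp [h0])
  have hgc : g c ≤ S := (hg c).trans (hN _ _
    ⟨0, 0, 1, zero_le_one, fun x y => by simp, by simp⟩)
  have hgpos : ∀ h : C(Torus d × Torus d, ℝ), 0 ≤ h → 0 ≤ g h := fun h hh => by
    have := (hg (-h)).trans (hN _ 0 ⟨0, 0, 0, le_rfl, fun x y => by simpa using hh (x, y), by simp⟩)
    rw [map_neg] at this
    linarith
  have hgfst : ∀ φ : C(Torus d, ℝ),
      g (φ.comp ContinuousMap.fst) = ∫ x, φ x ∂(μ : Measure (Torus d)) := by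
    have key : ∀ φ : C(Torus d, ℝ),
        g (φ.comp ContinuousMap.fst) ≤ ∫ x, φ x ∂(μ : Measure (Torus d)) := fun φ =>
      (hg _).trans (hN _ _ ⟨φ, 0, 0, le_rfl, fun x y => by simp, by simp⟩)
    intro φ
    refine le_antisymm (key φ) ?_
    have h1 := key (-φ)
    have h2 : (-φ).comp (ContinuousMap.fst (α := Torus d) (β := Torus d)) =
      -(φ.comp ContinuousMap.fst) := rfl
    rw [h2, map_neg] at h1
    simp only [ContinuousMap.neg_apply] at h1
    rw [integral_neg] at h1
    linarith
  have hgsnd : ∀ χ : C(Torus d, ℝ),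
      g (χ.comp ContinuousMap.snd) = ∫ x, χ x ∂(ν : Measure (Torus d)) := by
    have key : ∀ φ : C(Torus d, ℝ),
        g (φ.comp ContinuousMap.snd) ≤ ∫ x, φ x ∂(ν : Measure (Torus d)) := fun φ =>
      (hg _).trans (hN _ _ ⟨0, φ, 0, le_rfl, fun x y => by simp, by simp⟩)
    intro φ
    refine le_antisymm (key φ) ?_
    have h1 := key (-φ)
    have h2 : (-φ).comp (ContinuousMap.snd (α := Torus d) (β := Torus d)) =
      -(φ.comp ContinuousMap.snd) := rfl
    rw [h2, map_neg] at h1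
    simp only [ContinuousMap.neg_apply] at h1
    rw [integral_neg] at h1
    linarith
  let Λ : CompactlySupportedContinuousMap (Torus d × Torus d) ℝ →ₚ[ℝ] ℝ := PositiveLinearMap.mk₀
    { toFun := fun f => g f.toContinuousMap
      map_add' := fun f f' => g.map_add f.toContinuousMap f'.toContinuousMap
      map_smul' := fun r f => g.map_smul r f.toContinuousMap }
    (fun f hf => hgpos f.toContinuousMap fun z => hf z)
  set M := RealRMK.rieszMeasure Λ with hM
  have hint : ∀ f : C(Torus d × Torus d, ℝ), ∫ z, f z ∂M = g f := fun f =>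
    RealRMK.integral_rieszMeasure Λ (CompactlySupportedContinuousMap.continuousMapEquiv f)
  have hMfin : IsFiniteMeasure M := by
    have : M.Regular := RealRMK.regular_rieszMeasure Λ
    infer_instance
  have hMprob : IsProbabilityMeasure M := by
    have h1 : ∫ _ : Torus d × Torus d, (1 : ℝ) ∂M = 1 := by
      have h2 := hint (ContinuousMap.const _ 1)
      have h3 := hgfst (ContinuousMap.const _ 1)
      simp only [ContinuousMap.const_apply, integral_const, probReal_univ, one_smul] at h3
      exact h2.trans h3
    rw [integral_const, smul_eq_mul, mul_one] at h1
    exact ⟨by rw [← ENNReal.toReal_eq_one_iff]; exact h1⟩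
  let π₀ : ProbabilityMeasure (Torus d × Torus d) := ⟨M, hMprob⟩
  refine ⟨π₀, ⟨?_, ?_⟩, ?_⟩
  · apply Subtype.ext
    change M.map Prod.fst = (μ : Measure (Torus d))
    have hmp : IsProbabilityMeasure (M.map Prod.fst) :=
      Measure.isProbabilityMeasure_map measurable_fst.aemeasurable
    refine ext_of_forall_integral_eq_of_IsFiniteMeasure fun φ => ?_
    rw [integral_map measurable_fst.aemeasurable
      φ.continuous.aestronglyMeasurable]
    exact (hint (φ.toContinuousMap.comp ContinuousMap.fst)).trans (hgfst φ.toContinuousMap)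
  · apply Subtype.ext
    change M.map Prod.snd = (ν : Measure (Torus d))
    have hmp : IsProbabilityMeasure (M.map Prod.snd) :=
      Measure.isProbabilityMeasure_map measurable_snd.aemeasurable
    refine ext_of_forall_integral_eq_of_IsFiniteMeasure fun φ => ?_
    rw [integral_map measurable_snd.aemeasurable
      φ.continuous.aestronglyMeasurable]
    exact (hint (φ.toContinuousMap.comp ContinuousMap.snd)).trans (hgsnd φ.toContinuousMap)
  · exact (hint c).trans_le hgc

theorem wdist_rpow_le_of_dual {p : ℝ} (hp : 1 ≤ p) {S : ℝ}
    (hS : ∀ φ χ : C(Torus d, ℝ), (∀ x y, φ x + χ y ≤ torusDist x y ^ p) →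
      ∫ x, φ x ∂(μ : Measure (Torus d)) + ∫ y, χ y ∂(ν : Measure (Torus d)) ≤ S) :
    wdist p μ ν ^ p ≤ S := by
  have hp0 : 0 < p := by linarith
  obtain ⟨π, hπ, h⟩ := exists_plan_integral_le (μ := μ) (ν := ν) (S := S)
    (c := ⟨fun z => torusDist z.1 z.2 ^ p,
      (Real.continuous_rpow_const hp0.le).comp continuous_torusDist⟩) hS
  calc wdist p μ ν ^ p ≤ planCostR p π ^ p :=
        Real.rpow_le_rpow wdist_nonneg (wdist_le_of_plan hp0 hπ) hp0.le
    _ ≤ S := by rw [planCostR, lpn_rpow hp0]; exact h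

end Duality

section HopfLax

variable {d : ℕ}

/-- The Hopf-Lax semigroup of the Hamiltonian `‖·‖ ^ q / q`, on the torus. -/
noncomputable def hopfLax {d : ℕ} (p : ℝ) (f : Torus d → ℝ) (s : ℝ) (x : Torus d) : ℝ :=
  ⨅ w : Tangent d, (f (x - torusProj (s • w)) + s * (‖w‖ ^ p / p))

variable {p K : ℝ} {f : Torus d → ℝ} {s k : ℝ}

theorem hopfLax_le (hp : 0 < p) (hf : Continuous f) (hs : 0 ≤ s) (x : Torus d) (w : Tangent d) :
    hopfLax p f s x ≤ f (x - torusProj (s • w)) + s * (‖w‖ ^ p / p) := by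
  obtain ⟨B, -, hB⟩ := exists_bound_of_continuous hf
  refine ciInf_le ⟨-B, ?_⟩ w
  rintro _ ⟨w, rfl⟩
  have h1 := (abs_le.1 (hB (x - torusProj (s • w)))).1
  have h2 : 0 ≤ s * (‖w‖ ^ p / p) := by positivity
  simp only
  linarith

theorem le_hopfLax {c : ℝ} {x : Torus d}
    (h : ∀ w, c ≤ f (x - torusProj (s • w)) + s * (‖w‖ ^ p / p)) : c ≤ hopfLax p f s x :=
  le_ciInf h

theorem hopfLax_zero (hp : 0 < p) (hf : Continuous f) (x : Torus d) : hopfLax p f 0 x = f x := by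
  refine le_antisymm ?_ (le_hopfLax fun w => ?_)
  · simpa [torusProj_zero] using hopfLax_le hp hf le_rfl x 0
  · simp [torusProj_zero]

theorem hopfLax_torusLip (hp : 0 < p) (hf : TorusLip K f) (hs : 0 ≤ s) :
    TorusLip K (hopfLax p f s) := by
  intro x w
  rw [← sub_le_iff_le_add]
  refine le_hopfLax fun w' => ?_
  have h1 := hopfLax_le hp hf.continuous hs (x + torusProj w) w'
  have h2 := hf (x - torusProj (s • w')) w
  rw [sub_add_eq_add_sub] at h2
  linarith

theorem hopfLax_step (hp : 1 ≤ p) (hf : Continuous f) (hs : 0 ≤ s) (hk : 0 ≤ k) (x : Torus d)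
    (w : Tangent d) :
    hopfLax p f (s + k) (x + torusProj (k • w)) ≤ hopfLax p f s x + k * (‖w‖ ^ p / p) := by
  have hp0 : 0 < p := by linarith
  rcases (add_nonneg hs hk).eq_or_lt with h0 | h0
  · have h1 : s = 0 := by linarith
    have h2 : k = 0 := by linarith
    simp [h1, h2, torusProj_zero]
  rw [← sub_le_iff_le_add]
  refine le_hopfLax fun w' => ?_
  have h1 := hopfLax_le hp0 hf h0.le (x + torusProj (k • w))
    ((s / (s + k)) • w' + (k / (s + k)) • w)
  have h2 : (s + k) • ((s / (s + k)) • w' + (k / (s + k)) • w) = s • w' + k • w := by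
    rw [smul_add, smul_smul, smul_smul, mul_div_cancel₀ _ h0.ne', mul_div_cancel₀ _ h0.ne']
  rw [h2, torusProj_add, add_sub_add_right_eq_sub] at h1
  have h3 : ‖(s / (s + k)) • w' + (k / (s + k)) • w‖ ^ p ≤
      s / (s + k) * ‖w'‖ ^ p + k / (s + k) * ‖w‖ ^ p := by
    have ha : 0 ≤ s / (s + k) := by positivity
    have hb : 0 ≤ k / (s + k) := by positivity
    have hab : s / (s + k) + k / (s + k) = 1 := by rw [← add_div, div_self h0.ne']
    have h4 := (convexOn_rpow hp).2 (norm_nonneg w' : ‖w'‖ ∈ Ici (0 : ℝ))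
      (norm_nonneg w : ‖w‖ ∈ Ici (0 : ℝ)) ha hb hab
    simp only [smul_eq_mul] at h4
    refine le_trans (Real.rpow_le_rpow (norm_nonneg _) ?_ hp0.le) h4
    refine (norm_add_le _ _).trans (le_of_eq ?_)
    rw [norm_smul, norm_smul, Real.norm_of_nonneg ha, Real.norm_of_nonneg hb]
  have h5 := mul_le_mul_of_nonneg_left h3 (show 0 ≤ (s + k) / p by positivity)
  have h6 : (s + k) / p * (s / (s + k) * ‖w'‖ ^ p + k / (s + k) * ‖w‖ ^ p) =
      s * (‖w'‖ ^ p / p) + k * (‖w‖ ^ p / p) := by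
    field_simp
  rw [h6, div_mul_eq_mul_div, mul_div_assoc] at h5
  linarith

theorem hopfLax_add_le (hp : 1 ≤ p) (hf : Continuous f) (hs : 0 ≤ s) (hk : 0 ≤ k) (x : Torus d) :
    hopfLax p f (s + k) x ≤ hopfLax p f s x := by
  have := hopfLax_step hp hf hs hk x 0
  simpa [torusProj_zero, Real.zero_rpow (by linarith : p ≠ 0)] using this

theorem hopfLax_le_add {q : ℝ} (hpq : p.HolderConjugate q) (hK : 0 ≤ K) (hf : TorusLip K f)
    (hs : 0 ≤ s) (hk : 0 ≤ k) (x : Torus d) :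
    hopfLax p f s x ≤ hopfLax p f (s + k) x + K ^ q / q * k := by
  rw [← sub_le_iff_le_add]
  refine le_hopfLax fun w => ?_
  have h1 := hopfLax_le hpq.pos hf.continuous hs x w
  have h2 := hf (x - torusProj ((s + k) • w)) (k • w)
  rw [add_smul, torusProj_add, ← sub_sub, sub_add_cancel, norm_smul, Real.norm_of_nonneg hk] at h2
  have h3 := Real.young_inequality_of_nonneg (norm_nonneg w) hK hpq
  have h4 := mul_le_mul_of_nonneg_left h3 hk
  rw [add_smul, torusProj_add, ← sub_sub]
  linarith

theorem abs_hopfLax_sub_le {q : ℝ} (hpq : p.HolderConjugate q) (hK : 0 ≤ K) (hf : TorusLip K f)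
    {s s' : ℝ} (hs : 0 ≤ s) (hs' : 0 ≤ s') (x : Torus d) :
    |hopfLax p f s x - hopfLax p f s' x| ≤ K ^ q / q * |s - s'| := by
  wlog h : s ≤ s' generalizing s s'
  · rw [abs_sub_comm, abs_sub_comm s]
    exact this hs' hs (le_of_not_ge h)
  have h1 := hopfLax_le_add hpq hK hf hs (sub_nonneg.2 h) x
  have h2 := hopfLax_add_le hpq.lt.le hf.continuous hs (sub_nonneg.2 h) x
  rw [add_sub_cancel] at h1 h2
  rw [abs_sub_comm s, abs_of_nonneg (sub_nonneg.2 h), abs_of_nonneg (by linarith)]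
  linarith

/-- Smooth-in-space subsolutions of the Hamilton-Jacobi equation `∂ₛ u + ‖∇u‖ ^ q / q = 0`,
in integrated form. -/
structure IsHJSubsolution {d : ℕ} (p K C : ℝ) (u : ℝ → Torus d → ℝ) : Prop where
  smooth : ∀ s, TorusSmooth (u s)
  lip : ∀ s, TorusLip K (u s)
  time : ∀ s s' x, |u s x - u s' x| ≤ C * |s - s'|
  time_lip : ∀ s s', TorusLip (C * |s - s'|) fun x => u s x - u s' x
  step : ∀ s k, 0 ≤ s → 0 ≤ k → ∀ x w,
    u (s + k) (x + torusProj (k • w)) ≤ u s x + k * (‖w‖ ^ p / p)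

theorem exists_hjSubsolution {q : ℝ} (hpq : p.HolderConjugate q) {φ χ : Torus d → ℝ}
    (hφ : Continuous φ) (hle : ∀ x y, φ x + χ y ≤ torusDist x y ^ p) {T δ : ℝ} (hT : 0 < T)
    (hδ : 0 < δ) :
    ∃ (K C : ℝ) (u : ℝ → Torus d → ℝ), 0 ≤ K ∧ 0 ≤ C ∧ IsHJSubsolution p K C u ∧
      (∀ x, u 0 x ≤ -(T ^ (1 - p) / p * φ x) + δ) ∧
      ∀ y, T ^ (1 - p) / p * χ y - δ ≤ u T y := by
  have hp0 := hpq.pos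
  set c := T ^ (1 - p) / p with hc
  have hc0 : 0 ≤ c := by positivity
  obtain ⟨f, hf, hfa⟩ := exists_smooth_approx (F := fun x => -(c * φ x))
    (continuous_const.mul hφ).neg (half_pos hδ)
  obtain ⟨K, hK0, hK⟩ := hf.exists_norm_grad_le
  have hL : TorusLip K f := hf.torusLip hK
  have hfc := hf.continuous
  set r := δ / (2 * (K + 1)) with hr
  have hr0 : 0 < r := by positivity
  have hKr : K * r ≤ δ / 2 := by
    rw [hr, mul_div_assoc', div_le_div_iff₀ (by positivity) two_pos]
    nlinarith
  let ρ : ContDiffBump (0 : Tangent d) := ⟨r / 2, r, by positivity, by linarith⟩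
  obtain ⟨L, hL0, hLm⟩ := exists_torusMollify_torusLip ρ
  have hQ : ∀ s, TorusLip K (hopfLax p f (max s 0)) := fun s =>
    hopfLax_torusLip hp0 hL (le_max_right _ _)
  have hQc : ∀ s, Continuous (hopfLax p f (max s 0)) := fun s => (hQ s).continuous
  set A := K ^ q / q with hA
  have hq0 := hpq.symm.pos
  have hA0 : 0 ≤ A := by positivity
  have hQt : ∀ s s' x, |hopfLax p f (max s 0) x - hopfLax p f (max s' 0) x| ≤ A * |s - s'| :=
    fun s s' x => (abs_hopfLax_sub_le hpq hK0 hL (le_max_right _ _) (le_max_right _ _) x).trans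
      (mul_le_mul_of_nonneg_left (abs_max_sub_max_le_abs _ _ _) hA0)
  have hosc : ∀ s x, |torusMollify ρ (hopfLax p f (max s 0)) x - hopfLax p f (max s 0) x| ≤
      δ / 2 := fun s => abs_torusMollify_sub_le ρ (hQc s) fun x z hz => by
    have h1 := (hQ s).abs_sub_le x (-z)
    rw [torusProj_neg, ← sub_eq_add_neg, norm_neg] at h1
    exact h1.trans ((mul_le_mul_of_nonneg_left hz.le hK0).trans hKr)
  refine ⟨K, A + L * A, fun s => torusMollify ρ (hopfLax p f (max s 0)), hK0, by positivity,
    ⟨fun s => torusSmooth_torusMollify ρ (hQc s), fun s => torusMollify_torusLip ρ (hQ s),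
    fun s s' x => ?_, fun s s' => ?_, fun s k hs hk x w => ?_⟩, fun x => ?_, fun y => ?_⟩
  · have h1 := torusMollify_le_add ρ (hQc s) (hQc s') (x := x) (y := x) (c := A * |s - s'|)
      fun z _ => by linarith [(abs_le.1 (hQt s s' (x - torusProj z))).2]
    have h2 := torusMollify_le_add ρ (hQc s') (hQc s) (x := x) (y := x) (c := A * |s - s'|)
      fun z _ => by linarith [(abs_le.1 (hQt s s' (x - torusProj z))).1]
    have h3 : 0 ≤ L * A * |s - s'| := by positivity
    rw [abs_le]; constructor <;> linarith
  · have h1 := hLm (A * |s - s'|) (fun x => hopfLax p f (max s 0) x - hopfLax p f (max s' 0) x)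
      ((hQc s).sub (hQc s')) (hQt s s')
    have h2 : torusMollify ρ (fun x => hopfLax p f (max s 0) x - hopfLax p f (max s' 0) x) =
        fun x => torusMollify ρ (hopfLax p f (max s 0)) x -
          torusMollify ρ (hopfLax p f (max s' 0)) x :=
      funext fun x => torusMollify_sub ρ (hQc s) (hQc s') x
    rw [h2] at h1
    refine h1.mono ?_
    have h3 : 0 ≤ A * |s - s'| := by positivity
    linarith
  · refine torusMollify_le_add ρ (hQc _) (hQc _) fun z _ => ?_
    rw [add_sub_right_comm, max_eq_left (add_nonneg hs hk), max_eq_left hs]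
    exact hopfLax_step hpq.lt.le hfc hs hk _ w
  · have h1 := (abs_le.1 (hosc 0 x)).2
    have h2 := (abs_le.1 (hfa x)).2
    rw [max_self] at h1
    rw [hopfLax_zero hp0 hfc] at h1
    simp only [max_self]
    linarith
  · have h1 := (abs_le.1 (hosc T y)).1
    simp only [max_eq_left hT.le] at h1 ⊢
    have h2 : c * χ y - δ / 2 ≤ hopfLax p f T y := le_hopfLax fun w => by
      have h3 := (abs_le.1 (hfa (y - torusProj (T • w)))).1
      have h4 := hle (y - torusProj (T • w)) y
      have h5 : torusDist (y - torusProj (T • w)) y ≤ T * ‖w‖ := by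
        have := torusDist_add_torusProj_le (y - torusProj (T • w)) (T • w)
        rwa [sub_add_cancel, norm_smul, Real.norm_of_nonneg hT.le] at this
      have h6 := Real.rpow_le_rpow (torusDist_nonneg _ _) h5 hp0.le
      rw [Real.mul_rpow hT.le (norm_nonneg w)] at h6
      have h7 := mul_le_mul_of_nonneg_left (h4.trans h6) hc0
      have h8 : c * (T ^ p * ‖w‖ ^ p) = T * (‖w‖ ^ p / p) := by
        have : T ^ (1 - p) * T ^ p = T := by
          rw [← Real.rpow_add hT, sub_add_cancel, Real.rpow_one]
        rw [hc]
        calc T ^ (1 - p) / p * (T ^ p * ‖w‖ ^ p) = (T ^ (1 - p) * T ^ p) * (‖w‖ ^ p / p) := by ring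
          _ = _ := by rw [this]
      rw [h8] at h7
      linarith
    linarith

end HopfLax

section AbsoluteContinuity

variable {f m : ℝ → ℝ}

theorem MeasureTheory.LocallyIntegrable.intervalIntegrable' (hm : LocallyIntegrable m volume)
    (a b : ℝ) : IntervalIntegrable m volume a b :=
  intervalIntegrable_iff.mpr <|
    (hm.integrableOn_isCompact isCompact_uIcc).mono_set uIoc_subset_uIcc

theorem absolutelyContinuousOnInterval_of_abs_sub_le (hm : LocallyIntegrable m volume)
    (h : ∀ s t, s ≤ t → |f t - f s| ≤ ∫ τ in s..t, m τ) (a b : ℝ) :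
    AbsolutelyContinuousOnInterval f a b := by
  have h1 := (hm.intervalIntegrable' a b).absolutelyContinuousOnInterval_intervalIntegral
    (c := a) left_mem_uIcc
  rw [absolutelyContinuousOnInterval_iff] at h1 ⊢
  intro ε hε
  obtain ⟨δ, hδ, h2⟩ := h1 ε hε
  refine ⟨δ, hδ, fun E hE hlt => lt_of_le_of_lt (Finset.sum_le_sum fun i _ => ?_) (h2 E hE hlt)⟩
  have hi := hm.intervalIntegrable'
  have key : ∀ s t, s ≤ t → dist (f s) (f t) ≤
      dist (∫ τ in a..s, m τ) (∫ τ in a..t, m τ) := fun s t hst => by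
    rw [Real.dist_eq, abs_sub_comm, Real.dist_eq, abs_sub_comm (∫ τ in a..s, m τ),
      intervalIntegral.integral_interval_sub_left (hi a t) (hi a s)]
    exact (h s t hst).trans (le_abs_self _)
  rcases le_total (E.2 i).1 (E.2 i).2 with hle | hle
  · exact key _ _ hle
  · rw [dist_comm, dist_comm (∫ τ in a..(E.2 i).1, m τ)]
    exact key _ _ hle

theorem ae_differentiableAt_of_abs_sub_le (hm : LocallyIntegrable m volume)
    (h : ∀ s t, s ≤ t → |f t - f s| ≤ ∫ τ in s..t, m τ) : ∀ᵐ t, DifferentiableAt ℝ f t := by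
  have h1 : ∀ n : ℕ, ∀ᵐ t : ℝ, t ∈ uIcc (-n : ℝ) n → DifferentiableAt ℝ f t := fun n =>
    (absolutelyContinuousOnInterval_of_abs_sub_le hm h (-n) n).ae_differentiableAt
  filter_upwards [ae_all_iff.2 h1] with t ht
  obtain ⟨n, hn⟩ := exists_nat_ge |t|
  refine ht n ?_
  rw [uIcc_of_le (by linarith [abs_nonneg t])]
  exact abs_le.1 hn

end AbsoluteContinuity

section Curves

variable {d : ℕ} {p : ℝ} {μ : ℝ → ProbabilityMeasure (Torus d)} {g : ℝ → ℝ}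

/-- `μ` is a curve on the whole line, absolutely continuous with respect to `W_p` with integrable
speed bound `g`. -/
structure IsACCurve {d : ℕ} (p : ℝ) (g : ℝ → ℝ) (μ : ℝ → ProbabilityMeasure (Torus d)) :
    Prop where
  one_lt : 1 < p
  nonneg : ∀ t, 0 ≤ g t
  integrable : Integrable g
  le : ∀ s t, s ≤ t → wdist p (μ s) (μ t) ≤ ∫ τ in s..t, g τ

namespace IsACCurve

theorem pos (h : IsACCurve p g μ) : 0 < p := by linarith [h.one_lt]

theorem abs_integral_sub_le (h : IsACCurve p g μ) {K : ℝ} (hK : 0 ≤ K) {F : Torus d → ℝ}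
    (hF : TorusLip K F) {s t : ℝ} (hst : s ≤ t) :
    |∫ x, F x ∂(μ t : Measure (Torus d)) - ∫ x, F x ∂(μ s : Measure (Torus d))| ≤
      ∫ τ in s..t, K * g τ := by
  rw [intervalIntegral.integral_const_mul]
  exact (hF.abs_integral_sub_le h.one_lt.le hK _ _).trans
    (mul_le_mul_of_nonneg_left (h.le s t hst) hK)

theorem wdist_le_abs (h : IsACCurve p g μ) (s t : ℝ) :
    wdist p (μ s) (μ t) ≤ |∫ τ in s..t, g τ| := by
  rcases le_total s t with hst | hst
  · exact (h.le s t hst).trans (le_abs_self _)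
  · rw [wdist_comm h.pos, intervalIntegral.integral_symm, abs_neg]
    exact (h.le t s hst).trans (le_abs_self _)

theorem continuous (h : IsACCurve p g μ) : Continuous μ := by
  rw [continuous_iff_continuousAt]
  intro t
  rw [ContinuousAt, tendsto_iff_forall_lipschitz_integral_tendsto]
  rintro F - ⟨L, hL⟩
  have h1 : Tendsto (fun s => L * |∫ τ in t..s, g τ|) (𝓝 t) (𝓝 0) := by
    have h2 : Continuous fun s => L * |∫ τ in t..s, g τ| :=
      continuous_const.mul (intervalIntegral.continuous_primitive
        (fun a b => h.integrable.intervalIntegrable) t).abs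
    simpa using h2.tendsto t
  rw [tendsto_iff_dist_tendsto_zero]
  refine squeeze_zero (fun _ => dist_nonneg) (fun s => ?_) h1
  exact (hL.torusLip.abs_integral_sub_le h.one_lt.le L.2 _ _).trans
    (mul_le_mul_of_nonneg_left (h.wdist_le_abs t s) L.2)

theorem continuous_integral (h : IsACCurve p g μ) {F : Torus d → ℝ} (hF : Continuous F) :
    Continuous fun t => ∫ x, F x ∂(μ t : Measure (Torus d)) := by
  rw [continuous_iff_continuousAt]
  intro t
  obtain ⟨C, -, hC⟩ := exists_bound_of_continuous hF
  have h1 := ProbabilityMeasure.tendsto_iff_forall_integral_tendsto.1 (h.continuous.tendsto t)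
    (BoundedContinuousFunction.ofNormedAddCommGroup F hF C hC)
  exact h1

end IsACCurve

theorem eventually_le_mul_abs_of_hasDerivAt {w : ℝ → ℝ → ℝ} {m : ℝ → ℝ} {t : ℝ}
    (hw : ∀ s, w s t ≤ |∫ τ in t..s, m τ|) (hm : 0 ≤ m t)
    (hd : HasDerivAt (fun s => ∫ τ in t..s, m τ) (m t) t) {ε : ℝ} (hε : 0 < ε) :
    ∀ᶠ s in 𝓝 t, w s t ≤ (m t + ε) * |s - t| := by
  have h1 := (hasDerivAt_iff_isLittleO.1 hd).def hε
  filter_upwards [h1] with s hs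
  simp only [intervalIntegral.integral_same, sub_zero, Real.norm_eq_abs, smul_eq_mul] at hs
  have h2 := abs_sub_abs_le_abs_sub (∫ τ in t..s, m τ) ((s - t) * m t)
  rw [abs_mul, abs_of_nonneg hm] at h2
  linarith [hw s]

theorem exists_dense_grad (d : ℕ) : ∃ ψ : ℕ → Torus d → ℝ, (∀ k, TorusSmooth (ψ k)) ∧
    ∀ φ, TorusSmooth φ → ∀ ε > 0, ∃ k, ∀ x, ‖torusGrad φ x - torusGrad (ψ k) x‖ ≤ ε := by
  let S : Type := {φ : Torus d → ℝ // TorusSmooth φ}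
  let G : S → C(Torus d, Tangent d) := fun φ => ⟨torusGrad φ.1, φ.2.continuous_grad⟩
  have h0 : TorusSmooth (fun _ : Torus d => (0 : ℝ)) := contDiff_const
  obtain ⟨s, hs, hsc, hd⟩ := (TopologicalSpace.IsSeparable.of_separableSpace
    (range G)).exists_countable_dense_subset
  have hne : s.Nonempty := by
    by_contra hempty
    rw [not_nonempty_iff_eq_empty] at hempty
    have := hd (mem_range_self (⟨_, h0⟩ : S))
    simp [hempty] at this
  obtain ⟨f, hf⟩ := hsc.exists_eq_range hne
  have hfr : ∀ k, ∃ φ : S, G φ = f k := fun k => hs (hf ▸ mem_range_self k)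
  choose ψ hψ using hfr
  refine ⟨fun k => (ψ k).1, fun k => (ψ k).2, fun φ hφ ε hε => ?_⟩
  obtain ⟨y, hy, hyd⟩ := Metric.mem_closure_iff.1 (hd (mem_range_self (⟨φ, hφ⟩ : S))) ε hε
  rw [hf] at hy
  obtain ⟨k, rfl⟩ := hy
  refine ⟨k, fun x => ?_⟩
  have h1 := (ContinuousMap.dist_apply_le_dist x).trans hyd.le
  rw [← hψ k, dist_eq_norm] at h1
  exact h1

/-- The time `t` is regular for the curve `μ`. -/
structure GoodTime {d : ℕ} (p : ℝ) (μ : ℝ → ProbabilityMeasure (Torus d)) (t : ℝ) : Prop where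
  lip : ∃ C, 0 ≤ C ∧ ∀ᶠ s in 𝓝 t, wdist p (μ s) (μ t) ≤ C * |s - t|
  diff : ∀ ψ, TorusSmooth ψ →
    DifferentiableAt ℝ (fun s => ∫ x, ψ x ∂(μ s : Measure (Torus d))) t

/-- The rate of change of the integral of `ψ` along the curve `μ`. -/
noncomputable def rate {d : ℕ} (μ : ℝ → ProbabilityMeasure (Torus d)) (t : ℝ)
    (ψ : Torus d → ℝ) : ℝ :=
  deriv (fun s => ∫ x, ψ x ∂(μ s : Measure (Torus d))) t

theorem slope_eq_div (f : ℝ → ℝ) (t s : ℝ) : slope f t s = (f s - f t) / (s - t) := by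
  rw [slope_def_field]

theorem abs_slope_sub_le {t s : ℝ} {C K : ℝ} (hst : s ≠ t) (hp : 1 ≤ p) (hK : 0 ≤ K)
    (hC : wdist p (μ s) (μ t) ≤ C * |s - t|) {φ ψ : Torus d → ℝ} (hφ : Continuous φ)
    (hψ : Continuous ψ) (h : TorusLip K fun x => φ x - ψ x) :
    |slope (fun s => ∫ x, φ x ∂(μ s : Measure (Torus d))) t s -
      slope (fun s => ∫ x, ψ x ∂(μ s : Measure (Torus d))) t s| ≤ K * C := by
  have h0 : 0 < |s - t| := abs_pos.2 (sub_ne_zero.2 hst)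
  have hi : ∀ (F : Torus d → ℝ) (_ : Continuous F) (s : ℝ),
      Integrable F (μ s : Measure (Torus d)) := fun F hF s => by
    exact ContinuousMap.integrable_torus ⟨F, hF⟩ _
  have h1 := h.abs_integral_sub_le hp hK (μ s) (μ t)
  rw [integral_sub (hi φ hφ t) (hi ψ hψ t), integral_sub (hi φ hφ s) (hi ψ hψ s)] at h1
  rw [slope_eq_div, slope_eq_div, ← sub_div, abs_div, div_le_iff₀ h0, abs_sub_comm]
  have h2 := mul_le_mul_of_nonneg_left hC hK
  calc _ = _ := by congr 1; ring
    _ ≤ _ := h1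
    _ ≤ _ := h2
    _ = _ := by ring

theorem goodTime_of_dense (hp : 1 ≤ p) {ψ : ℕ → Torus d → ℝ} (hψ : ∀ k, TorusSmooth (ψ k))
    (hdense : ∀ φ, TorusSmooth φ → ∀ ε > 0, ∃ k, ∀ x,
      ‖torusGrad φ x - torusGrad (ψ k) x‖ ≤ ε) {t : ℝ}
    (hlip : ∃ C, 0 ≤ C ∧ ∀ᶠ s in 𝓝 t, wdist p (μ s) (μ t) ≤ C * |s - t|)
    (hdiff : ∀ k, DifferentiableAt ℝ (fun s => ∫ x, ψ k x ∂(μ s : Measure (Torus d))) t) :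
    GoodTime p μ t := by
  refine ⟨hlip, fun φ hφ => ?_⟩
  obtain ⟨C, hC0, hC⟩ := hlip
  have hcauchy : Cauchy (map (slope (fun s => ∫ x, φ x ∂(μ s : Measure (Torus d))) t)
      (𝓝[≠] t)) := by
    rw [Metric.cauchy_iff]
    refine ⟨inferInstance, fun ε hε => ?_⟩
    obtain ⟨k, hk⟩ := hdense φ hφ (ε / (4 * (C + 1))) (by positivity)
    have hL : TorusLip (ε / (4 * (C + 1))) fun x => φ x - ψ k x :=
      (hφ.sub (hψ k)).torusLip fun x => by rw [hφ.grad_sub (hψ k)]; exact hk x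
    have hb : ε / (4 * (C + 1)) * C ≤ ε / 4 := by
      rw [div_mul_eq_mul_div, div_le_div_iff₀ (by positivity) (by norm_num)]
      nlinarith
    have h1 := hasDerivAt_iff_tendsto_slope.1 (hdiff k).hasDerivAt
    have h2 := Metric.tendsto_nhds.1 h1 (ε / 4) (by positivity)
    refine ⟨_, image_mem_map (h2.and ((hC.filter_mono nhdsWithin_le_nhds).and
      self_mem_nhdsWithin)), ?_⟩
    rintro _ ⟨s, ⟨hs1, hs2, hs3⟩, rfl⟩ _ ⟨s', ⟨hs1', hs2', hs3'⟩, rfl⟩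
    have e1 := abs_slope_sub_le hs3 hp (by positivity) hs2 hφ.continuous (hψ k).continuous hL
    have e2 := abs_slope_sub_le hs3' hp (by positivity) hs2' hφ.continuous (hψ k).continuous hL
    rw [Real.dist_eq] at hs1 hs1' ⊢
    rw [abs_lt] at hs1 hs1' ⊢
    rw [abs_le] at e1 e2
    constructor <;> linarith [e1.1, e1.2, e2.1, e2.2, hs1.1, hs1.2, hs1'.1, hs1'.2]
  obtain ⟨l, hl⟩ := CompleteSpace.complete hcauchy
  exact (hasDerivAt_iff_tendsto_slope.2 hl).differentiableAt

namespace IsACCurve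

theorem eventually_wdist_le_of_bound (h : IsACCurve p g μ) {m : ℝ → ℝ} (hm0 : ∀ t, 0 ≤ m t)
    (hm : LocallyIntegrable m volume)
    (hle : ∀ s t, s ≤ t → wdist p (μ s) (μ t) ≤ ∫ τ in s..t, m τ) :
    ∀ᵐ t, ∀ ε > 0, ∀ᶠ s in 𝓝 t, wdist p (μ s) (μ t) ≤ (m t + ε) * |s - t| := by
  filter_upwards [LocallyIntegrable.ae_hasDerivAt_integral hm] with t ht ε hε
  refine eventually_le_mul_abs_of_hasDerivAt (w := fun s t => wdist p (μ s) (μ t))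
    (fun s => ?_) (hm0 t) (ht t) hε
  rcases le_total s t with hst | hst
  · rw [intervalIntegral.integral_symm, abs_neg]
    exact (hle s t hst).trans (le_abs_self _)
  · rw [wdist_comm h.pos]
    exact (hle t s hst).trans (le_abs_self _)

theorem ae_goodTime (h : IsACCurve p g μ) : ∀ᵐ t, GoodTime p μ t := by
  obtain ⟨ψ, hψ, hdense⟩ := exists_dense_grad d
  have h1 : ∀ k, ∀ᵐ t, DifferentiableAt ℝ
      (fun s => ∫ x, ψ k x ∂(μ s : Measure (Torus d))) t := fun k => by
    obtain ⟨K, hK0, hK⟩ := (hψ k).exists_norm_grad_le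
    exact ae_differentiableAt_of_abs_sub_le (h.integrable.const_mul K).locallyIntegrable
      fun s t hst => h.abs_integral_sub_le hK0 ((hψ k).torusLip hK) hst
  filter_upwards [ae_all_iff.2 h1,
    h.eventually_wdist_le_of_bound h.nonneg h.integrable.locallyIntegrable h.le] with t ht1 ht2
  exact goodTime_of_dense h.one_lt.le hψ hdense
    ⟨g t + 1, by linarith [h.nonneg t], ht2 1 one_pos⟩ ht1

end IsACCurve

theorem TorusSmooth.integrable {ψ : Torus d → ℝ} (hψ : TorusSmooth ψ) (m : Measure (Torus d))
    [IsFiniteMeasure m] : Integrable ψ m :=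
  ContinuousMap.integrable_torus ⟨ψ, hψ.continuous⟩ m

theorem TorusSmooth.memLp_grad {ψ : Torus d → ℝ} (hψ : TorusSmooth ψ) (m : Measure (Torus d))
    [IsFiniteMeasure m] (r : ℝ≥0∞) : MemLp (torusGrad ψ) r m := by
  obtain ⟨K, -, hK⟩ := hψ.exists_norm_grad_le
  exact memLp_of_bounded hψ.continuous_grad.measurable hK

namespace GoodTime

variable {t : ℝ} {φ ψ : Torus d → ℝ}

theorem tendsto_slope (h : GoodTime p μ t) (hψ : TorusSmooth ψ) :
    Tendsto (slope (fun s => ∫ x, ψ x ∂(μ s : Measure (Torus d))) t) (𝓝[≠] t)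
      (𝓝 (rate μ t ψ)) :=
  hasDerivAt_iff_tendsto_slope.1 (h.diff ψ hψ).hasDerivAt

theorem rate_add (h : GoodTime p μ t) (hφ : TorusSmooth φ) (hψ : TorusSmooth ψ) :
    rate μ t (fun x => φ x + ψ x) = rate μ t φ + rate μ t ψ := by
  rw [rate, rate, rate, ← deriv_fun_add (h.diff φ hφ) (h.diff ψ hψ)]
  congr 1; ext s
  rw [integral_add (hφ.integrable _) (hψ.integrable _)]

theorem rate_const_mul (c : ℝ) (ψ : Torus d → ℝ) :
    rate μ t (fun x => c * ψ x) = c * rate μ t ψ := by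
  simp only [rate, integral_const_mul, deriv_const_mul_field]

end GoodTime

theorem TorusSmooth.abs_integral_sub_le_wdist {q : ℝ} (hpq : p.HolderConjugate q)
    {ψ : Torus d → ℝ} (hψ : TorusSmooth ψ) {ε : ℝ} (hε : 0 < ε) :
    ∃ C, 0 ≤ C ∧ ∀ μ ν : ProbabilityMeasure (Torus d),
      |∫ x, ψ x ∂(ν : Measure (Torus d)) - ∫ x, ψ x ∂(μ : Measure (Torus d))| ≤
      (lpn q (torusGrad ψ) (μ : Measure (Torus d)) + ε) * wdist p μ ν + C * wdist p μ ν ^ p := by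
  obtain ⟨C, hC0, hC⟩ := hψ.abs_integral_sub_sub_le hpq.lt.le hε
  refine ⟨C, hC0, fun μ ν => ?_⟩
  have key : ∀ c, wdist p μ ν < c →
      |∫ x, ψ x ∂(ν : Measure (Torus d)) - ∫ x, ψ x ∂(μ : Measure (Torus d))| ≤
      (lpn q (torusGrad ψ) (μ : Measure (Torus d)) + ε) * c + C * c ^ p := fun c hc => by
    obtain ⟨π, hπ, hπc⟩ := exists_plan_lt hpq.pos hc
    have h1 := hC hπ
    have h2 := abs_integral_inner_le hpq.symm
      (hπ.memLp_fst (hψ.memLp_grad (μ : Measure (Torus d)) (ENNReal.ofReal q)))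
      (memLp_torusDisp (π : Measure (Torus d × Torus d)) (ENNReal.ofReal p))
    rw [hπ.lpn_fst hψ.continuous_grad.aestronglyMeasurable] at h2
    have h3 : planCostR p π ^ p ≤ c ^ p := Real.rpow_le_rpow lpn_nonneg hπc.le hpq.pos.le
    have h4 := mul_le_mul_of_nonneg_left hπc.le
      (add_nonneg (lpn_nonneg (p := q) (X := torusGrad ψ) (m := (μ : Measure (Torus d)))) hε.le)
    have h5 := mul_le_mul_of_nonneg_left h3 hC0
    have h6 : lpn p (fun z : Torus d × Torus d => torusDisp z.1 z.2)
      (π : Measure (Torus d × Torus d)) = planCostR p π := rfl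
    rw [h6] at h2
    rw [abs_le] at h1 h2 ⊢
    constructor <;> nlinarith [h1.1, h1.2, h2.1, h2.2]
  have hcont : Continuous fun c : ℝ =>
      (lpn q (torusGrad ψ) (μ : Measure (Torus d)) + ε) * c + C * c ^ p :=
    (continuous_const.mul continuous_id).add
      (continuous_const.mul (Real.continuous_rpow_const hpq.pos.le))
  refine ge_of_tendsto (hcont.tendsto (wdist p μ ν) |>.mono_left
    (nhdsWithin_le_nhds (s := Ioi (wdist p μ ν)))) ?_
  filter_upwards [self_mem_nhdsWithin] with c hc using key c hc

theorem GoodTime.abs_rate_le {q : ℝ} (hpq : p.HolderConjugate q) {t : ℝ} (h : GoodTime p μ t)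
    {A : ℝ} (hA0 : 0 ≤ A) (hA : ∃ᶠ s in 𝓝[≠] t, wdist p (μ s) (μ t) ≤ A * |s - t|)
    {ψ : Torus d → ℝ} (hψ : TorusSmooth ψ) :
    |rate μ t ψ| ≤ A * lpn q (torusGrad ψ) (μ t : Measure (Torus d)) := by
  set l := lpn q (torusGrad ψ) (μ t : Measure (Torus d)) with hl
  have hl0 : 0 ≤ l := lpn_nonneg
  refine le_of_forall_pos_le_add fun ε hε => ?_
  obtain ⟨C, hC0, hC⟩ := hψ.abs_integral_sub_le_wdist hpq (ε := ε / (A + 1)) (by positivity)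
  have h1 : Tendsto (fun s => |slope (fun s => ∫ x, ψ x ∂(μ s : Measure (Torus d))) t s| -
      C * A ^ p * |s - t| ^ (p - 1)) (𝓝[≠] t) (𝓝 (|rate μ t ψ| - 0)) := by
    refine (h.tendsto_slope hψ).abs.sub ?_
    have : Continuous fun s : ℝ => C * A ^ p * |s - t| ^ (p - 1) :=
      continuous_const.mul ((Real.continuous_rpow_const (sub_pos.2 hpq.lt).le).comp
        (continuous_id.sub continuous_const).abs)
    have h2 := this.tendsto t
    simp only [sub_self, abs_zero, Real.zero_rpow (sub_pos.2 hpq.lt).ne', mul_zero] at h2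
    exact h2.mono_left nhdsWithin_le_nhds
  rw [sub_zero] at h1
  refine le_of_tendsto_of_frequently h1 ((hA.and_eventually self_mem_nhdsWithin).mono ?_)
  rintro s ⟨hs, hst : s ≠ t⟩
  have h0 : 0 < |s - t| := abs_pos.2 (sub_ne_zero.2 hst)
  rw [wdist_comm hpq.pos] at hs
  have h3 := hC (μ t) (μ s)
  have h4 : wdist p (μ t) (μ s) ^ p ≤ A ^ p * (|s - t| ^ (p - 1) * |s - t|) := by
    rw [← Real.rpow_add_one h0.ne', sub_add_cancel, ← Real.mul_rpow hA0 h0.le]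
    exact Real.rpow_le_rpow wdist_nonneg hs hpq.pos.le
  have h5 : A * (ε / (A + 1)) ≤ ε := by
    rw [mul_div_assoc', div_le_iff₀ (by positivity)]
    nlinarith
  rw [slope_eq_div, abs_div, sub_le_iff_le_add, div_le_iff₀ h0]
  refine h3.trans ?_
  have h6 := mul_le_mul_of_nonneg_left hs (add_nonneg hl0 (show 0 ≤ ε / (A + 1) by positivity))
  have h7 := mul_le_mul_of_nonneg_left h4 hC0
  have h8 := mul_le_mul_of_nonneg_right h5 h0.le
  linarith

theorem GoodTime.tendsto_slope_of_eventually (hp : 1 ≤ p) {t : ℝ} (h : GoodTime p μ t)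
    {u : ℝ → Torus d → ℝ} (hu : ∀ s, TorusSmooth (u s))
    (hL : ∀ ε > 0, ∀ᶠ s in 𝓝 t, TorusLip ε fun x => u s x - u t x) :
    Tendsto (fun s => (∫ x, u s x ∂(μ s : Measure (Torus d)) -
      ∫ x, u s x ∂(μ t : Measure (Torus d))) / (s - t)) (𝓝[≠] t) (𝓝 (rate μ t (u t))) := by
  obtain ⟨A, hA0, hA⟩ := h.lip
  refine (h.tendsto_slope (hu t)).congr_dist (Metric.tendsto_nhds.2 fun ε hε => ?_)
  filter_upwards [hA.filter_mono nhdsWithin_le_nhds, self_mem_nhdsWithin,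
    (hL (ε / (2 * (A + 1))) (by positivity)).filter_mono nhdsWithin_le_nhds] with s hs hst hsL
  rw [dist_zero_right, Real.norm_of_nonneg dist_nonneg, Real.dist_eq, abs_sub_comm]
  have h1 := abs_slope_sub_le hst hp (by positivity) hs (hu s).continuous (hu t).continuous hsL
  rw [slope_eq_div (fun r => ∫ x, u s x ∂(μ r : Measure (Torus d)))] at h1
  refine h1.trans_lt ?_
  rw [div_mul_eq_mul_div, div_lt_iff₀ (by positivity)]
  nlinarith

theorem GoodTime.tendsto_slope_family (hp : 1 ≤ p) {t : ℝ} (h : GoodTime p μ t) {C : ℝ}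
    (hC : 0 ≤ C) {u : ℝ → Torus d → ℝ} (hu : ∀ s, TorusSmooth (u s))
    (hL : ∀ s s', TorusLip (C * |s - s'|) fun x => u s x - u s' x) {θ : ℝ → ℝ}
    (hθ : ContinuousAt θ t) :
    Tendsto (fun s => (∫ x, u (θ s) x ∂(μ s : Measure (Torus d)) -
      ∫ x, u (θ s) x ∂(μ t : Measure (Torus d))) / (s - t)) (𝓝[≠] t)
      (𝓝 (rate μ t (u (θ t)))) := by
  refine h.tendsto_slope_of_eventually hp (u := fun s => u (θ s)) (fun s => hu _) fun ε hε => ?_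
  filter_upwards [Metric.tendsto_nhds.1 hθ (ε / (C + 1)) (by positivity)] with s hs
  refine (hL (θ s) (θ t)).mono ?_
  rw [Real.dist_eq, lt_div_iff₀ (by positivity)] at hs
  nlinarith [abs_nonneg (θ s - θ t)]

end Curves

section GradFunctional

variable {d : ℕ} {p q A : ℝ} {m : Measure (Torus d)} {ℓ : (Torus d → ℝ) → ℝ}

/-- `ℓ` is a linear functional of the gradient, bounded by `A` in `L^q`. -/
structure IsGradFunctional {d : ℕ} (q A : ℝ) (m : Measure (Torus d)) (ℓ : (Torus d → ℝ) → ℝ) :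
    Prop where
  nonneg : 0 ≤ A
  add : ∀ φ ψ, TorusSmooth φ → TorusSmooth ψ → ℓ (fun x => φ x + ψ x) = ℓ φ + ℓ ψ
  const_mul : ∀ c ψ, ℓ (fun x => c * ψ x) = c * ℓ ψ
  bound : ∀ ψ, TorusSmooth ψ → |ℓ ψ| ≤ A * lpn q (torusGrad ψ) m

/-- The strictly convex energy whose minimizer represents `ℓ`. -/
noncomputable def gradEnergy {d : ℕ} (q : ℝ) (m : Measure (Torus d)) (ℓ : (Torus d → ℝ) → ℝ)
    (φ : Torus d → ℝ) : ℝ :=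
  (∫ x, ‖torusGrad φ x‖ ^ q ∂m) / q - ℓ φ

/-- `v` represents `ℓ` and is dual to a limit of gradients. -/
structure IsTangentVelocity {d : ℕ} (p q : ℝ) (m : Measure (Torus d)) (ℓ : (Torus d → ℝ) → ℝ)
    (v : Torus d → Tangent d) : Prop where
  memLp : MemLp v (ENNReal.ofReal p) m
  rate_eq : ∀ ψ, TorusSmooth ψ → ℓ ψ = ∫ x, inner ℝ (torusGrad ψ x) (v x) ∂m
  approx : ∀ ε > 0, ∃ φ, TorusSmooth φ ∧ lpn q (fun x => torusGrad φ x - pgrad p (v x)) m ≤ ε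

theorem IsTangentVelocity.lpn_le (hpq : p.HolderConjugate q) [IsProbabilityMeasure m]
    {v : Torus d → Tangent d} (h : IsTangentVelocity p q m ℓ v) {A : ℝ} (hA : 0 ≤ A)
    (hb : ∀ ψ, TorusSmooth ψ → |ℓ ψ| ≤ A * lpn q (torusGrad ψ) m) : lpn p v m ≤ A := by
  have hq1 := hpq.symm.lt.le
  have hξ := h.memLp.pgrad hpq
  set N := lpn p v m with hN
  set X := lpn q (fun x => pgrad p (v x)) m with hX
  have hN0 : 0 ≤ N := lpn_nonneg
  have hXq : X ^ q = N ^ p := by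
    rw [hX, lpn_rpow hpq.symm.pos, hN, lpn_rpow hpq.pos]
    simp only [norm_pgrad_rpow hpq]
  have hX0 : 0 ≤ X := lpn_nonneg
  have key : N ^ p ≤ A * X := by
    refine le_of_forall_pos_le_add fun ε hε => ?_
    obtain ⟨φ, hφ, hφε⟩ := h.approx (ε / (A + N + 1)) (by positivity)
    have hg := hφ.memLp_grad m (ENNReal.ofReal q)
    have h1 : ∫ x, inner ℝ (pgrad p (v x)) (v x) ∂m = N ^ p := by
      rw [hN, lpn_rpow hpq.pos]
      simp only [inner_pgrad_self hpq.lt]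
    have h2 := abs_integral_inner_le hpq.symm (hg.sub hξ) h.memLp
    have h3 : ∫ x, inner ℝ ((torusGrad φ - fun x => pgrad p (v x)) x) (v x) ∂m =
        ℓ φ - N ^ p := by
      simp only [Pi.sub_apply, inner_sub_left]
      rw [integral_sub (integrable_inner_of_memLp hpq.symm hg h.memLp)
        (integrable_inner_of_memLp hpq.symm hξ h.memLp), h1, h.rate_eq φ hφ]
    have h4 : lpn q (torusGrad φ - fun x => pgrad p (v x)) m ≤ ε / (A + N + 1) := hφε
    have h5 := lpn_le_add_sub hq1 hg hξ
    have h6 := (le_abs_self _).trans (hb φ hφ)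
    rw [h3] at h2
    have h7 := (abs_le.1 h2).1
    have h8 : lpn q (torusGrad φ) m ≤ X + ε / (A + N + 1) := h5.trans (by gcongr)
    have h9 := mul_le_mul_of_nonneg_left h8 hA
    have h10 := mul_le_mul_of_nonneg_right h4 hN0
    have h11 : (A + N) * (ε / (A + N + 1)) ≤ ε := by
      rw [mul_div_assoc', div_le_iff₀ (by positivity)]
      nlinarith
    nlinarith
  rcases hN0.eq_or_lt with h0 | h0
  · rw [← h0]; exact hA
  · have h1 : X = N ^ (p - 1) := by
      rw [← Real.rpow_rpow_inv hX0 hpq.symm.pos.ne', hXq, ← Real.rpow_mul hN0]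
      congr 1
      rw [← div_eq_mul_inv, div_eq_iff hpq.symm.pos.ne', hpq.sub_one_mul_conj]
    have h2 : N ^ p = N ^ (p - 1) * N := by rw [← Real.rpow_add_one h0.ne', sub_add_cancel]
    rw [h1, h2, mul_comm A] at key
    exact le_of_mul_le_mul_left key (by positivity)

namespace IsGradFunctional

theorem sub (h : IsGradFunctional q A m ℓ) {φ ψ : Torus d → ℝ} (hφ : TorusSmooth φ)
    (hψ : TorusSmooth ψ) : ℓ (fun x => φ x - ψ x) = ℓ φ - ℓ ψ := by
  have := h.add φ _ hφ (hψ.const_mul (-1))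
  rw [h.const_mul] at this
  simpa [sub_eq_add_neg] using this

theorem abs_sub_le (h : IsGradFunctional q A m ℓ) {φ ψ : Torus d → ℝ} (hφ : TorusSmooth φ)
    (hψ : TorusSmooth ψ) :
    |ℓ φ - ℓ ψ| ≤ A * lpn q (fun x => torusGrad φ x - torusGrad ψ x) m := by
  rw [← h.sub hφ hψ]
  have := h.bound _ (hφ.sub hψ)
  have h1 : torusGrad (fun x => φ x - ψ x) = fun x => torusGrad φ x - torusGrad ψ x :=
    funext fun x => hφ.grad_sub hψ x
  rwa [h1] at this

theorem energy_le (h : IsGradFunctional q A m ℓ) (hq : 1 < q) [IsProbabilityMeasure m]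
    {φ ψ : Torus d → ℝ} (hφ : TorusSmooth φ) (hψ : TorusSmooth ψ) {δ : ℝ}
    (hδ : lpn q (fun x => torusGrad φ x - torusGrad ψ x) m ≤ δ) :
    gradEnergy q m ℓ φ ≤ (lpn q (torusGrad ψ) m + δ) ^ q / q + A * δ - ℓ ψ := by
  have hq0 : 0 < q := by linarith
  have h1 := lpn_le_add_sub hq.le (hφ.memLp_grad m (ENNReal.ofReal q))
    (hψ.memLp_grad m (ENNReal.ofReal q))
  have h2 : lpn q (torusGrad φ) m ^ q ≤ (lpn q (torusGrad ψ) m + δ) ^ q :=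
    Real.rpow_le_rpow lpn_nonneg (h1.trans (by gcongr)) hq0.le
  have h3 := (abs_le.1 ((h.abs_sub_le hφ hψ).trans (mul_le_mul_of_nonneg_left hδ h.nonneg))).1
  rw [gradEnergy, ← lpn_rpow hq0]
  have h4 : lpn q (torusGrad φ) m ^ q / q ≤ (lpn q (torusGrad ψ) m + δ) ^ q / q := by gcongr
  linarith

theorem exists_energy_le_add (h : IsGradFunctional q A m ℓ) (hq : 1 < q) [IsProbabilityMeasure m]
    {ψ : Torus d → ℝ} (hψ : TorusSmooth ψ) {ε : ℝ} (hε : 0 < ε) :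
    ∃ δ > 0, ∀ φ, TorusSmooth φ → ∀ r ≤ δ, 0 ≤ r →
      lpn q (fun x => torusGrad φ x - torusGrad ψ x) m ≤ r →
      gradEnergy q m ℓ φ ≤ gradEnergy q m ℓ ψ + ε := by
  have hq0 : 0 < q := by linarith
  have hc : Continuous fun δ : ℝ => (lpn q (torusGrad ψ) m + δ) ^ q / q + A * δ - ℓ ψ :=
    ((((Real.continuous_rpow_const hq0.le).comp (continuous_const.add continuous_id)).div_const
      _).add (continuous_const.mul continuous_id)).sub continuous_const
  have h0 := hc.tendsto 0
  simp only [add_zero, mul_zero] at h0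
  rw [lpn_rpow hq0] at h0
  have h1 : ∀ᶠ δ in 𝓝 (0 : ℝ), (lpn q (torusGrad ψ) m + δ) ^ q / q + A * δ - ℓ ψ <
      gradEnergy q m ℓ ψ + ε := h0.eventually_lt_const (lt_add_of_pos_right _ hε)
  obtain ⟨δ, hδ, h2⟩ := Metric.eventually_nhds_iff.1 h1
  refine ⟨δ / 2, by positivity, fun φ hφ r hr hr0 hle => ?_⟩
  refine (h.energy_le hq hφ hψ hle).trans (h2 ?_).le
  rw [Real.dist_eq, sub_zero, abs_of_nonneg hr0]
  linarith

theorem neg_le_energy (h : IsGradFunctional q A m ℓ) (hpq : p.HolderConjugate q)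
    {φ : Torus d → ℝ} (hφ : TorusSmooth φ) : -(A ^ p / p) ≤ gradEnergy q m ℓ φ := by
  have h1 := (le_abs_self _).trans (h.bound φ hφ)
  have h2 := Real.young_inequality_of_nonneg h.nonneg
    (lpn_nonneg (p := q) (X := torusGrad φ) (m := m)) hpq
  rw [lpn_rpow hpq.symm.pos] at h2
  rw [gradEnergy]
  linarith

theorem exists_inf (h : IsGradFunctional q A m ℓ) (hpq : p.HolderConjugate q) :
    ∃ I, I ≤ 0 ∧ (∀ φ, TorusSmooth φ → I ≤ gradEnergy q m ℓ φ) ∧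
      ∀ ε > 0, ∃ φ, TorusSmooth φ ∧ gradEnergy q m ℓ φ ≤ I + ε := by
  let S : Set ℝ := {e | ∃ φ, TorusSmooth φ ∧ gradEnergy q m ℓ φ = e}
  have hS : BddBelow S := ⟨-(A ^ p / p), by rintro _ ⟨φ, hφ, rfl⟩; exact h.neg_le_energy hpq hφ⟩
  have hz : TorusSmooth fun _ : Torus d => (0 : ℝ) := contDiff_const
  have h0 : (0 : ℝ) ∈ S := by
    refine ⟨fun _ => 0, hz, ?_⟩
    have h1 : torusGrad (fun _ : Torus d => (0 : ℝ)) = fun _ => 0 := by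
      funext x
      simpa using hz.grad_const_mul 0 x
    have h2 : ℓ (fun _ => 0) = 0 := by simpa using h.const_mul 0 fun _ => 0
    rw [gradEnergy, h1, h2]
    simp [Real.zero_rpow hpq.symm.pos.ne']
  refine ⟨sInf S, csInf_le hS h0, fun φ hφ => csInf_le hS ⟨φ, hφ, rfl⟩, fun ε hε => ?_⟩
  obtain ⟨_, ⟨φ, hφ, rfl⟩, hlt⟩ := exists_lt_of_csInf_lt ⟨0, h0⟩ (lt_add_of_pos_right (sInf S) hε)
  exact ⟨φ, hφ, hlt.le⟩

theorem exists_cluster (h : IsGradFunctional q A m ℓ) (hpq : p.HolderConjugate q)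
    [IsProbabilityMeasure m] {I : ℝ} (hI0 : I ≤ 0)
    (hI : ∀ φ, TorusSmooth φ → I ≤ gradEnergy q m ℓ φ) {η : ℝ} (hη : 0 < η) :
    ∃ δ > 0, ∀ φ ψ, TorusSmooth φ → TorusSmooth ψ → gradEnergy q m ℓ φ ≤ I + δ →
      gradEnergy q m ℓ ψ ≤ I + δ →
      lpn q (fun x => torusGrad φ x - torusGrad ψ x) m ≤ η := by
  have hq0 := hpq.symm.pos
  have hp0 := hpq.pos
  have hA := h.nonneg
  set B := 2 * q * ((2 * A) ^ p / p + 1) with hB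
  have hB0 : 0 < B := by positivity
  have hbd : ∀ φ, TorusSmooth φ → gradEnergy q m ℓ φ ≤ I + 1 →
      ∫ x, ‖torusGrad φ x‖ ^ q ∂m ≤ B := fun φ hφ hle => by
    have h1 := (le_abs_self _).trans (h.bound φ hφ)
    set x := lpn q (torusGrad φ) m
    have hx0 : 0 ≤ x := lpn_nonneg
    rw [gradEnergy, ← lpn_rpow hq0] at hle
    rw [← lpn_rpow hq0]
    have h2 := Real.young_inequality_of_nonneg (show 0 ≤ 2 * A by positivity)
      (show 0 ≤ x / 2 by positivity) hpq
    have h3 : (x / 2) ^ q ≤ x ^ q / 2 := by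
      rw [Real.div_rpow hx0 two_pos.le]
      gcongr
      exact Real.self_le_rpow_of_one_le one_le_two hpq.symm.lt.le
    have h4 : (x / 2) ^ q / q ≤ x ^ q / 2 / q := by gcongr
    have h5 : x ^ q / q - x ^ q / 2 / q ≤ (2 * A) ^ p / p + 1 := by
      have : 2 * A * (x / 2) = A * x := by ring
      linarith
    have h6 : x ^ q / q - x ^ q / 2 / q = x ^ q / (2 * q) := by field_simp; ring
    rw [h6, div_le_iff₀ (by positivity)] at h5
    rw [hB]; linarith
  obtain ⟨C, hC0, hC⟩ := exists_integral_norm_sub_rpow_le hpq.symm.lt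
    (ε := η ^ q / (4 * B)) (by positivity) d
  refine ⟨min 1 (η ^ q / (2 * (C * q + 1))), by positivity, fun φ ψ hφ hψ h1 h2 => ?_⟩
  have e1 := hbd φ hφ (h1.trans (by gcongr; exact min_le_left _ _))
  have e2 := hbd ψ hψ (h2.trans (by gcongr; exact min_le_left _ _))
  have e3 := hC _ m _ _ (hφ.memLp_grad m (ENNReal.ofReal q)) (hψ.memLp_grad m (ENNReal.ofReal q))
  have e4 := hI _ ((hφ.add hψ).const_mul 2⁻¹)
  have e5 : ∀ x, torusGrad (fun x => 2⁻¹ * (φ x + ψ x)) x =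
      (2⁻¹ : ℝ) • (torusGrad φ x + torusGrad ψ x) := fun x => by
    rw [(hφ.add hψ).grad_const_mul, hφ.grad_add hψ]
  simp only [gradEnergy, e5] at e4 h1 h2
  rw [h.const_mul, h.add φ ψ hφ hψ] at e4
  rw [lpn_le_iff hq0 hη.le]
  refine e3.trans ?_
  set a := ∫ x, ‖torusGrad φ x‖ ^ q ∂m
  set b := ∫ x, ‖torusGrad ψ x‖ ^ q ∂m
  set c := ∫ x, ‖(2⁻¹ : ℝ) • (torusGrad φ x + torusGrad ψ x)‖ ^ q ∂m
  set δ := min 1 (η ^ q / (2 * (C * q + 1)))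
  have e6 : η ^ q / (4 * B) * (a + b) ≤ η ^ q / 2 := by
    rw [div_mul_eq_mul_div, div_le_div_iff₀ (by positivity) two_pos]
    have : 0 ≤ η ^ q := by positivity
    nlinarith
  have e7 : 2⁻¹ * (a + b) - c ≤ q * δ := by
    have h3 : (2⁻¹ * (a + b) - c) / q ≤ δ := by
      have : (2⁻¹ * (a + b) - c) / q = 2⁻¹ * (a / q + b / q) - c / q := by ring
      rw [this]; linarith
    rw [div_le_iff₀ hq0] at h3
    linarith
  have e8 : C * (q * δ) ≤ η ^ q / 2 := by
    have h3 : δ ≤ η ^ q / (2 * (C * q + 1)) := min_le_right _ _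
    calc C * (q * δ) ≤ C * (q * (η ^ q / (2 * (C * q + 1)))) := by gcongr
      _ = C * q / (C * q + 1) * (η ^ q / 2) := by field_simp
      _ ≤ 1 * (η ^ q / 2) := by
        gcongr
        rw [div_le_one (by positivity)]
        linarith
      _ = η ^ q / 2 := one_mul _
  have e9 := mul_le_mul_of_nonneg_left e7 hC0
  linarith

theorem rate_le_of_minimizing (h : IsGradFunctional q A m ℓ) (hpq : p.HolderConjugate q)
    [IsProbabilityMeasure m] {I : ℝ} (hI : ∀ φ, TorusSmooth φ → I ≤ gradEnergy q m ℓ φ)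
    {ξ : Torus d → Tangent d} (hξ : MemLp ξ (ENNReal.ofReal q) m)
    (happ : ∀ ε > 0, ∃ φ, TorusSmooth φ ∧ gradEnergy q m ℓ φ ≤ I + ε ∧
      lpn q (fun x => torusGrad φ x - ξ x) m ≤ ε)
    {χ : Torus d → ℝ} (hχ : TorusSmooth χ) :
    ℓ χ ≤ ∫ x, inner ℝ (torusGrad χ x) (pgrad q (ξ x)) ∂m := by
  have hq0 := hpq.symm.pos
  have hp0 := hpq.pos
  have hq1 := hpq.symm.lt
  have hη := hχ.memLp_grad m (ENNReal.ofReal q)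
  obtain ⟨K, hK0, hK⟩ := hχ.exists_norm_grad_le
  have hmem : ∀ τ : ℝ, MemLp (fun x => ξ x + τ • torusGrad χ x) (ENNReal.ofReal q) m :=
    fun τ => hξ.add (hη.const_smul τ)
  have hint : ∀ τ : ℝ, Integrable
      (fun x => inner ℝ (torusGrad χ x) (pgrad q (ξ x + τ • torusGrad χ x))) m := fun τ =>
    integrable_inner_of_memLp hpq.symm hη ((hmem τ).pgrad hpq.symm)
  have step : ∀ τ : ℝ, 0 < τ →
      ℓ χ ≤ ∫ x, inner ℝ (torusGrad χ x) (pgrad q (ξ x + τ • torusGrad χ x)) ∂m := by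
    intro τ hτ
    have h1 : τ * ℓ χ ≤ (lpn q (fun x => ξ x + τ • torusGrad χ x) m ^ q - lpn q ξ m ^ q) / q := by
      have hc : Continuous fun ε : ℝ => ((lpn q (fun x => ξ x + τ • torusGrad χ x) m + ε) ^ q -
          (max (lpn q ξ m - ε) 0) ^ q) / q + ε := by
        refine ((Continuous.sub ?_ ?_).div_const q).add continuous_id
        · exact (Real.continuous_rpow_const hq0.le).comp (continuous_const.add continuous_id)
        · exact (Real.continuous_rpow_const hq0.le).comp
            ((continuous_const.sub continuous_id).max continuous_const)
      have hlim := hc.tendsto 0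
      simp only [add_zero, sub_zero] at hlim
      rw [max_eq_left lpn_nonneg] at hlim
      refine ge_of_tendsto (hlim.mono_left (nhdsWithin_le_nhds (s := Ioi 0))) ?_
      filter_upwards [self_mem_nhdsWithin] with ε hε
      obtain ⟨φ, hφ, hφI, hφξ⟩ := happ ε hε
      have e1 := hI _ (hφ.add (hχ.const_mul τ))
      have e2 : torusGrad (fun x => φ x + τ * χ x) =
          fun x => torusGrad φ x + τ • torusGrad χ x := by
        funext x
        rw [hφ.grad_add (hχ.const_mul τ), hχ.grad_const_mul]
      have hgφ := hφ.memLp_grad m (ENNReal.ofReal q)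
      rw [gradEnergy, h.add _ _ hφ (hχ.const_mul τ), h.const_mul, ← lpn_rpow hq0, e2] at e1
      rw [gradEnergy, ← lpn_rpow hq0] at hφI
      have e3 : lpn q (fun x => torusGrad φ x + τ • torusGrad χ x) m ≤
          lpn q (fun x => ξ x + τ • torusGrad χ x) m + ε := by
        have e4 := lpn_le_add_sub hq1.le (hgφ.add (hη.const_smul τ)) (hmem τ)
        have e5 : lpn q (fun x => (torusGrad φ + τ • torusGrad χ) x -
            (ξ x + τ • torusGrad χ x)) m = lpn q (fun x => torusGrad φ x - ξ x) m := by
          congr 1; ext1 x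
          simp only [Pi.add_apply, Pi.smul_apply, add_sub_add_right_eq_sub]
        rw [e5] at e4
        exact e4.trans (by gcongr)
      have e6 : max (lpn q ξ m - ε) 0 ≤ lpn q (torusGrad φ) m := by
        refine max_le ?_ lpn_nonneg
        have := lpn_le_add_sub hq1.le hξ hgφ
        rw [lpn_sub_comm] at this
        linarith
      have e7 := Real.rpow_le_rpow lpn_nonneg e3 hq0.le
      have e8 := Real.rpow_le_rpow (le_max_right _ _) e6 hq0.le
      have e9 := div_le_div_of_nonneg_right (sub_le_sub e7 e8) hq0.le
      rw [sub_div] at e9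
      linarith
    have h2 : (lpn q (fun x => ξ x + τ • torusGrad χ x) m ^ q - lpn q ξ m ^ q) / q ≤
        τ * ∫ x, inner ℝ (torusGrad χ x) (pgrad q (ξ x + τ • torusGrad χ x)) ∂m := by
      rw [div_le_iff₀ hq0, lpn_rpow hq0, lpn_rpow hq0,
        ← integral_sub ((hmem τ).integrable_rpow hq0) (hξ.integrable_rpow hq0), mul_comm, ← mul_assoc,
        ← integral_const_mul]
      refine integral_mono (((hmem τ).integrable_rpow hq0).sub (hξ.integrable_rpow hq0))
        ((hint τ).const_mul _) fun x => ?_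
      have := norm_rpow_add_inner_pgrad_le hq1 (ξ x + τ • torusGrad χ x) (ξ x)
      rw [sub_add_cancel_left, inner_neg_right, inner_smul_right, real_inner_comm] at this
      simp only
      linarith
    exact le_of_mul_le_mul_left (h1.trans h2) hτ
  have hlim : Tendsto (fun τ : ℝ =>
      ∫ x, inner ℝ (torusGrad χ x) (pgrad q (ξ x + τ • torusGrad χ x)) ∂m) (𝓝[>] 0)
      (𝓝 (∫ x, inner ℝ (torusGrad χ x) (pgrad q (ξ x)) ∂m)) := by
    have hdom : MemLp (fun x => ‖ξ x‖ + K) (ENNReal.ofReal q) m := hξ.norm.add (memLp_const K)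
    have hdom' : Integrable (fun x => (‖ξ x‖ + K) ^ q) m := by
      have := hdom.integrable_norm_rpow (by simpa using hq0) ENNReal.ofReal_ne_top
      rw [ENNReal.toReal_ofReal hq0.le] at this
      refine this.congr (ae_of_all _ fun x => ?_)
      simp only [Real.norm_of_nonneg (add_nonneg (norm_nonneg (ξ x)) hK0)]
    refine tendsto_integral_filter_of_dominated_convergence (fun x => (‖ξ x‖ + K) ^ q / p + K ^ q / q)
      ?_ ?_ ((hdom'.div_const p).add (integrable_const _)) ?_
    · exact Eventually.of_forall fun τ => (hint τ).1
    · filter_upwards [Ioo_mem_nhdsGT one_pos] with τ hτ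
      refine ae_of_all _ fun x => ?_
      have e1 : ‖ξ x + τ • torusGrad χ x‖ ≤ ‖ξ x‖ + K := by
        refine (norm_add_le _ _).trans ?_
        rw [norm_smul, Real.norm_of_nonneg hτ.1.le]
        have := mul_le_mul hτ.2.le (hK x) (norm_nonneg _) zero_le_one
        linarith
      have e2 := Real.young_inequality_of_nonneg
        (norm_nonneg (pgrad q (ξ x + τ • torusGrad χ x))) (norm_nonneg (torusGrad χ x)) hpq
      rw [norm_pgrad_rpow hpq.symm] at e2
      have e3 := Real.rpow_le_rpow (norm_nonneg _) e1 hq0.le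
      have e4 := Real.rpow_le_rpow (norm_nonneg _) (hK x) hq0.le
      have e5 := norm_inner_le_norm (𝕜 := ℝ) (torusGrad χ x) (pgrad q (ξ x + τ • torusGrad χ x))
      rw [mul_comm] at e5
      refine (e5.trans e2).trans ?_
      gcongr
    · refine ae_of_all _ fun x => ?_
      have hc : Continuous fun τ : ℝ =>
          (inner ℝ (torusGrad χ x) (pgrad q (ξ x + τ • torusGrad χ x)) : ℝ) :=
        continuous_const.inner ((continuous_pgrad hq1).comp
          (continuous_const.add (continuous_id.smul continuous_const)))
      have := hc.tendsto 0
      simp only [zero_smul, add_zero] at this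
      exact this.mono_left nhdsWithin_le_nhds
  refine ge_of_tendsto hlim ?_
  filter_upwards [self_mem_nhdsWithin] with τ hτ using step τ hτ

theorem isTangentVelocity_of_minimizing (h : IsGradFunctional q A m ℓ) (hpq : p.HolderConjugate q)
    [IsProbabilityMeasure m] {I : ℝ} (hI : ∀ φ, TorusSmooth φ → I ≤ gradEnergy q m ℓ φ)
    {ξ : Torus d → Tangent d} (hξ : MemLp ξ (ENNReal.ofReal q) m)
    (happ : ∀ ε > 0, ∃ φ, TorusSmooth φ ∧ gradEnergy q m ℓ φ ≤ I + ε ∧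
      lpn q (fun x => torusGrad φ x - ξ x) m ≤ ε) :
    IsTangentVelocity p q m ℓ fun x => pgrad q (ξ x) := by
  refine ⟨hξ.pgrad hpq.symm, fun ψ hψ => ?_, fun ε hε => ?_⟩
  · refine le_antisymm (h.rate_le_of_minimizing hpq hI hξ happ hψ) ?_
    have h1 := h.rate_le_of_minimizing hpq hI hξ happ (hψ.const_mul (-1))
    rw [h.const_mul] at h1
    simp only [hψ.grad_const_mul, inner_smul_left, RCLike.conj_to_real] at h1
    rw [integral_const_mul] at h1
    linarith
  · obtain ⟨φ, hφ, -, h2⟩ := happ ε hε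
    exact ⟨φ, hφ, by simpa only [pgrad_pgrad hpq.symm] using h2⟩

end IsGradFunctional

end GradFunctional

section Selection

variable {d : ℕ} {p q A : ℝ} {m : Measure (Torus d)} {ℓ : (Torus d → ℝ) → ℝ}
  {ψ : ℕ → Torus d → ℝ}

/-- All members of the family with at most the energy of `ψ k` are `(1/2) ^ N`-close to `ψ k`. -/
def NearMinimal {d : ℕ} (q : ℝ) (m : Measure (Torus d)) (ℓ : (Torus d → ℝ) → ℝ)
    (ψ : ℕ → Torus d → ℝ) (N k : ℕ) : Prop :=
  ∀ j, gradEnergy q m ℓ (ψ j) ≤ gradEnergy q m ℓ (ψ k) →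
    lpn q (fun x => torusGrad (ψ j) x - torusGrad (ψ k) x) m ≤ (1 / 2) ^ N

theorem NearMinimal.lpn_le {N M j k : ℕ} (hj : NearMinimal q m ℓ ψ N j)
    (hk : NearMinimal q m ℓ ψ M k) (hNM : N ≤ M) :
    lpn q (fun x => torusGrad (ψ j) x - torusGrad (ψ k) x) m ≤ (1 / 2) ^ N := by
  rcases le_total (gradEnergy q m ℓ (ψ k)) (gradEnergy q m ℓ (ψ j)) with h | h
  · rw [lpn_sub_comm]
    exact hj k h
  · exact (hk j h).trans (pow_le_pow_of_le_one (by norm_num) (by norm_num) hNM)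

namespace IsGradFunctional

theorem exists_index_energy_le (h : IsGradFunctional q A m ℓ) (hpq : p.HolderConjugate q)
    [IsProbabilityMeasure m] (hψ : ∀ k, TorusSmooth (ψ k))
    (hdense : ∀ φ, TorusSmooth φ → ∀ ε > 0, ∃ k, ∀ x, ‖torusGrad φ x - torusGrad (ψ k) x‖ ≤ ε)
    {I : ℝ} (hI : ∀ ε > 0, ∃ φ, TorusSmooth φ ∧ gradEnergy q m ℓ φ ≤ I + ε) {ε : ℝ}
    (hε : 0 < ε) : ∃ k, gradEnergy q m ℓ (ψ k) ≤ I + ε := by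
  obtain ⟨φ, hφ, h1⟩ := hI (ε / 2) (half_pos hε)
  obtain ⟨δ, hδ, h2⟩ := h.exists_energy_le_add hpq.symm.lt hφ (half_pos hε)
  obtain ⟨k, hk⟩ := hdense φ hφ δ hδ
  refine ⟨k, ?_⟩
  have h3 := h2 (ψ k) (hψ k) δ le_rfl hδ.le (by
    rw [lpn_sub_comm]
    exact lpn_le_of_norm_le hpq.symm.pos hδ.le hk)
  linarith

theorem exists_nearMinimal (h : IsGradFunctional q A m ℓ) (hpq : p.HolderConjugate q)
    [IsProbabilityMeasure m] (hψ : ∀ k, TorusSmooth (ψ k))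
    (hdense : ∀ φ, TorusSmooth φ → ∀ ε > 0, ∃ k, ∀ x, ‖torusGrad φ x - torusGrad (ψ k) x‖ ≤ ε)
    (N : ℕ) : ∃ k, NearMinimal q m ℓ ψ N k := by
  obtain ⟨I, hI0, hI, hI'⟩ := h.exists_inf hpq
  obtain ⟨δ, hδ, h1⟩ := h.exists_cluster hpq hI0 hI (η := (1 / 2) ^ N) (by positivity)
  obtain ⟨k, hk⟩ := h.exists_index_energy_le hpq hψ hdense hI' hδ
  exact ⟨k, fun j hj => h1 _ _ (hψ j) (hψ k) (hj.trans hk) hk⟩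

theorem isTangentVelocity_of_nearMinimal (h : IsGradFunctional q A m ℓ)
    (hpq : p.HolderConjugate q) [IsProbabilityMeasure m] (hψ : ∀ k, TorusSmooth (ψ k))
    (hdense : ∀ φ, TorusSmooth φ → ∀ ε > 0, ∃ k, ∀ x, ‖torusGrad φ x - torusGrad (ψ k) x‖ ≤ ε)
    {k : ℕ → ℕ} (hk : ∀ N, NearMinimal q m ℓ ψ N (k N)) :
    IsTangentVelocity p q m ℓ
      fun x => pgrad q (limUnder atTop fun N => torusGrad (ψ (k N)) x) := by
  have hq0 := hpq.symm.pos
  obtain ⟨I, hI0, hI, hI'⟩ := h.exists_inf hpq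
  set ξ : Torus d → Tangent d := fun x => limUnder atTop fun N => torusGrad (ψ (k N)) x with hξdef
  have hmem : ∀ N, MemLp (torusGrad (ψ (k N))) (ENNReal.ofReal q) m := fun N =>
    (hψ (k N)).memLp_grad m _
  let B : ℕ → ℝ≥0∞ := fun N => ENNReal.ofReal (2 * (1 / 2) ^ N)
  have hB : ∑' N, B N ≠ ∞ :=
    (summable_geometric_two.mul_left 2).tsum_ofReal_ne_top
  have hcau : ∀ N n k' : ℕ, N ≤ n → N ≤ k' →
      eLpNorm (torusGrad (ψ (k n)) - torusGrad (ψ (k k'))) (ENNReal.ofReal q) m < B N := by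
    intro N n k' hn hk'
    have hpow : ∀ {a b : ℕ}, a ≤ b → (1 / 2 : ℝ) ^ b ≤ (1 / 2) ^ a := fun hab =>
      pow_le_pow_of_le_one (by norm_num) (by norm_num) hab
    have h1 : lpn q (fun x => torusGrad (ψ (k n)) x - torusGrad (ψ (k k')) x) m ≤ (1 / 2) ^ N := by
      rcases le_total n k' with hle | hle
      · exact ((hk n).lpn_le (hk k') hle).trans (hpow hn)
      · rw [lpn_sub_comm]
        exact ((hk k').lpn_le (hk n) hle).trans (hpow hk')
    have h2 : eLpNorm (torusGrad (ψ (k n)) - torusGrad (ψ (k k'))) (ENNReal.ofReal q) m = _ :=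
      eLpNorm_eq_lpn hq0 ((hmem n).sub (hmem k'))
    rw [h2]
    refine (ENNReal.ofReal_lt_ofReal_iff (by positivity)).2 (lt_of_le_of_lt h1 ?_)
    have : (0 : ℝ) < (1 / 2) ^ N := by positivity
    linarith
  have hlim : ∀ᵐ x ∂m, Tendsto (fun N => torusGrad (ψ (k N)) x) atTop (𝓝 (ξ x)) := by
    filter_upwards [Lp.ae_tendsto_of_cauchy_eLpNorm (fun N => (hmem N).1)
      (by simpa using hpq.symm.lt.le) hB hcau] with x hx
    exact tendsto_nhds_limUnder hx
  have hconv := Lp.cauchy_tendsto_of_tendsto (fun N => (hmem N).1) ξ hB hcau hlim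
  have hξm : AEStronglyMeasurable ξ m :=
    aestronglyMeasurable_of_tendsto_ae atTop (fun N => (hmem N).1) hlim
  have hξ : MemLp ξ (ENNReal.ofReal q) m := by
    obtain ⟨N, hN⟩ := (hconv.eventually_lt_const ENNReal.zero_lt_top).exists
    have h1 : MemLp (torusGrad (ψ (k N)) - ξ) (ENNReal.ofReal q) m :=
      ⟨(hmem N).1.sub hξm, hN⟩
    have h2 := (hmem N).sub h1
    rwa [sub_sub_cancel] at h2
  refine h.isTangentVelocity_of_minimizing hpq hI hξ fun ε hε => ?_
  obtain ⟨j, hj⟩ := h.exists_index_energy_le hpq hψ hdense hI' (half_pos hε)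
  obtain ⟨δ, hδ, h1⟩ := h.exists_energy_le_add hpq.symm.lt (hψ j) (half_pos hε)
  have e1 := hconv.eventually_lt_const (show (0 : ℝ≥0∞) < ENNReal.ofReal ε by simpa using hε)
  have e2 : ∀ᶠ N : ℕ in atTop, (1 / 2 : ℝ) ^ N < δ :=
    (tendsto_pow_atTop_nhds_zero_of_lt_one (by norm_num) (by norm_num)).eventually_lt_const hδ
  obtain ⟨N, hN1, hN2⟩ := (e1.and e2).exists
  refine ⟨ψ (k N), hψ _, ?_, ?_⟩
  · rcases le_total (gradEnergy q m ℓ (ψ (k N))) (gradEnergy q m ℓ (ψ j)) with hle | hle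
    · linarith
    · have h2 := h1 (ψ (k N)) (hψ _) _ hN2.le (by positivity) (by
        rw [lpn_sub_comm]; exact hk N j hle)
      linarith
  · have h2 : eLpNorm (torusGrad (ψ (k N)) - ξ) (ENNReal.ofReal q) m = _ :=
      eLpNorm_eq_lpn hq0 ((hmem N).sub hξ)
    rw [h2] at hN1
    exact ((ENNReal.ofReal_lt_ofReal_iff hε).1 hN1).le

end IsGradFunctional

theorem GoodTime.isGradFunctional (hpq : p.HolderConjugate q)
    {μ : ℝ → ProbabilityMeasure (Torus d)} {t : ℝ} (h : GoodTime p μ t) :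
    ∃ A, IsGradFunctional q A (μ t : Measure (Torus d)) (rate μ t) := by
  obtain ⟨A, hA0, hA⟩ := h.lip
  exact ⟨A, hA0, fun φ ψ hφ hψ => h.rate_add hφ hψ, fun c ψ => GoodTime.rate_const_mul c ψ,
    fun ψ hψ => h.abs_rate_le hpq hA0 (hA.filter_mono nhdsWithin_le_nhds).frequently hψ⟩

theorem IsACCurve.exists_velocity {g : ℝ → ℝ} {μ : ℝ → ProbabilityMeasure (Torus d)}
    (h : IsACCurve p g μ) (hpq : p.HolderConjugate q) :
    ∃ v : ℝ → Torus d → Tangent d, Measurable (Function.uncurry v) ∧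
      ∀ t, GoodTime p μ t → IsTangentVelocity p q (μ t : Measure (Torus d)) (rate μ t) (v t) := by
  classical
  obtain ⟨ψ, hψ, hdense⟩ := exists_dense_grad d
  have hcont : ∀ {F : Torus d → Tangent d}, Continuous F →
      Measurable fun t => ∫ x, ‖F x‖ ^ q ∂(μ t : Measure (Torus d)) := fun hF =>
    (h.continuous_integral ((Real.continuous_rpow_const hpq.symm.pos.le).comp hF.norm)).measurable
  have hE : ∀ k, Measurable fun t => gradEnergy q (μ t : Measure (Torus d)) (rate μ t) (ψ k) :=
    fun k => ((hcont (hψ k).continuous_grad).div_const q).sub (measurable_deriv _)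
  have hD : ∀ j k, Measurable fun t =>
      lpn q (fun x => torusGrad (ψ j) x - torusGrad (ψ k) x) (μ t : Measure (Torus d)) := fun j k =>
    (hcont ((hψ j).continuous_grad.sub (hψ k).continuous_grad)).pow_const _
  let S : ℕ → ℕ → ℝ → Prop := fun N k t =>
    NearMinimal q (μ t : Measure (Torus d)) (rate μ t) ψ N k
  have hS : ∀ N k, MeasurableSet {t | S N k t} := fun N k => by
    have : {t | S N k t} = ⋂ j, ({t | gradEnergy q (μ t : Measure (Torus d)) (rate μ t) (ψ j) ≤
        gradEnergy q (μ t : Measure (Torus d)) (rate μ t) (ψ k)}ᶜ ∪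
        {t | lpn q (fun x => torusGrad (ψ j) x - torusGrad (ψ k) x) (μ t : Measure (Torus d)) ≤
          (1 / 2) ^ N}) := by
      ext t
      simp only [S, NearMinimal, mem_ofPred_eq, mem_iInter, mem_union, mem_compl_iff,
        imp_iff_not_or]
    rw [this]
    exact MeasurableSet.iInter fun j => (measurableSet_le (hE j) (hE k)).compl.union
      (measurableSet_le (hD j k) measurable_const)
  have hex : ∀ N t, ∃ k, S N k t ∨ ∀ j, ¬ S N j t := fun N t => by
    by_cases hn : ∃ k, S N k t
    · exact hn.imp fun k hk => Or.inl hk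
    · exact ⟨0, Or.inr (not_exists.1 hn)⟩
  let κ : ℕ → ℝ → ℕ := fun N t => Nat.find (hex N t)
  have hκ : ∀ N, Measurable (κ N) := fun N => measurable_find (hex N) fun k => by
    have h1 : {t | S N k t ∨ ∀ j, ¬ S N j t} = {t | S N k t} ∪ ⋂ j, {t | S N j t}ᶜ := by
      ext t; simp
    rw [h1]
    exact (hS N k).union (MeasurableSet.iInter fun j => (hS N j).compl)
  let ξ : ℕ → ℝ × Torus d → Tangent d := fun N z => torusGrad (ψ (κ N z.1)) z.2
  have hξ : ∀ N, Measurable (ξ N) := fun N => by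
    have h1 : Measurable fun z : ℕ × Torus d => torusGrad (ψ z.1) z.2 :=
      measurable_from_prod_countable_right fun k => (hψ k).continuous_grad.measurable
    exact h1.comp (((hκ N).comp measurable_fst).prodMk measurable_snd)
  refine ⟨fun t x => pgrad q (limUnder atTop fun N => ξ N (t, x)), ?_, fun t ht => ?_⟩
  · have h1 : StronglyMeasurable fun z => limUnder atTop fun N => ξ N z :=
      StronglyMeasurable.limUnder fun N => (hξ N).stronglyMeasurable
    exact (continuous_pgrad hpq.symm.lt).measurable.comp h1.measurable
  · obtain ⟨A, hA⟩ := ht.isGradFunctional hpq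
    refine hA.isTangentVelocity_of_nearMinimal hpq hψ hdense (k := fun N => κ N t) fun N => ?_
    rcases Nat.find_spec (hex N t) with h1 | h1
    · exact h1
    · obtain ⟨k, hk⟩ := hA.exists_nearMinimal hpq hψ hdense N
      exact absurd hk (h1 k)

end Selection

section KernelMeasurability

variable {d : ℕ} {μ : ℝ → ProbabilityMeasure (Torus d)}

theorem measurable_toMeasure_of_continuous (h : Continuous μ) :
    Measurable fun t => (μ t : Measure (Torus d)) := by
  refine Measurable.measure_of_isPiSystem_of_isProbabilityMeasure
    (S := {s : Set (Torus d) | IsOpen s}) (BorelSpace.measurable_eq) isPiSystem_isOpen ?_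
  intro s hs
  refine LowerSemicontinuous.measurable fun t => lowerSemicontinuousAt_iff_le_liminf.2 ?_
  exact ProbabilityMeasure.le_liminf_measure_open_of_tendsto (h.tendsto t) hs

/-- The measures along a weakly continuous curve, as a Markov kernel. -/
noncomputable def curveKernel (h : Continuous μ) : ProbabilityTheory.Kernel ℝ (Torus d) :=
  ⟨fun t => μ t, measurable_toMeasure_of_continuous h⟩

instance (h : Continuous μ) : ProbabilityTheory.IsMarkovKernel (curveKernel h) :=
  ⟨fun t => inferInstanceAs (IsProbabilityMeasure (μ t : Measure (Torus d)))⟩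

theorem measurable_integral_curve (h : Continuous μ) {f : ℝ → Torus d → ℝ}
    (hf : Measurable (Function.uncurry f)) :
    Measurable fun t => ∫ x, f t x ∂(μ t : Measure (Torus d)) :=
  (StronglyMeasurable.integral_kernel_prod_right (κ := curveKernel h)
    hf.stronglyMeasurable).measurable

theorem measurable_lintegral_curve (h : Continuous μ) {f : ℝ → Torus d → ℝ≥0∞}
    (hf : Measurable (Function.uncurry f)) :
    Measurable fun t => ∫⁻ x, f t x ∂(μ t : Measure (Torus d)) :=
  Measurable.lintegral_kernel_prod_right (κ := curveKernel h) hf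

theorem measurable_lpn_curve (h : Continuous μ) {v : ℝ → Torus d → Tangent d} (p : ℝ)
    (hv : Measurable (Function.uncurry v)) :
    Measurable fun t => lpn p (v t) (μ t : Measure (Torus d)) :=
  (measurable_integral_curve h (f := fun t x => ‖v t x‖ ^ p) (hv.norm.pow_const p)).pow_const _

end KernelMeasurability

section BenamouBrenier

variable {d : ℕ} {p q : ℝ} {μ : ℝ → ProbabilityMeasure (Torus d)} {g : ℝ → ℝ}
  {v : ℝ → Torus d → Tangent d}

/-- `v` is a Borel field of tangent velocities of the curve `μ`. -/
structure IsVelocity {d : ℕ} (p q : ℝ) (μ : ℝ → ProbabilityMeasure (Torus d))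
    (v : ℝ → Torus d → Tangent d) : Prop where
  measurable : Measurable (Function.uncurry v)
  tangent : ∀ t, GoodTime p μ t → IsTangentVelocity p q (μ t : Measure (Torus d)) (rate μ t) (v t)

theorem IsVelocity.measurable_apply (hv : IsVelocity p q μ v) (t : ℝ) : Measurable (v t) :=
  hv.measurable.of_uncurry_left

theorem IsVelocity.lpn_le_of_frequently (hv : IsVelocity p q μ v) (hpq : p.HolderConjugate q)
    {t : ℝ} (ht : GoodTime p μ t) {A : ℝ} (hA0 : 0 ≤ A)
    (hA : ∃ᶠ s in 𝓝[≠] t, wdist p (μ s) (μ t) ≤ A * |s - t|) :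
    lpn p (v t) (μ t : Measure (Torus d)) ≤ A :=
  (hv.tangent t ht).lpn_le hpq hA0 fun _ hψ => ht.abs_rate_le hpq hA0 hA hψ

theorem IsACCurve.ae_lpn_le (h : IsACCurve p g μ) (hpq : p.HolderConjugate q)
    (hv : IsVelocity p q μ v) :
    ∀ᵐ t, GoodTime p μ t ∧ lpn p (v t) (μ t : Measure (Torus d)) ≤ g t := by
  filter_upwards [h.ae_goodTime,
    h.eventually_wdist_le_of_bound h.nonneg h.integrable.locallyIntegrable h.le] with t ht1 ht2
  refine ⟨ht1, le_of_forall_pos_le_add fun ε hε => ?_⟩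
  exact hv.lpn_le_of_frequently hpq ht1 (by linarith [h.nonneg t])
    ((ht2 ε hε).filter_mono nhdsWithin_le_nhds).frequently

theorem IsACCurve.integrable_lpn (h : IsACCurve p g μ) (hpq : p.HolderConjugate q)
    (hv : IsVelocity p q μ v) : Integrable fun t => lpn p (v t) (μ t : Measure (Torus d)) := by
  refine h.integrable.mono' (measurable_lpn_curve h.continuous p
    hv.measurable).aestronglyMeasurable ?_
  filter_upwards [h.ae_lpn_le hpq hv] with t ht
  rw [Real.norm_of_nonneg lpn_nonneg]
  exact ht.2

theorem measurable_add_torusProj_smul {w : Torus d → Tangent d} (hw : Measurable w) (s : ℝ) :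
    Measurable fun x => x + torusProj (s • w x) :=
  measurable_id.add (continuous_torusProj.measurable.comp (hw.const_smul s))

theorem TorusSmooth.hasDerivAt_integral_line {ψ : Torus d → ℝ} (hψ : TorusSmooth ψ)
    {m : Measure (Torus d)} [IsProbabilityMeasure m] {w : Torus d → Tangent d} (hw : Measurable w)
    (hwi : Integrable w m) :
    HasDerivAt (fun s : ℝ => ∫ x, ψ (x + torusProj (s • w x)) ∂m)
      (∫ x, inner ℝ (torusGrad ψ x) (w x) ∂m) 0 := by
  obtain ⟨K, hK0, hK⟩ := hψ.exists_norm_grad_le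
  have hL := hψ.torusLip hK
  have hm : ∀ s : ℝ, Measurable fun x => ψ (x + torusProj (s • w x)) := fun s =>
    hψ.continuous.measurable.comp (measurable_add_torusProj_smul hw s)
  refine (hasDerivAt_integral_of_dominated_loc_of_lip (μ := m) (s := univ)
    (F := fun s x => ψ (x + torusProj (s • w x))) (bound := fun x => K * ‖w x‖)
    (F' := fun x => inner ℝ (torusGrad ψ x) (w x)) univ_mem
    (Eventually.of_forall fun s => (hm s).aestronglyMeasurable) ?_ ?_ ?_
    (hwi.norm.const_mul K) (ae_of_all _ fun x => hψ.hasDerivAt_line x (w x))).2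
  · simpa [torusProj_zero] using hψ.integrable m
  · exact (hψ.continuous_grad.measurable.inner hw).aestronglyMeasurable
  · refine ae_of_all _ fun x => LipschitzOnWith.of_dist_le_mul fun s _ s' _ => ?_
    have h1 := hL.abs_sub_le (x + torusProj (s' • w x)) ((s - s') • w x)
    rw [add_assoc, ← torusProj_add, ← add_smul, add_sub_cancel, norm_smul] at h1
    rw [Real.dist_eq, Real.dist_eq, Real.coe_nnabs,
      abs_of_nonneg (mul_nonneg hK0 (norm_nonneg (w x)))]
    exact h1.trans (le_of_eq (by rw [Real.norm_eq_abs]; ring))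

theorem IsHJSubsolution.deriv_integral_le {K C : ℝ} {u : ℝ → Torus d → ℝ}
    (hpq : p.HolderConjugate q) (hu : IsHJSubsolution p K C u) (hC : 0 ≤ C) {t : ℝ} (ht : GoodTime p μ t)
    {w : Torus d → Tangent d} (hwm : Measurable w)
    (hw : IsTangentVelocity p q (μ t : Measure (Torus d)) (rate μ t) w) {θ : ℝ → ℝ} {c : ℝ}
    (hθ : HasDerivAt θ c t) (hmono : Monotone θ) (hθ0 : 0 ≤ θ t) (hc : 0 < c)
    (hwc : lpn p w (μ t : Measure (Torus d)) ≤ c) {G' : ℝ}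
    (hG : HasDerivAt (fun r => ∫ x, u (θ r) x ∂(μ r : Measure (Torus d))) G' t) : G' ≤ c / p := by
  set m := (μ t : Measure (Torus d)) with hm
  set ψ := u (θ t) with hψdef
  have hψ : TorusSmooth ψ := hu.smooth _
  set ω : Torus d → Tangent d := fun x => c⁻¹ • w x with hω
  have hωm : Measurable ω := hwm.const_smul c⁻¹
  have hωp : MemLp ω (ENNReal.ofReal p) m := hw.memLp.const_smul c⁻¹
  have hωi : Integrable ω m :=
    (hωp.mono_exponent (by simpa using hpq.lt.le : 1 ≤ ENNReal.ofReal p)).integrable le_rfl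
  have hωp1 : ∫ x, ‖ω x‖ ^ p ∂m ≤ 1 := by
    have h1 : lpn p ω m ≤ 1 := by
      rw [hω, lpn_smul hpq.pos, abs_of_pos (inv_pos.2 hc), inv_mul_le_iff₀ hc, mul_one]
      exact hwc
    simpa using (lpn_le_iff hpq.pos zero_le_one).1 h1
  set f : ℝ → ℝ := fun s => ∫ x, ψ (x + torusProj (s • ω x)) ∂m with hf
  have hfd : HasDerivAt f (∫ x, inner ℝ (torusGrad ψ x) (ω x) ∂m) 0 :=
    hψ.hasDerivAt_integral_line hωm hωi
  have hinner : ∫ x, inner ℝ (torusGrad ψ x) (ω x) ∂m = c⁻¹ * rate μ t ψ := by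
    rw [hw.rate_eq ψ hψ, ← integral_const_mul]
    simp only [hω, inner_smul_right]
  have hk : HasDerivAt (fun r => -(θ r - θ t)) (-c) t := (hθ.sub_const _).neg
  have hfk : HasDerivAt (fun r => f (-(θ r - θ t))) (-rate μ t ψ) t := by
    have h1 : HasDerivAt f (∫ x, inner ℝ (torusGrad ψ x) (ω x) ∂m) (-(θ t - θ t)) := by
      simpa using hfd
    have h2 := h1.comp t hk
    have h3 : c⁻¹ * rate μ t ψ * -c = -rate μ t ψ := by field_simp
    rw [hinner, h3] at h2
    exact h2
  have hΦ : HasDerivAt (fun r => f (-(θ r - θ t)) + (θ r - θ t) / p) (-rate μ t ψ + c / p) t :=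
    hfk.add ((hθ.sub_const _).div_const p)
  have hint : ∀ s r, Integrable (u s) (μ r : Measure (Torus d)) := fun s r =>
    (hu.smooth s).integrable _
  have h1 : Tendsto (slope (fun r => ∫ x, u (θ r) x ∂(μ r : Measure (Torus d))) t) (𝓝[>] t)
      (𝓝 G') := (hasDerivAt_iff_tendsto_slope.1 hG).mono_left
        (nhdsWithin_mono _ fun _ h => ne_of_gt h)
  have h2 := ((ht.tendsto_slope_family hpq.lt.le hC hu.smooth hu.time_lip
    hθ.continuousAt).mono_left (nhdsWithin_mono _ fun _ h => ne_of_gt h)).add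
    ((hasDerivAt_iff_tendsto_slope.1 hΦ).mono_left
      (nhdsWithin_mono _ fun _ h => ne_of_gt h : 𝓝[>] t ≤ 𝓝[≠] t))
  rw [add_neg_cancel_left] at h2
  refine le_of_tendsto_of_tendsto h1 h2 ?_
  filter_upwards [self_mem_nhdsWithin] with r hr
  have hr0 : 0 < r - t := sub_pos.2 hr
  rw [slope_eq_div, slope_eq_div, ← add_div]
  refine div_le_div_of_nonneg_right ?_ hr0.le
  have hk0 : 0 ≤ θ r - θ t := sub_nonneg.2 (hmono (le_of_lt hr))
  have hf0 : f 0 = ∫ x, ψ x ∂m := by simp [hf, torusProj_zero]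
  have hstep : ∫ x, u (θ r) x ∂m ≤ f (-(θ r - θ t)) + (θ r - θ t) / p := by
    have hb : ∀ x, u (θ r) x ≤ ψ (x + torusProj (-(θ r - θ t) • ω x)) +
        (θ r - θ t) / p * ‖ω x‖ ^ p := fun x => by
      have := hu.step (θ t) (θ r - θ t) hθ0 hk0 (x + torusProj (-(θ r - θ t) • ω x)) (ω x)
      rw [add_assoc, ← torusProj_add, neg_smul, neg_add_cancel, torusProj_zero, add_zero,
        add_sub_cancel] at this
      rw [neg_smul]
      refine this.trans (le_of_eq ?_)
      rw [hψdef]; ring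
    have hi1 : Integrable (fun x => ψ (x + torusProj (-(θ r - θ t) • ω x))) m := by
      obtain ⟨B, -, hB⟩ := exists_bound_of_continuous hψ.continuous
      exact Integrable.of_bound (hψ.continuous.measurable.comp
        (measurable_add_torusProj_smul hωm _)).aestronglyMeasurable B (ae_of_all _ fun x => hB _)
    have hi2 := (hωp.integrable_rpow hpq.pos).const_mul ((θ r - θ t) / p)
    have h3 := integral_mono (hint (θ r) t) (hi1.add hi2) hb
    simp only [Pi.add_apply] at h3
    rw [integral_add hi1 hi2, integral_const_mul] at h3
    have h4 := mul_le_mul_of_nonneg_left hωp1 (div_nonneg hk0 hpq.pos.le)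
    linarith
  simp only [sub_self, neg_zero, zero_div, add_zero]
  rw [hf0]
  linarith

theorem sub_le_integral_of_deriv_le {f m n : ℝ → ℝ} (hm : LocallyIntegrable m volume)
    (h : ∀ s t, s ≤ t → |f t - f s| ≤ ∫ τ in s..t, m τ) (hn : LocallyIntegrable n volume)
    {a b : ℝ} (hab : a ≤ b)
    (hle : ∀ᵐ t, t ∈ Icc a b → ∀ f', HasDerivAt f f' t → f' ≤ n t) :
    f b - f a ≤ ∫ τ in a..b, n τ := by
  have hac := absolutelyContinuousOnInterval_of_abs_sub_le hm h a b
  rw [← hac.integral_deriv_eq_sub]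
  refine intervalIntegral.integral_mono_ae_restrict hab hac.intervalIntegrable_deriv
    (hn.intervalIntegrable' a b) ?_
  rw [EventuallyLE, ae_restrict_iff' measurableSet_Icc]
  filter_upwards [hle, ae_differentiableAt_of_abs_sub_le hm h] with t h1 h2 ht
  exact h1 ht _ h2.hasDerivAt

theorem IsACCurve.wdist_le_integral_lpn (h : IsACCurve p g μ) (hpq : p.HolderConjugate q)
    (hv : IsVelocity p q μ v) {a b : ℝ} (hab : a ≤ b) :
    wdist p (μ a) (μ b) ≤ ∫ r in a..b, lpn p (v r) (μ r : Measure (Torus d)) := by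
  rcases hab.eq_or_lt with rfl | hab'
  · simpa using h.le a a le_rfl
  refine le_of_forall_pos_le_add fun ε hε => ?_
  have hNi := h.integrable_lpn hpq hv
  set N : ℝ → ℝ := fun r => lpn p (v r) (μ r : Measure (Torus d)) with hN
  have hN0 : ∀ r, 0 ≤ N r := fun r => lpn_nonneg
  have hba : 0 < b - a := sub_pos.2 hab'
  set e := ε / (b - a) with he
  have he0 : 0 < e := div_pos hε hba
  set n : ℝ → ℝ := fun r => N r + e with hn
  have hni : LocallyIntegrable n volume :=
    hNi.locallyIntegrable.add (locallyIntegrable_const e)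
  have hn0 : ∀ r, 0 ≤ n r := fun r => add_nonneg (hN0 r) he0.le
  set θ : ℝ → ℝ := fun r => ∫ τ in a..r, n τ with hθ
  have hθsub : ∀ r r', θ r' - θ r = ∫ τ in r..r', n τ := fun r r' =>
    intervalIntegral.integral_interval_sub_left (hni.intervalIntegrable' _ _)
      (hni.intervalIntegrable' _ _)
  have hmono : Monotone θ := fun r r' hr => by
    rw [← sub_nonneg, hθsub]
    exact intervalIntegral.integral_nonneg hr fun τ _ => hn0 τ
  have hθa : θ a = 0 := intervalIntegral.integral_same
  set T := θ b with hT
  have hTeq : T = (∫ r in a..b, N r) + ε := by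
    rw [hT, hθ]
    simp only [hn]
    rw [intervalIntegral.integral_add hNi.intervalIntegrable intervalIntegrable_const,
      intervalIntegral.integral_const, smul_eq_mul, he, mul_div_cancel₀ _ hba.ne']
  have hT0 : 0 < T := by
    rw [hTeq]
    exact add_pos_of_nonneg_of_pos (intervalIntegral.integral_nonneg hab fun r _ => hN0 r) hε
  rw [← hTeq, ← Real.rpow_le_rpow_iff wdist_nonneg hT0.le h.pos]
  refine wdist_rpow_le_of_dual h.one_lt.le fun φ χ hφχ => ?_
  set S := ∫ x, φ x ∂(μ a : Measure (Torus d)) + ∫ y, χ y ∂(μ b : Measure (Torus d)) with hS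
  have key : ∀ δ > 0, T ^ (1 - p) / p * S ≤ T / p + 2 * δ := fun δ hδ => by
    obtain ⟨K, C, u, hK, hC, hu, hu0, huT⟩ :=
      exists_hjSubsolution hpq φ.continuous hφχ hT0 hδ
    set G : ℝ → ℝ := fun r => ∫ x, u (θ r) x ∂(μ r : Measure (Torus d)) with hG
    have hint : ∀ s r, Integrable (u s) (μ r : Measure (Torus d)) := fun s r =>
      (hu.smooth s).integrable _
    have hmi : LocallyIntegrable (fun τ => C * n τ + K * g τ) volume :=
      (hni.smul C).add (h.integrable.const_mul K).locallyIntegrable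
    have hGm : ∀ r r', r ≤ r' → |G r' - G r| ≤ ∫ τ in r..r', (C * n τ + K * g τ) := by
      intro r r' hr
      rw [intervalIntegral.integral_add ((hni.intervalIntegrable' _ _).const_mul C)
        (h.integrable.intervalIntegrable.const_mul K), intervalIntegral.integral_const_mul,
        ← hθsub]
      have h1 := h.abs_integral_sub_le hK (hu.lip (θ r')) hr
      have h2 : |∫ x, u (θ r') x ∂(μ r : Measure (Torus d)) - G r| ≤ C * (θ r' - θ r) := by
        rw [hG, ← integral_sub (hint _ _) (hint _ _), ← abs_of_nonneg (sub_nonneg.2 (hmono hr)),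
          ← Real.norm_eq_abs]
        refine (norm_integral_le_of_norm_le_const (ae_of_all _ fun x => ?_)).trans
          (le_of_eq (by rw [probReal_univ, mul_one]))
        exact hu.time _ _ x
      have h3 := abs_add_le (∫ x, u (θ r') x ∂(μ r : Measure (Torus d)) - G r)
        (G r' - ∫ x, u (θ r') x ∂(μ r : Measure (Torus d)))
      rw [sub_add_sub_cancel'] at h3
      linarith
    have h1 := sub_le_integral_of_deriv_le (n := fun r => n r / p) hmi hGm
      (by simp only [div_eq_inv_mul]; exact hni.smul p⁻¹) hab (by
        filter_upwards [h.ae_goodTime, LocallyIntegrable.ae_hasDerivAt_integral hni]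
          with r hr1 hr2 hr3 G' hG'
        exact hu.deriv_integral_le hpq hC hr1 (hv.measurable_apply r) (hv.tangent r hr1)
          (hr2 a) hmono (by rw [← hθa]; exact hmono hr3.1)
          (add_pos_of_nonneg_of_pos (hN0 r) he0) (le_add_of_nonneg_right he0.le) hG')
    rw [intervalIntegral.integral_div] at h1
    have hφi := (ContinuousMap.integrable_torus φ (μ a : Measure (Torus d))).const_mul
      (T ^ (1 - p) / p)
    have hχi := (ContinuousMap.integrable_torus χ (μ b : Measure (Torus d))).const_mul
      (T ^ (1 - p) / p)
    have h2 : G a ≤ -(T ^ (1 - p) / p * ∫ x, φ x ∂(μ a : Measure (Torus d))) + δ := by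
      have := integral_mono (hint 0 a) (hφi.neg.add (integrable_const δ)) hu0
      simp only [Pi.add_apply, Pi.neg_apply] at this
      rw [integral_add hφi.fun_neg (integrable_const δ), integral_neg, integral_const_mul] at this
      simpa [hG, hθa] using this
    have h3 : T ^ (1 - p) / p * ∫ x, χ x ∂(μ b : Measure (Torus d)) - δ ≤ G b := by
      have := integral_mono (hχi.sub (integrable_const δ)) (hint T b) huT
      simp only [Pi.sub_apply] at this
      rw [integral_sub hχi (integrable_const δ), integral_const_mul] at this
      simpa [hG] using this
    have h4 : ∫ r in a..b, n r = T := rfl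
    rw [h4] at h1
    rw [hS, mul_add]
    linarith
  have h1 : T ^ (1 - p) / p * S ≤ T / p := by
    refine le_of_forall_pos_le_add fun δ hδ => ?_
    have := key (δ / 2) (half_pos hδ)
    linarith
  rw [div_mul_eq_mul_div, div_le_div_iff_of_pos_right h.pos] at h1
  have h2 := mul_le_mul_of_nonneg_left h1 (Real.rpow_nonneg hT0.le (p - 1))
  rwa [← mul_assoc, ← Real.rpow_add hT0, ← Real.rpow_add_one hT0.ne', sub_add_cancel,
    sub_add_sub_cancel', sub_self, Real.rpow_zero, one_mul] at h2

/-- At almost every time the metric derivative of the curve is the norm of the velocity. -/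
theorem IsACCurve.ae_hasMetricDerivAt (h : IsACCurve p g μ) (hpq : p.HolderConjugate q)
    (hv : IsVelocity p q μ v) : ∀ᵐ t, GoodTime p μ t ∧
      Tendsto (fun s => wdist p (μ s) (μ t) / |s - t|) (𝓝[≠] t)
        (𝓝 (lpn p (v t) (μ t : Measure (Torus d)))) := by
  filter_upwards [h.ae_goodTime, h.eventually_wdist_le_of_bound (fun _ => lpn_nonneg)
    (h.integrable_lpn hpq hv).locallyIntegrable
    fun s t hst => h.wdist_le_integral_lpn hpq hv hst] with t ht1 ht2
  refine ⟨ht1, tendsto_order.2 ⟨fun A hA => ?_, fun A hA => ?_⟩⟩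
  · by_contra hcon
    rw [not_eventually] at hcon
    have hcon' : ∃ᶠ s in 𝓝[≠] t, wdist p (μ s) (μ t) ≤ A * |s - t| := by
      refine (hcon.and_eventually self_mem_nhdsWithin).mono fun s hs => ?_
      have h0 : 0 < |s - t| := abs_pos.2 (sub_ne_zero.2 hs.2)
      rw [← div_le_iff₀ h0]
      exact not_lt.1 hs.1
    obtain ⟨s, hs, hst⟩ := (hcon'.and_eventually self_mem_nhdsWithin).exists
    have hA0 : 0 ≤ A := by
      have h0 : 0 < |s - t| := abs_pos.2 (sub_ne_zero.2 hst)
      exact le_of_mul_le_mul_right (by rw [zero_mul]; exact wdist_nonneg.trans hs) h0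
    exact absurd (hv.lpn_le_of_frequently hpq ht1 hA0 hcon') (not_le.2 hA)
  · filter_upwards [(ht2 ((A - lpn p (v t) (μ t : Measure (Torus d))) / 2)
      (by linarith)).filter_mono nhdsWithin_le_nhds, self_mem_nhdsWithin] with s hs hst
    have h0 : 0 < |s - t| := abs_pos.2 (sub_ne_zero.2 hst)
    rw [div_lt_iff₀ h0]
    refine hs.trans_lt (mul_lt_mul_of_pos_right (by linarith) h0)

end BenamouBrenier

section TestFunctions

variable {d : ℕ} {a b : ℝ} {ψ : ℝ → Torus d → ℝ}

namespace IsTestFunction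

theorem torusSmooth (h : IsTestFunction a b ψ) (t : ℝ) : TorusSmooth (ψ t) :=
  h.smooth.comp (contDiff_prodMk_right t)

theorem hasDerivAt (h : IsTestFunction a b ψ) (t : ℝ) (u : Tangent d) :
    HasDerivAt (fun τ => ψ τ (torusProj u))
      (fderiv ℝ (fun z : ℝ × Tangent d => ψ z.1 (torusProj z.2)) (t, u) (1, 0)) t := by
  have h1 := ((h.smooth.differentiable (by simp)) (t, u)).hasFDerivAt
  have h2 : HasDerivAt (fun τ : ℝ => (τ, u)) (1, 0) t :=
    (hasDerivAt_id t).prodMk (hasDerivAt_const t u)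
  exact h1.comp_hasDerivAt t h2

theorem hasDerivAt_deriv (h : IsTestFunction a b ψ) (t : ℝ) (x : Torus d) :
    HasDerivAt (fun τ => ψ τ x) (deriv (fun τ => ψ τ x) t) t := by
  obtain ⟨u, rfl⟩ := isOpenQuotientMap_torusProj.surjective x
  exact (h.hasDerivAt t u).differentiableAt.hasDerivAt

theorem isOpenQuotientMap_prod :
    IsOpenQuotientMap (Prod.map id torusProj : ℝ × Tangent d → ℝ × Torus d) :=
  IsOpenQuotientMap.id.prodMap isOpenQuotientMap_torusProj

theorem continuous_deriv (h : IsTestFunction a b ψ) :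
    Continuous fun z : ℝ × Torus d => deriv (fun τ => ψ τ z.2) z.1 := by
  refine isOpenQuotientMap_prod.isQuotientMap.continuous_iff.2 ?_
  have h1 : Continuous fun z : ℝ × Tangent d =>
      fderiv ℝ (fun z : ℝ × Tangent d => ψ z.1 (torusProj z.2)) z (1, 0) :=
    (h.smooth.continuous_fderiv (by simp)).clm_apply continuous_const
  refine h1.congr fun z => ?_
  exact (h.hasDerivAt z.1 z.2).deriv.symm

theorem continuous_grad (h : IsTestFunction a b ψ) :
    Continuous fun z : ℝ × Torus d => torusGrad (ψ z.1) z.2 := by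
  refine isOpenQuotientMap_prod.isQuotientMap.continuous_iff.2 ?_
  have h1 : Continuous fun z : ℝ × Tangent d =>
      (InnerProductSpace.toDual ℝ (Tangent d)).symm
        ((fderiv ℝ (fun z : ℝ × Tangent d => ψ z.1 (torusProj z.2)) z).comp
          (ContinuousLinearMap.inr ℝ ℝ (Tangent d))) :=
    (InnerProductSpace.toDual ℝ (Tangent d)).symm.continuous.comp
      ((h.smooth.continuous_fderiv (by simp)).clm_comp continuous_const)
  refine h1.congr fun z => ?_
  have h2 := ((h.smooth.differentiable (by simp)) z).hasFDerivAt
  have h3 : HasFDerivAt (fun u : Tangent d => (z.1, u)) (ContinuousLinearMap.inr ℝ ℝ (Tangent d))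
      z.2 := hasFDerivAt_prodMk_right z.1 z.2
  have h4 := HasFDerivAt.comp z.2 h2 h3
  simp only [Function.comp_def, Prod.map_fst, Prod.map_snd, id]
  rw [torusGrad_torusProj, gradient]
  congr 1
  exact h4.fderiv.symm

theorem exists_bound {E : Type*} [NormedAddCommGroup E] {F : ℝ × Torus d → E} (hF : Continuous F)
    {a' b' : ℝ} (h0 : ∀ t, t ∉ Icc a' b' → ∀ x, F (t, x) = 0) :
    ∃ C, 0 ≤ C ∧ ∀ t x, ‖F (t, x)‖ ≤ C := by
  obtain ⟨C, hC⟩ := (isCompact_Icc.prod isCompact_univ :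
    IsCompact (Icc a' b' ×ˢ (univ : Set (Torus d)))).exists_bound_of_continuousOn hF.continuousOn
  refine ⟨max C 0, le_max_right _ _, fun t x => ?_⟩
  by_cases ht : t ∈ Icc a' b'
  · exact (hC (t, x) ⟨ht, trivial⟩).trans (le_max_left _ _)
  · rw [h0 t ht x, norm_zero]
    exact le_max_right _ _

theorem exists_deriv_bound (h : IsTestFunction a b ψ) :
    ∃ C, 0 ≤ C ∧ ∀ t x, |deriv (fun τ => ψ τ x) t| ≤ C := by
  obtain ⟨a', b', -, -, h0⟩ := h.support
  refine exists_bound (F := fun z => deriv (fun τ => ψ τ z.2) z.1) h.continuous_deriv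
    (a' := a') (b' := b') fun t ht x => ?_
  have h1 : (fun τ => ψ τ x) =ᶠ[𝓝 t] fun _ => 0 := by
    filter_upwards [isClosed_Icc.isOpen_compl.mem_nhds ht] with τ hτ
    rw [h0 τ hτ]; rfl
  simpa using h1.deriv_eq

theorem exists_grad_bound (h : IsTestFunction a b ψ) :
    ∃ K, 0 ≤ K ∧ ∀ t x, ‖torusGrad (ψ t) x‖ ≤ K := by
  obtain ⟨a', b', -, -, h0⟩ := h.support
  refine exists_bound (F := fun z => torusGrad (ψ z.1) z.2) h.continuous_grad
    (a' := a') (b' := b') fun t ht x => ?_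
  simp [torusGrad, h0 t ht, gradient]

theorem eventually_torusLip (h : IsTestFunction a b ψ) (t : ℝ) {ε : ℝ} (hε : 0 < ε) :
    ∀ᶠ s in 𝓝 t, TorusLip ε fun x => ψ s x - ψ t x := by
  have h1 : ∀ᶠ s in 𝓝 t, ∀ x ∈ (univ : Set (Torus d)),
      ‖torusGrad (ψ s) x - torusGrad (ψ t) x‖ < ε := by
    refine isCompact_univ.eventually_forall_of_forall_eventually fun x _ => ?_
    have hc : Continuous fun z : ℝ × Torus d => ‖torusGrad (ψ z.1) z.2 - torusGrad (ψ t) z.2‖ :=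
      (h.continuous_grad.sub ((h.torusSmooth t).continuous_grad.comp continuous_snd)).norm
    have h2 := hc.tendsto (t, x)
    simp only [sub_self, norm_zero] at h2
    exact h2.eventually_lt_const hε
  filter_upwards [h1] with s hs
  refine ((h.torusSmooth s).sub (h.torusSmooth t)).torusLip fun x => ?_
  rw [(h.torusSmooth s).grad_sub (h.torusSmooth t)]
  exact (hs x trivial).le

theorem abs_sub_le_of_deriv_bound (h : IsTestFunction a b ψ) {C : ℝ}
    (hC : ∀ t x, |deriv (fun τ => ψ τ x) t| ≤ C) (s t : ℝ) (x : Torus d) :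
    |ψ t x - ψ s x| ≤ C * |t - s| :=
  convex_univ.norm_image_sub_le_of_norm_deriv_le (f := fun τ => ψ τ x)
    (fun τ _ => (h.hasDerivAt_deriv τ x).differentiableAt) (fun τ _ => hC τ x)
    (mem_univ s) (mem_univ t)

theorem hasDerivAt_integral (h : IsTestFunction a b ψ) (m : Measure (Torus d))
    [IsProbabilityMeasure m] (t : ℝ) :
    HasDerivAt (fun s => ∫ x, ψ s x ∂m) (∫ x, deriv (fun τ => ψ τ x) t ∂m) t := by
  obtain ⟨C, hC0, hC⟩ := h.exists_deriv_bound
  refine (hasDerivAt_integral_of_dominated_loc_of_lip (μ := m) (s := univ) (F := ψ)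
    (bound := fun _ => C) univ_mem
    (Eventually.of_forall fun s => (h.torusSmooth s).continuous.aestronglyMeasurable)
    ((h.torusSmooth t).integrable m) ?_ ?_ (integrable_const C)
    (ae_of_all _ fun x => h.hasDerivAt_deriv t x)).2
  · exact (h.continuous_deriv.comp (Continuous.prodMk_right t)).aestronglyMeasurable
  · refine ae_of_all _ fun x => LipschitzOnWith.of_dist_le_mul fun s _ s' _ => ?_
    rw [Real.dist_eq, Real.dist_eq, Real.coe_nnabs, abs_of_nonneg hC0]
    exact h.abs_sub_le_of_deriv_bound hC s' s x

end IsTestFunction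

end TestFunctions

section ContinuityEquation

variable {d : ℕ} {p q a b : ℝ} {μ : ℝ → ProbabilityMeasure (Torus d)} {g : ℝ → ℝ}
  {v w : ℝ → Torus d → Tangent d} {ψ : ℝ → Torus d → ℝ}

theorem GoodTime.hasDerivAt_integral_testFunction (hp : 1 ≤ p) {t : ℝ} (ht : GoodTime p μ t)
    (hψ : IsTestFunction a b ψ) :
    HasDerivAt (fun s => ∫ x, ψ s x ∂(μ s : Measure (Torus d)))
      (∫ x, deriv (fun τ => ψ τ x) t ∂(μ t : Measure (Torus d)) + rate μ t (ψ t)) t := by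
  rw [hasDerivAt_iff_tendsto_slope]
  have h1 := (hasDerivAt_iff_tendsto_slope.1
    (hψ.hasDerivAt_integral (μ t : Measure (Torus d)) t)).add
    (ht.tendsto_slope_of_eventually hp hψ.torusSmooth fun ε hε => hψ.eventually_torusLip t hε)
  refine h1.congr fun s => ?_
  rw [slope_eq_div, slope_eq_div, ← add_div]
  congr 1; ring

theorem IsACCurve.integral_testFunction_eq_zero (h : IsACCurve p g μ)
    (hψ : IsTestFunction a b ψ) :
    ∫ t in a..b, (∫ x, deriv (fun τ => ψ τ x) t ∂(μ t : Measure (Torus d)) + rate μ t (ψ t)) =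
      0 := by
  obtain ⟨C, hC0, hC⟩ := hψ.exists_deriv_bound
  obtain ⟨K, hK0, hK⟩ := hψ.exists_grad_bound
  set H : ℝ → ℝ := fun s => ∫ x, ψ s x ∂(μ s : Measure (Torus d)) with hH
  have hint : ∀ s r, Integrable (ψ s) (μ r : Measure (Torus d)) := fun s r =>
    (hψ.torusSmooth s).integrable _
  have hac : AbsolutelyContinuousOnInterval H a b := by
    refine absolutelyContinuousOnInterval_of_abs_sub_le (m := fun τ => C + K * g τ)
      ((locallyIntegrable_const C).add (h.integrable.const_mul K).locallyIntegrable)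
      (fun s t hst => ?_) a b
    rw [intervalIntegral.integral_add intervalIntegrable_const
      (h.integrable.intervalIntegrable.const_mul K), intervalIntegral.integral_const, smul_eq_mul]
    have h1 := h.abs_integral_sub_le hK0 ((hψ.torusSmooth t).torusLip (hK t)) hst
    have h2 : |∫ x, ψ t x ∂(μ s : Measure (Torus d)) - H s| ≤ C * (t - s) := by
      rw [hH, ← integral_sub (hint _ _) (hint _ _), ← abs_of_nonneg (sub_nonneg.2 hst),
        ← Real.norm_eq_abs]
      exact (norm_integral_le_of_norm_le_const (ae_of_all _ fun x =>
        hψ.abs_sub_le_of_deriv_bound hC s t x)).trans (le_of_eq (by rw [probReal_univ, mul_one]))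
    have h3 := abs_add_le (∫ x, ψ t x ∂(μ s : Measure (Torus d)) - H s)
      (H t - ∫ x, ψ t x ∂(μ s : Measure (Torus d)))
    rw [sub_add_sub_cancel'] at h3
    linarith
  have h0 : ∀ t, t ∉ Ioo a b → H t = 0 := fun t ht => by
    obtain ⟨a', b', ha, hb, h0⟩ := hψ.support
    have : ψ t = 0 := h0 t fun h' => ht ⟨ha.trans_le h'.1, h'.2.trans_lt hb⟩
    simp [hH, this]
  have h1 := hac.integral_deriv_eq_sub
  rw [h0 a (by simp), h0 b (by simp), sub_zero] at h1
  rw [← h1]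
  refine intervalIntegral.integral_congr_ae ?_
  filter_upwards [h.ae_goodTime] with t ht _
  exact (ht.hasDerivAt_integral_testFunction h.one_lt.le hψ).deriv.symm

theorem integral_inner_grad_bound {K : ℝ} {m : Measure (Torus d)} {G w : Torus d → Tangent d}
    (hK : ∀ x, ‖G x‖ ≤ K) (hw : Integrable w m) :
    |∫ x, inner ℝ (G x) (w x) ∂m| ≤ K * ∫ x, ‖w x‖ ∂m := by
  rw [← integral_const_mul]
  rw [← Real.norm_eq_abs]
  exact norm_integral_le_of_norm_le (hw.norm.const_mul K) (ae_of_all _ fun x =>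
    (norm_inner_le_norm (G x) (w x)).trans (mul_le_mul_of_nonneg_right (hK x) (norm_nonneg _)))

theorem integrable_inner_bounded {K : ℝ} {m : Measure (Torus d)} {G w : Torus d → Tangent d}
    (hG : AEStronglyMeasurable G m) (hK : ∀ x, ‖G x‖ ≤ K) (hw : Integrable w m) :
    Integrable (fun x => inner ℝ (G x) (w x)) m :=
  (hw.norm.const_mul K).mono' (hG.inner hw.1) (ae_of_all _ fun x =>
    (norm_inner_le_norm _ _).trans (mul_le_mul_of_nonneg_right (hK x) (norm_nonneg _)))

theorem IsACCurve.solvesContinuityEquation (h : IsACCurve p g μ) (hpq : p.HolderConjugate q)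
    (hv : IsVelocity p q μ v) (hab : a ≤ b) : SolvesContinuityEquation a b μ v := by
  have hint : ∀ t, GoodTime p μ t → Integrable (v t) (μ t : Measure (Torus d)) := fun t ht =>
    ((hv.tangent t ht).memLp.mono_exponent
      (by simpa using hpq.lt.le : 1 ≤ ENNReal.ofReal p)).integrable le_rfl
  refine ⟨hv.measurable, ?_, fun ψ hψ => ?_⟩
  · refine lt_of_le_of_lt (setLIntegral_le_lintegral _ _) ?_
    have h1 := (h.integrable_lpn hpq hv).lintegral_lt_top
    refine lt_of_le_of_lt (lintegral_mono_ae ?_) h1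
    filter_upwards [h.ae_goodTime] with t ht
    rw [← ofReal_integral_norm_eq_lintegral_enorm (hint t ht)]
    exact ENNReal.ofReal_le_ofReal (integral_norm_le_lpn hpq.lt.le (hv.tangent t ht).memLp)
  · rw [integral_Icc_eq_integral_Ioc, ← intervalIntegral.integral_of_le hab,
      ← h.integral_testFunction_eq_zero hψ]
    refine intervalIntegral.integral_congr_ae ?_
    filter_upwards [h.ae_goodTime] with t ht _
    obtain ⟨C, hC0, hC⟩ := hψ.exists_deriv_bound
    obtain ⟨K, hK0, hK⟩ := (hψ.torusSmooth t).exists_norm_grad_le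
    rw [(hv.tangent t ht).rate_eq _ (hψ.torusSmooth t), integral_add]
    · exact Integrable.of_bound
        (hψ.continuous_deriv.comp (Continuous.prodMk_right t)).aestronglyMeasurable C
        (ae_of_all _ fun x => hC t x)
    · exact integrable_inner_bounded (hψ.torusSmooth t).continuous_grad.aestronglyMeasurable hK
        (hint t ht)

theorem isTestFunction_mul {α : ℝ → ℝ} (hα : ContDiff ℝ ((⊤ : ℕ∞) : WithTop ℕ∞) α)
    (hc : HasCompactSupport α) (hs : tsupport α ⊆ Ioo a b) {φ : Torus d → ℝ}
    (hφ : TorusSmooth φ) : IsTestFunction a b fun t x => α t * φ x := by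
  have hφ' : ContDiff ℝ ((⊤ : ℕ∞) : WithTop ℕ∞) fun u : Tangent d => φ (torusProj u) := hφ
  refine ⟨(hα.comp contDiff_fst).mul (hφ'.comp contDiff_snd), ?_⟩
  have h0 : ∀ t, t ∉ tsupport α → (fun x => α t * φ x) = 0 := fun t ht => by
    ext x; simp [image_eq_zero_of_notMem_tsupport ht]
  rcases (tsupport α).eq_empty_or_nonempty with he | hne
  · exact ⟨a + 1, b - 1, by linarith, by linarith, fun t _ => h0 t (by simp [he])⟩
  · obtain ⟨a', ha', hla⟩ := hc.isCompact.exists_isLeast hne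
    obtain ⟨b', hb', hlb⟩ := hc.isCompact.exists_isGreatest hne
    exact ⟨a', b', (hs ha').1, (hs hb').2, fun t ht => h0 t fun h => ht ⟨hla h, hlb h⟩⟩

namespace SolvesContinuityEquation

theorem ae_integrable (h : SolvesContinuityEquation a b μ w) (hμ : Continuous μ) :
    ∀ᵐ t ∂(volume.restrict (Icc a b)), Integrable (w t) (μ t : Measure (Torus d)) := by
  have hm := measurable_lintegral_curve hμ (f := fun t x => ‖w t x‖ₑ) h.borel.enorm
  filter_upwards [ae_lt_top hm h.integrable.ne] with t ht
  exact ⟨h.borel.of_uncurry_left.aestronglyMeasurable, ht⟩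

theorem integrableOn_inner (h : SolvesContinuityEquation a b μ w) (hμ : Continuous μ)
    {φ : Torus d → ℝ} (hφ : TorusSmooth φ) :
    IntegrableOn (fun t => ∫ x, inner ℝ (torusGrad φ x) (w t x) ∂(μ t : Measure (Torus d)))
      (Icc a b) := by
  obtain ⟨K, hK0, hK⟩ := hφ.exists_norm_grad_le
  have hm := measurable_lintegral_curve hμ (f := fun t x => ‖w t x‖ₑ) h.borel.enorm
  have h1 : IntegrableOn (fun t => ∫ x, ‖w t x‖ ∂(μ t : Measure (Torus d))) (Icc a b) := by
    have h2 : IntegrableOn (fun t => (∫⁻ x, ‖w t x‖ₑ ∂(μ t : Measure (Torus d))).toReal)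
      (Icc a b) := integrable_toReal_of_lintegral_ne_top hm.aemeasurable h.integrable.ne
    refine h2.congr ?_
    filter_upwards [h.ae_integrable hμ] with t ht
    rw [integral_norm_eq_lintegral_enorm ht.1]
  refine Integrable.mono' (h1.const_mul K) ?_ ?_
  · exact (measurable_integral_curve hμ (f := fun t x => inner ℝ (torusGrad φ x) (w t x))
      ((hφ.continuous_grad.measurable.comp measurable_snd).inner h.borel)).aestronglyMeasurable
  · filter_upwards [h.ae_integrable hμ] with t ht
    exact integral_inner_grad_bound hK ht

theorem integral_mul_eq (h : SolvesContinuityEquation a b μ w) (hμ : Continuous μ) {α : ℝ → ℝ}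
    (hα : ContDiff ℝ ((⊤ : ℕ∞) : WithTop ℕ∞) α) (hc : HasCompactSupport α)
    (hs : tsupport α ⊆ Ioo a b) {φ : Torus d → ℝ} (hφ : TorusSmooth φ) :
    ∫ t in Icc a b, α t * ∫ x, inner ℝ (torusGrad φ x) (w t x) ∂(μ t : Measure (Torus d)) =
      -∫ t in Icc a b, deriv α t * ∫ x, φ x ∂(μ t : Measure (Torus d)) := by
  obtain ⟨K, hK0, hK⟩ := hφ.exists_norm_grad_le
  obtain ⟨B, -, hB⟩ := exists_bound_of_continuous hφ.continuous
  have h1 := h.equation _ (isTestFunction_mul hα hc hs hφ)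
  have h2 : IntegrableOn (fun t => deriv α t * ∫ x, φ x ∂(μ t : Measure (Torus d))) (Icc a b) := by
    refine Continuous.integrableOn_Icc ((hα.continuous_deriv (by simp)).mul ?_)
    rw [continuous_iff_continuousAt]
    intro t
    exact ProbabilityMeasure.tendsto_iff_forall_integral_tendsto.1 (hμ.tendsto t)
      (BoundedContinuousFunction.ofNormedAddCommGroup φ hφ.continuous B hB)
  have h3 : IntegrableOn (fun t => α t *
      ∫ x, inner ℝ (torusGrad φ x) (w t x) ∂(μ t : Measure (Torus d))) (Icc a b) := by
    obtain ⟨A, hA⟩ := hc.exists_bound_of_continuous hα.continuous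
    exact (h.integrableOn_inner hμ hφ).bdd_mul hα.continuous.aestronglyMeasurable
      (ae_of_all _ hA)
  rw [eq_neg_iff_add_eq_zero, add_comm, ← integral_add h2 h3, ← h1]
  refine integral_congr_ae ?_
  filter_upwards [h.ae_integrable hμ] with t ht
  simp only [hφ.grad_const_mul, real_inner_smul_left, deriv_mul_const_field]
  rw [integral_add ((hφ.integrable _).const_mul _)
    ((integrable_inner_bounded hφ.continuous_grad.aestronglyMeasurable hK ht).const_mul _),
    integral_const_mul, integral_const_mul]

theorem ae_integral_inner_eq (hv : SolvesContinuityEquation a b μ v)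
    (hw : SolvesContinuityEquation a b μ w) (hμ : Continuous μ) :
    ∀ᵐ t ∂(volume.restrict (Icc a b)), ∀ φ, TorusSmooth φ →
      ∫ x, inner ℝ (torusGrad φ x) (v t x) ∂(μ t : Measure (Torus d)) =
        ∫ x, inner ℝ (torusGrad φ x) (w t x) ∂(μ t : Measure (Torus d)) := by
  have key : ∀ φ, TorusSmooth φ → ∀ᵐ t ∂(volume.restrict (Icc a b)),
      ∫ x, inner ℝ (torusGrad φ x) (v t x) ∂(μ t : Measure (Torus d)) =
        ∫ x, inner ℝ (torusGrad φ x) (w t x) ∂(μ t : Measure (Torus d)) := fun φ hφ => by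
    have hi := (hv.integrableOn_inner hμ hφ).sub (hw.integrableOn_inner hμ hφ)
    rw [← restrict_Ioo_eq_restrict_Icc, ae_restrict_iff' measurableSet_Ioo]
    have h1 := isOpen_Ioo.ae_eq_zero_of_integral_contDiff_smul_eq_zero (μ := volume)
      ((hi.mono_set Ioo_subset_Icc_self).locallyIntegrableOn) fun α hα hc hs => by
        have h2 : ∫ t in Icc a b, α t • (∫ x, inner ℝ (torusGrad φ x) (v t x)
            ∂(μ t : Measure (Torus d)) - ∫ x, inner ℝ (torusGrad φ x) (w t x)
            ∂(μ t : Measure (Torus d))) = 0 := by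
          obtain ⟨A, hA⟩ := hc.exists_bound_of_continuous hα.continuous
          have h3 : ∀ {F : ℝ → ℝ}, IntegrableOn F (Icc a b) →
              IntegrableOn (fun t => α t * F t) (Icc a b) := fun hF =>
            Integrable.bdd_mul hF hα.continuous.aestronglyMeasurable (ae_of_all _ hA)
          simp only [smul_eq_mul, mul_sub]
          rw [integral_sub (h3 (hv.integrableOn_inner hμ hφ)) (h3 (hw.integrableOn_inner hμ hφ)),
            hv.integral_mul_eq hμ hα hc hs hφ, hw.integral_mul_eq hμ hα hc hs hφ, sub_self]
        rw [← h2]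
        refine (setIntegral_eq_integral_of_forall_compl_eq_zero fun t ht => ?_).symm
        rw [image_eq_zero_of_notMem_tsupport fun h => ht (Ioo_subset_Icc_self (hs h)), zero_smul]
    filter_upwards [h1] with t ht ht'
    exact sub_eq_zero.1 (ht ht')
  obtain ⟨ψ, hψ, hdense⟩ := exists_dense_grad d
  filter_upwards [ae_all_iff.2 fun k => key (ψ k) (hψ k), hv.ae_integrable hμ,
    hw.ae_integrable hμ] with t ht htv htw φ hφ
  refine eq_of_abs_sub_le_all fun ε hε => ?_
  set V := ∫ x, ‖v t x‖ ∂(μ t : Measure (Torus d)) with hV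
  set W := ∫ x, ‖w t x‖ ∂(μ t : Measure (Torus d)) with hW
  have hV0 : 0 ≤ V := integral_nonneg fun _ => norm_nonneg _
  have hW0 : 0 ≤ W := integral_nonneg fun _ => norm_nonneg _
  obtain ⟨k, hk⟩ := hdense φ hφ (ε / (V + W + 1)) (by positivity)
  obtain ⟨K, -, hK⟩ := hφ.exists_norm_grad_le
  obtain ⟨L, -, hL⟩ := (hψ k).exists_norm_grad_le
  have h1 : ∀ {y : Torus d → Tangent d}, Integrable y (μ t : Measure (Torus d)) →
      |∫ x, inner ℝ (torusGrad φ x) (y x) ∂(μ t : Measure (Torus d)) -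
        ∫ x, inner ℝ (torusGrad (ψ k) x) (y x) ∂(μ t : Measure (Torus d))| ≤
      ε / (V + W + 1) * ∫ x, ‖y x‖ ∂(μ t : Measure (Torus d)) := fun hy => by
    rw [← integral_sub (integrable_inner_bounded hφ.continuous_grad.aestronglyMeasurable hK hy)
      (integrable_inner_bounded (hψ k).continuous_grad.aestronglyMeasurable hL hy)]
    simp only [← inner_sub_left]
    exact integral_inner_grad_bound hk hy
  have h2 := h1 htv
  have h3 := h1 htw
  rw [ht k] at h2
  have h4 : ε / (V + W + 1) * V + ε / (V + W + 1) * W ≤ ε := by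
    rw [← mul_add, div_mul_eq_mul_div, div_le_iff₀ (by positivity)]
    nlinarith
  rw [abs_le] at h2 h3 ⊢
  constructor <;> linarith [h2.1, h2.2, h3.1, h3.2]

end SolvesContinuityEquation

end ContinuityEquation

section StrongConvergence

variable {d : ℕ} {p q : ℝ} {m : Measure (Torus d)} {ℓ : (Torus d → ℝ) → ℝ}
  {v : Torus d → Tangent d}

/-- A vector field over `m` that has almost the norm of the tangent velocity `v` and almost its
action on one suitable gradient is close to `v`. -/
theorem IsTangentVelocity.exists_lpn_sub_le (h : IsTangentVelocity p q m ℓ v)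
    (hpq : p.HolderConjugate q) {ε : ℝ} (hε : 0 < ε) :
    ∃ δ > 0, ∃ φ, TorusSmooth φ ∧ ∀ (Ω : Type) [MeasurableSpace Ω] (m' : Measure Ω)
      (f : Ω → Torus d) (X : Ω → Tangent d), IsFiniteMeasure m' → Measurable f → m'.map f = m →
      MemLp X (ENNReal.ofReal p) m' → lpn p X m' ≤ lpn p v m + δ →
      |∫ z, inner ℝ (torusGrad φ (f z)) (X z) ∂m' - ∫ x, inner ℝ (torusGrad φ x) (v x) ∂m| ≤ δ →
      lpn p (fun z => X z - v (f z)) m' ≤ ε := by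
  have hp0 := hpq.pos
  set N := lpn p v m with hN
  have hN0 : 0 ≤ N := lpn_nonneg
  have hD : 0 < (N + 1) ^ p + N ^ p := by positivity
  obtain ⟨C, hC0, hC⟩ := exists_integral_norm_sub_rpow_le_bregman hpq
    (ε := ε ^ p / (2 * ((N + 1) ^ p + N ^ p))) (by positivity) d
  have hF : Continuous fun δ : ℝ => C * ((N + δ) ^ p - N ^ p + p * (δ + δ * (2 * N + δ))) :=
    continuous_const.mul ((((Real.continuous_rpow_const hp0.le).comp
      (continuous_const.add continuous_id)).sub continuous_const).add (by fun_prop))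
  have hF0 := hF.tendsto 0
  simp only [add_zero, sub_self, zero_mul, mul_zero] at hF0
  obtain ⟨δ, ⟨hδF, hδ1⟩, hδ0 : 0 < δ⟩ := (((hF0.eventually_lt_const
    (show (0 : ℝ) < ε ^ p / 2 by positivity)).and (eventually_le_nhds one_pos)).filter_mono
    nhdsWithin_le_nhds |>.and (self_mem_nhdsWithin (a := (0 : ℝ)) (s := Ioi 0))).exists
  obtain ⟨φ, hφ, hφδ⟩ := h.approx δ hδ0
  refine ⟨δ, hδ0, φ, hφ, fun Ω _ m' f X _ hf hfm hX hXN hXφ => ?_⟩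
  have : IsFiniteMeasure m := hfm ▸ inferInstance
  have hv := h.memLp
  have hξ := hv.pgrad hpq
  have hG : MemLp (torusGrad φ) (ENNReal.ofReal q) m := hφ.memLp_grad m _
  have hdiff : MemLp (fun x => torusGrad φ x - pgrad p (v x)) (ENNReal.ofReal q) m := hG.sub hξ
  have hcomp : ∀ {Y : Torus d → Tangent d} {r : ℝ≥0∞}, MemLp Y r m →
      MemLp (fun z => Y (f z)) r m' := fun hY => by
    rw [← hfm] at hY
    exact hY.comp_of_map hf.aemeasurable
  have hlpn : ∀ {Y : Torus d → Tangent d} {r : ℝ}, AEStronglyMeasurable Y m →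
      lpn r (fun z => Y (f z)) m' = lpn r Y m := fun hY => by
    rw [← hfm] at hY ⊢
    rw [lpn_map hf.aemeasurable hY]
  have e1 := abs_integral_inner_le hpq.symm (hcomp hdiff) hX
  rw [hlpn (Y := fun x => torusGrad φ x - pgrad p (v x)) hdiff.1] at e1
  simp only [inner_sub_left] at e1
  rw [integral_sub (integrable_inner_of_memLp hpq.symm (hcomp hG) hX)
    (integrable_inner_of_memLp hpq.symm (hcomp hξ) hX)] at e1
  have e2 := abs_integral_inner_le hpq.symm hdiff hv
  simp only [inner_sub_left] at e2
  rw [integral_sub (integrable_inner_of_memLp hpq.symm hG hv)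
    (integrable_inner_of_memLp hpq.symm hξ hv)] at e2
  have e3 : ∫ x, inner ℝ (pgrad p (v x)) (v x) ∂m = N ^ p := by
    rw [hN, lpn_rpow hp0]
    simp only [inner_pgrad_self hpq.lt]
  have e4 := mul_le_mul hφδ hXN lpn_nonneg hδ0.le
  have e5 := mul_le_mul_of_nonneg_right hφδ hN0
  rw [e3] at e2
  have hvf : ∫ z, ‖v (f z)‖ ^ p ∂m' = N ^ p := by
    rw [← lpn_rpow hp0, hlpn hv.1]
  have hXp : ∫ z, ‖X z‖ ^ p ∂m' ≤ (N + δ) ^ p := by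
    rw [← lpn_rpow hp0]
    exact Real.rpow_le_rpow lpn_nonneg hXN hp0.le
  have hlow : N ^ p - (δ + δ * (2 * N + δ)) ≤ ∫ z, inner ℝ (pgrad p (v (f z))) (X z) ∂m' := by
    rw [abs_le] at e1 e2 hXφ
    linarith [e1.1, e1.2, e2.1, e2.2, hXφ.1, hXφ.2]
  have hfin := hC Ω m' X (fun z => v (f z)) hX (hcomp hv)
  rw [hvf] at hfin
  rw [lpn_le_iff hp0 hε.le]
  refine hfin.trans ?_
  have b1 : ε ^ p / (2 * ((N + 1) ^ p + N ^ p)) * (∫ z, ‖X z‖ ^ p ∂m' + N ^ p) ≤ ε ^ p / 2 := by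
    have h1 : (N + δ) ^ p ≤ (N + 1) ^ p :=
      Real.rpow_le_rpow (by positivity) (by linarith) hp0.le
    rw [div_mul_eq_mul_div, div_le_div_iff₀ (by positivity) two_pos]
    have h2 : ∫ z, ‖X z‖ ^ p ∂m' + N ^ p ≤ (N + 1) ^ p + N ^ p := by linarith
    have h3 := mul_le_mul_of_nonneg_left h2 (show 0 ≤ ε ^ p * 2 by positivity)
    linarith
  have b2 : ∫ z, ‖X z‖ ^ p ∂m' - N ^ p -
      p * (∫ z, inner ℝ (pgrad p (v (f z))) (X z) ∂m' - N ^ p) ≤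
      (N + δ) ^ p - N ^ p + p * (δ + δ * (2 * N + δ)) := by
    have := mul_le_mul_of_nonneg_left hlow hp0.le
    linarith
  have b3 := mul_le_mul_of_nonneg_left b2 hC0
  linarith

theorem IsTangentVelocity.ae_eq [IsProbabilityMeasure m] (h : IsTangentVelocity p q m ℓ v)
    (hpq : p.HolderConjugate q) {w : Torus d → Tangent d} (hw : MemLp w (ENNReal.ofReal p) m)
    (heq : ∀ φ, TorusSmooth φ → ∫ x, inner ℝ (torusGrad φ x) (v x) ∂m =
      ∫ x, inner ℝ (torusGrad φ x) (w x) ∂m) (hle : lpn p w m ≤ lpn p v m) : v =ᵐ[m] w := by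
  have h0 : lpn p (fun x => w x - v x) m ≤ 0 := by
    refine le_of_forall_pos_le_add fun ε hε => ?_
    obtain ⟨δ, hδ, φ, hφ, hfin⟩ := h.exists_lpn_sub_le hpq hε
    rw [zero_add]
    refine hfin (Torus d) m id w inferInstance measurable_id Measure.map_id hw (by linarith) ?_
    simp only [id]
    rw [heq φ hφ, sub_self, abs_zero]
    exact hδ.le
  have h1 : MemLp (fun x => w x - v x) (ENNReal.ofReal p) m := hw.sub h.memLp
  have h2 := eLpNorm_eq_lpn hpq.pos h1
  rw [le_antisymm h0 lpn_nonneg, ENNReal.ofReal_zero,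
    eLpNorm_eq_zero_iff h1.1 (by simpa using hpq.pos)] at h2
  filter_upwards [h2] with x hx
  exact (sub_eq_zero.1 hx).symm

end StrongConvergence

section ChainRule

variable {d : ℕ} {p q : ℝ} {μ : ℝ → ProbabilityMeasure (Torus d)} {g : ℝ → ℝ}
  {v : ℝ → Torus d → Tangent d}

theorem toMeasure_transportVariation (μ : ProbabilityMeasure (Torus d)) {φ : Torus d → Tangent d}
    (hφ : Measurable φ) (t : ℝ) :
    (transportVariation μ φ hφ t : Measure (Torus d × Torus d)) =
      (μ : Measure (Torus d)).map fun x => (x, x + torusProj (t • φ x)) := rfl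

theorem measurable_prodMk_add_torusProj_smul {w : Torus d → Tangent d} (hw : Measurable w) (s : ℝ) :
    Measurable fun x => (x, x + torusProj (s • w x)) :=
  measurable_id.prodMk (measurable_add_torusProj_smul hw s)

theorem isTransportPlan_transportVariation (μ : ProbabilityMeasure (Torus d))
    {φ : Torus d → Tangent d} (hφ : Measurable φ) (t : ℝ) :
    IsTransportPlan (transportVariation μ φ hφ t) μ
      ((transportVariation μ φ hφ t).map measurable_snd.aemeasurable) := by
  refine ⟨?_, rfl⟩
  ext1
  rw [ProbabilityMeasure.toMeasure_map, toMeasure_transportVariation,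
    Measure.map_map measurable_fst (measurable_prodMk_add_torusProj_smul hφ t)]
  have h : (Prod.fst ∘ fun x => (x, x + torusProj (t • φ x)) : Torus d → Torus d) = id := rfl
  rw [h, Measure.map_id]

theorem wdist_transportVariation_le (hp : 0 < p) {μ ν : ProbabilityMeasure (Torus d)}
    {φ : Torus d → Tangent d} (hφ : Measurable φ) (hφp : MemLp φ (ENNReal.ofReal p)
    (μ : Measure (Torus d))) (t : ℝ) {π : ProbabilityMeasure (Torus d × Torus d)}
    (hπ : IsTransportPlan π μ ν) :
    wdist p ((transportVariation μ φ hφ t).map measurable_snd.aemeasurable) ν ≤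
      lpn p (fun z => torusDisp z.1 z.2 - t • φ z.1) (π : Measure (Torus d × Torus d)) := by
  have hT := measurable_add_torusProj_smul hφ t
  have hS : Measurable fun z : Torus d × Torus d => (z.1 + torusProj (t • φ z.1), z.2) :=
    (hT.comp measurable_fst).prodMk measurable_snd
  have hplan : IsTransportPlan (π.map hS.aemeasurable)
      ((transportVariation μ φ hφ t).map measurable_snd.aemeasurable) ν := by
    constructor
    · ext1
      rw [ProbabilityMeasure.toMeasure_map, ProbabilityMeasure.toMeasure_map,
        ProbabilityMeasure.toMeasure_map, toMeasure_transportVariation,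
        Measure.map_map measurable_fst hS, Measure.map_map measurable_snd
          (measurable_prodMk_add_torusProj_smul hφ t), ← hπ.map_fst,
        Measure.map_map _ measurable_fst]
      · rfl
      · exact measurable_snd.comp (measurable_prodMk_add_torusProj_smul hφ t)
    · ext1
      rw [ProbabilityMeasure.toMeasure_map, ProbabilityMeasure.toMeasure_map,
        Measure.map_map measurable_snd hS, ← hπ.map_snd]
      rfl
  refine (wdist_le_of_plan hp hplan).trans ?_
  have hi : MemLp (fun z : Torus d × Torus d => torusDisp z.1 z.2 - t • φ z.1)
      (ENNReal.ofReal p) (π : Measure (Torus d × Torus d)) :=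
    (memLp_torusDisp _ _).sub ((hπ.memLp_fst hφp).const_smul t)
  rw [planCostR, ProbabilityMeasure.toMeasure_map,
    lpn_map hS.aemeasurable measurable_torusDisp.aestronglyMeasurable, lpn_le_iff hp lpn_nonneg,
    lpn_rpow hp]
  refine integral_mono_of_nonneg (ae_of_all _ fun z => by positivity) (hi.integrable_rpow hp)
    (ae_of_all _ fun z => ?_)
  exact Real.rpow_le_rpow (norm_nonneg _) (torusDist_add_left_le z.1 z.2 (t • φ z.1)) hp.le

theorem GoodTime.eventually_wdist_transportVariation_le {t : ℝ} (ht : GoodTime p μ t)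
    (hpq : p.HolderConjugate q) {w : Torus d → Tangent d} (hwm : Measurable w)
    (hw : IsTangentVelocity p q (μ t : Measure (Torus d)) (rate μ t) w)
    (hN : Tendsto (fun s => wdist p (μ s) (μ t) / |s - t|) (𝓝[≠] t)
      (𝓝 (lpn p w (μ t : Measure (Torus d))))) {ε : ℝ} (hε : 0 < ε) :
    ∀ᶠ s in 𝓝[>] t, wdist p ((transportVariation (μ t) w hwm (s - t)).map
      measurable_snd.aemeasurable) (μ s) ≤ ε * (s - t) := by
  have hp0 := hpq.pos
  set N := lpn p w (μ t : Measure (Torus d)) with hNdef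
  have hN0 : 0 ≤ N := lpn_nonneg
  obtain ⟨δ, hδ, φ, hφ, hfin⟩ := hw.exists_lpn_sub_le hpq hε
  obtain ⟨C, hC0, hC⟩ := hφ.abs_integral_sub_sub_le hpq.lt.le
    (ε := δ / (3 * (N + δ))) (by positivity)
  have hsub : 𝓝[>] t ≤ 𝓝[≠] t := nhdsWithin_mono _ fun _ h => ne_of_gt h
  have e1 := (hN.mono_left hsub).eventually_lt_const (show N < N + δ / 2 by linarith)
  have e2 := Metric.tendsto_nhds.1 ((ht.tendsto_slope hφ).mono_left hsub) (δ / 3) (by positivity)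
  have e3 : ∀ᶠ s in 𝓝[>] t, s - t < δ / 2 := by
    have : Tendsto (fun s => s - t) (𝓝[>] t) (𝓝 (t - t)) :=
      ((continuous_id.sub continuous_const).tendsto t).mono_left nhdsWithin_le_nhds
    rw [sub_self] at this
    exact this.eventually_lt_const (by positivity)
  have e4 : ∀ᶠ s in 𝓝[>] t, C * (N + δ) ^ p * (s - t) ^ (p - 1) < δ / 3 := by
    have hc : Continuous fun s : ℝ => C * (N + δ) ^ p * (s - t) ^ (p - 1) :=
      continuous_const.mul ((Real.continuous_rpow_const (sub_pos.2 hpq.lt).le).comp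
        (continuous_id.sub continuous_const))
    have h2 := (hc.tendsto t).mono_left (nhdsWithin_le_nhds (s := Ioi t))
    simp only [sub_self, Real.zero_rpow (sub_pos.2 hpq.lt).ne', mul_zero] at h2
    exact h2.eventually_lt_const (by positivity)
  filter_upwards [e1, e2, e3, e4, self_mem_nhdsWithin] with s h1 h2 h3 h4 hs
  have hh : 0 < s - t := sub_pos.2 hs
  rw [abs_of_pos hh, div_lt_iff₀ hh, wdist_comm hp0] at h1
  have hlt : wdist p (μ t) (μ s) < (N + δ) * (s - t) := by nlinarith
  obtain ⟨π, hπ, hπc⟩ := exists_plan_lt hp0 hlt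
  have hc0 : 0 ≤ planCostR p π := lpn_nonneg
  have hX : MemLp (fun z : Torus d × Torus d => (s - t)⁻¹ • torusDisp z.1 z.2)
      (ENNReal.ofReal p) (π : Measure (Torus d × Torus d)) :=
    (memLp_torusDisp _ _).const_smul (s - t)⁻¹
  have hfin' := hfin (Torus d × Torus d) π Prod.fst
    (fun z => (s - t)⁻¹ • torusDisp z.1 z.2) inferInstance measurable_fst hπ.map_fst hX ?_ ?_
  · refine (wdist_transportVariation_le hp0 hwm hw.memLp (s - t) hπ).trans ?_
    have h5 : (fun z : Torus d × Torus d => torusDisp z.1 z.2 - (s - t) • w z.1) =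
        fun z => (s - t) • ((s - t)⁻¹ • torusDisp z.1 z.2 - w z.1) := by
      funext z
      rw [smul_sub, smul_inv_smul₀ hh.ne']
    rw [h5, lpn_smul hp0, abs_of_pos hh, mul_comm]
    exact mul_le_mul_of_nonneg_right hfin' hh.le
  · rw [lpn_smul hp0, abs_of_pos (inv_pos.2 hh), inv_mul_le_iff₀ hh, mul_comm]
    exact hπc.le
  · have h5 := hC hπ
    have h6 : ∫ z, inner ℝ (torusGrad φ z.1) ((s - t)⁻¹ • torusDisp z.1 z.2)
        ∂(π : Measure (Torus d × Torus d)) = (∫ z, inner ℝ (torusGrad φ z.1) (torusDisp z.1 z.2)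
        ∂(π : Measure (Torus d × Torus d))) / (s - t) := by
      simp only [inner_smul_right]
      rw [integral_const_mul, div_eq_inv_mul]
    rw [h6, ← hw.rate_eq φ hφ]
    rw [Real.dist_eq, slope_eq_div] at h2
    have h7 : δ / (3 * (N + δ)) * planCostR p π ≤ δ / 3 * (s - t) := by
      have h8 := mul_le_mul_of_nonneg_left hπc.le
        (show 0 ≤ δ / (3 * (N + δ)) by positivity)
      refine h8.trans (le_of_eq ?_)
      have : N + δ ≠ 0 := by positivity
      field_simp
    have h8 : C * planCostR p π ^ p ≤ δ / 3 * (s - t) := by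
      have h9 : planCostR p π ^ p ≤ (N + δ) ^ p * ((s - t) ^ (p - 1) * (s - t)) := by
        rw [← Real.rpow_add_one hh.ne', sub_add_cancel,
          ← Real.mul_rpow (by positivity) hh.le]
        exact Real.rpow_le_rpow hc0 hπc.le hp0.le
      have h10 := mul_le_mul_of_nonneg_left h9 hC0
      have h11 := mul_le_mul_of_nonneg_right h4.le hh.le
      linarith
    have h9 : |(∫ z, inner ℝ (torusGrad φ z.1) (torusDisp z.1 z.2)
        ∂(π : Measure (Torus d × Torus d))) / (s - t) -
        (∫ x, φ x ∂(μ s : Measure (Torus d)) - ∫ x, φ x ∂(μ t : Measure (Torus d))) / (s - t)| ≤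
        δ / 3 + δ / 3 := by
      rw [← sub_div, abs_div, abs_of_pos hh, div_le_iff₀ hh, abs_sub_comm]
      linarith
    rw [abs_lt] at h2
    rw [abs_le] at h9 ⊢
    constructor <;> linarith [h2.1, h2.2, h9.1, h9.2]

theorem tendsto_integral_inner_torusDisp (hpq : p.HolderConjugate q)
    {m : Measure (Torus d)} {w P : Torus d → Tangent d} (hwm : Measurable w)
    (hw : MemLp w (ENNReal.ofReal p) m) (hP : MemLp P (ENNReal.ofReal q) m) :
    Tendsto (fun h : ℝ => ∫ x, inner ℝ (P x) (h⁻¹ • torusDisp x (x + torusProj (h • w x))) ∂m)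
      (𝓝[>] 0) (𝓝 (∫ x, inner ℝ (P x) (w x) ∂m)) := by
  have hi : Integrable (fun x => ‖P x‖ * ‖w x‖) m := by
    have : ENNReal.HolderConjugate (ENNReal.ofReal q) (ENNReal.ofReal p) :=
      hpq.symm.ennrealOfReal
    exact hP.norm.integrable_mul hw.norm
  refine tendsto_integral_filter_of_dominated_convergence (fun x => ‖P x‖ * ‖w x‖) ?_ ?_ hi ?_
  · refine Eventually.of_forall fun h => hP.1.inner ?_
    exact ((measurable_torusDisp.comp (measurable_id.prodMk
      (measurable_add_torusProj_smul hwm h))).const_smul h⁻¹).aestronglyMeasurable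
  · filter_upwards [self_mem_nhdsWithin] with h (hh : 0 < h)
    refine ae_of_all _ fun x => (norm_inner_le_norm _ _).trans
      (mul_le_mul_of_nonneg_left ?_ (norm_nonneg _))
    have h1 := torusDist_add_torusProj_le x (h • w x)
    rw [torusDist, norm_smul, Real.norm_of_nonneg hh.le] at h1
    rw [norm_smul, Real.norm_of_nonneg (inv_pos.2 hh).le, inv_mul_le_iff₀ hh]
    exact h1
  · refine ae_of_all _ fun x => tendsto_const_nhds.congr' ?_
    have h1 : Tendsto (fun h : ℝ => ‖h • w x‖) (𝓝[>] 0) (𝓝 ‖(0 : ℝ) • w x‖) :=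
      ((continuous_id.smul continuous_const).norm.tendsto (0 : ℝ)).mono_left nhdsWithin_le_nhds
    rw [zero_smul, norm_zero] at h1
    filter_upwards [h1.eventually_lt_const (show (0 : ℝ) < 1 / 2 by norm_num),
      self_mem_nhdsWithin] with h h2 (hh : 0 < h)
    rw [torusDisp_add_torusProj h2, inv_smul_smul₀ hh.ne']

theorem IsWassersteinLipschitz.exists_abs_sub_le (hp : 0 < p)
    {U : ProbabilityMeasure (Torus d) → ℝ} (hU : IsWassersteinLipschitz p U) :
    ∃ L : ℝ, 0 ≤ L ∧ ∀ μ ν, |U μ - U ν| ≤ L * wdist p μ ν := by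
  obtain ⟨L, hL⟩ := hU
  refine ⟨L, L.2, fun μ ν => ?_⟩
  have h := hL μ ν
  have hL0 : (0 : ℝ) ≤ L := L.2
  rw [wasserstein_eq hp, ← ENNReal.ofReal_coe_nnreal, ← ENNReal.ofReal_mul hL0] at h
  exact (ENNReal.ofReal_le_ofReal_iff (mul_nonneg L.2 wdist_nonneg)).1 h

theorem GoodTime.tendsto_slope_comp {t : ℝ} (ht : GoodTime p μ t) (hpq : p.HolderConjugate q)
    {U : ProbabilityMeasure (Torus d) → ℝ} (hU : IsWassersteinLipschitz p U)
    {P : ProbabilityMeasure (Torus d) → Torus d → Tangent d} (hP : IsTransportDerivative p q U P)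
    {w : Torus d → Tangent d} (hwm : Measurable w)
    (hw : IsTangentVelocity p q (μ t : Measure (Torus d)) (rate μ t) w)
    (hN : Tendsto (fun s => wdist p (μ s) (μ t) / |s - t|) (𝓝[≠] t)
      (𝓝 (lpn p w (μ t : Measure (Torus d))))) :
    Tendsto (slope (fun s => U (μ s)) t) (𝓝[>] t)
      (𝓝 (∫ x, inner ℝ (P (μ t) x) (w x) ∂(μ t : Measure (Torus d)))) := by
  obtain ⟨L, hL0, hL⟩ := hU.exists_abs_sub_le hpq.pos
  have hshift : Tendsto (fun s => s - t) (𝓝[>] t) (𝓝[>] 0) := by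
    refine tendsto_nhdsWithin_iff.2 ⟨?_, ?_⟩
    · have : Tendsto (fun s => s - t) (𝓝 t) (𝓝 (t - t)) :=
        (continuous_id.sub continuous_const).tendsto t
      rw [sub_self] at this
      exact this.mono_left nhdsWithin_le_nhds
    · filter_upwards [self_mem_nhdsWithin] with s (hs : t < s) using sub_pos.2 hs
  have h1 := (hP.deriv (μ t) w hwm hw.memLp).comp hshift
  have h2 := (tendsto_integral_inner_torusDisp hpq hwm hw.memLp (hP.memLp (μ t))).comp hshift
  refine h2.congr_dist (Metric.tendsto_nhds.2 fun ε hε => ?_)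
  filter_upwards [Metric.tendsto_nhds.1 h1 (ε / 2) (half_pos hε),
    ht.eventually_wdist_transportVariation_le hpq hwm hw hN (ε := ε / (2 * (L + 1)))
      (by positivity), self_mem_nhdsWithin] with s h3 h4 hs
  have hh : 0 < s - t := sub_pos.2 hs
  simp only [Function.comp_apply] at h3
  set π := transportVariation (μ t) w hwm (s - t) with hπdef
  set ν := π.map measurable_snd.aemeasurable with hν
  have hπ : IsTransportPlan π (μ t) ν := isTransportPlan_transportVariation _ hwm _
  set I := ∫ z, inner ℝ (P (μ t) z.1) (torusDisp z.1 z.2) ∂(π : Measure (Torus d × Torus d))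
    with hI
  have hIeq : ∫ x, inner ℝ (P (μ t) x) ((s - t)⁻¹ • torusDisp x (x + torusProj ((s - t) • w x)))
      ∂(μ t : Measure (Torus d)) = I / (s - t) := by
    simp only [inner_smul_right]
    rw [integral_const_mul, div_eq_inv_mul, hI]
    congr 1
    rw [hπdef, toMeasure_transportVariation, integral_map
      (measurable_prodMk_add_torusProj_smul hwm _).aemeasurable]
    exact ((hπ.memLp_fst (hP.memLp (μ t))).1.inner measurable_torusDisp.aestronglyMeasurable)
  rw [dist_zero_right, Real.norm_of_nonneg (by positivity), one_div, inv_mul_lt_iff₀ hh] at h3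
  rw [dist_zero_right, Real.norm_of_nonneg dist_nonneg, Function.comp_apply, hIeq, slope_eq_div,
    Real.dist_eq, ← sub_div, abs_div, abs_of_pos hh, div_lt_iff₀ hh]
  have h5 := hL ν (μ s)
  have h6 := mul_le_mul_of_nonneg_left h4 hL0
  have h7 : L * (ε / (2 * (L + 1)) * (s - t)) ≤ ε / 2 * (s - t) := by
    rw [← mul_assoc]
    refine mul_le_mul_of_nonneg_right ?_ hh.le
    rw [mul_div_assoc', div_le_div_iff₀ (by positivity) two_pos]
    nlinarith
  rw [abs_lt] at h3 ⊢
  rw [abs_le] at h5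
  constructor <;> linarith [h3.1, h3.2, h5.1, h5.2]

theorem IsACCurve.chain_rule (h : IsACCurve p g μ) (hpq : p.HolderConjugate q)
    (hv : IsVelocity p q μ v) {U : ProbabilityMeasure (Torus d) → ℝ}
    (hU : IsWassersteinLipschitz p U) {P : ProbabilityMeasure (Torus d) → Torus d → Tangent d}
    (hP : IsTransportDerivative p q U P) :
    (∀ᵐ t, deriv (fun s => U (μ s)) t =
      ∫ x, inner ℝ (P (μ t) x) (v t x) ∂(μ t : Measure (Torus d))) ∧
    ∀ a b, AbsolutelyContinuousOnInterval (fun s => U (μ s)) a b := by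
  obtain ⟨L, hL0, hL⟩ := hU.exists_abs_sub_le hpq.pos
  have hb : ∀ s t, s ≤ t → |U (μ t) - U (μ s)| ≤ ∫ τ in s..t, L * g τ := fun s t hst => by
    rw [intervalIntegral.integral_const_mul, abs_sub_comm]
    exact (hL _ _).trans (mul_le_mul_of_nonneg_left (h.le s t hst) hL0)
  have hm : LocallyIntegrable (fun τ => L * g τ) volume :=
    (h.integrable.const_mul L).locallyIntegrable
  refine ⟨?_, fun a b => absolutelyContinuousOnInterval_of_abs_sub_le hm hb a b⟩
  filter_upwards [ae_differentiableAt_of_abs_sub_le hm hb, h.ae_hasMetricDerivAt hpq hv]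
    with t ht1 ht2
  have hsub : 𝓝[>] t ≤ 𝓝[≠] t := nhdsWithin_mono _ fun _ h => ne_of_gt h
  exact tendsto_nhds_unique
    ((hasDerivAt_iff_tendsto_slope.1 ht1.hasDerivAt).mono_left hsub) (ht2.1.tendsto_slope_comp hpq hU hP
      (hv.measurable_apply t) (hv.tangent t ht2.1) ht2.2)

end ChainRule

section MinimalVelocity

variable {d : ℕ} {p q a b : ℝ} {μ ν : ℝ → ProbabilityMeasure (Torus d)} {g : ℝ → ℝ}
  {v w : ℝ → Torus d → Tangent d}

theorem HasMetricDerivAt.congr {m : ℝ≥0∞} {t : ℝ} (h : HasMetricDerivAt p μ m t)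
    (hμν : μ =ᶠ[𝓝 t] ν) : HasMetricDerivAt p ν m t := by
  refine Tendsto.congr' ?_ h
  filter_upwards [hμν.filter_mono nhdsWithin_le_nhds] with s hs
  rw [hs, hμν.self_of_nhds]

theorem SolvesContinuityEquation.congr (h : SolvesContinuityEquation a b μ v)
    (hμν : ∀ t ∈ Icc a b, μ t = ν t) : SolvesContinuityEquation a b ν v := by
  refine ⟨h.borel, ?_, fun ψ hψ => ?_⟩
  · rw [← setLIntegral_congr_fun measurableSet_Icc fun t ht => by
      show ∫⁻ x, ‖v t x‖ₑ ∂(μ t : Measure (Torus d)) = _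
      rw [hμν t ht]]
    exact h.integrable
  · rw [← h.equation ψ hψ]
    exact setIntegral_congr_fun measurableSet_Icc fun t ht => by simp only [hμν t ht]

theorem IsMinimalVelocity.congr (h : IsMinimalVelocity p a b μ v)
    (hμν : ∀ t ∈ Icc a b, μ t = ν t) : IsMinimalVelocity p a b ν v := by
  refine ⟨h.continuityEquation.congr hμν, ?_⟩
  have h1 := h.norm_le
  rw [← restrict_Ioo_eq_restrict_Icc, ae_restrict_iff' measurableSet_Ioo] at h1 ⊢
  filter_upwards [h1] with t h2 ht
  obtain ⟨h3, m, h4, h5⟩ := h2 ht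
  rw [hμν t (Ioo_subset_Icc_self ht)] at h3 h5
  refine ⟨h3, m, h4.congr ?_, h5⟩
  filter_upwards [Ioo_mem_nhds ht.1 ht.2] with s hs using hμν s (Ioo_subset_Icc_self hs)

theorem hasMetricDerivAt_iff (hp : 0 < p) {N : ℝ} {t : ℝ} (hN : 0 ≤ N) :
    HasMetricDerivAt p μ (ENNReal.ofReal N) t ↔
      Tendsto (fun s => wdist p (μ s) (μ t) / |s - t|) (𝓝[≠] t) (𝓝 N) := by
  have h1 : (fun s => wasserstein p (μ s) (μ t) / ENNReal.ofReal |s - t|) =ᶠ[𝓝[≠] t]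
      fun s => ENNReal.ofReal (wdist p (μ s) (μ t) / |s - t|) := by
    filter_upwards [self_mem_nhdsWithin] with s hs
    rw [wasserstein_eq hp, ENNReal.ofReal_div_of_pos (abs_pos.2 (sub_ne_zero.2 hs))]
  rw [HasMetricDerivAt, tendsto_congr' h1]
  refine ⟨fun h => ?_, fun h => ENNReal.tendsto_ofReal h⟩
  have h2 := (ENNReal.tendsto_toReal ENNReal.ofReal_ne_top).comp h
  rw [ENNReal.toReal_ofReal hN] at h2
  refine h2.congr fun s => ?_
  exact ENNReal.toReal_ofReal (div_nonneg wdist_nonneg (abs_nonneg _))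

theorem IsACCurve.isMinimalVelocity (h : IsACCurve p g μ) (hpq : p.HolderConjugate q)
    (hv : IsVelocity p q μ v) (hab : a ≤ b) : IsMinimalVelocity p a b μ v := by
  refine ⟨h.solvesContinuityEquation hpq hv hab, ae_restrict_of_ae ?_⟩
  filter_upwards [h.ae_hasMetricDerivAt hpq hv] with t ht
  have h1 := (hv.tangent t ht.1).memLp
  exact ⟨h1, _, (hasMetricDerivAt_iff hpq.pos lpn_nonneg).2 ht.2,
    (eLpNorm_eq_lpn hpq.pos h1).le⟩

theorem IsACCurve.ae_eq_of_isMinimalVelocity (h : IsACCurve p g μ) (hpq : p.HolderConjugate q)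
    (hv : IsVelocity p q μ v) (hab : a ≤ b) (hw : IsMinimalVelocity p a b μ w) :
    ∀ᵐ t ∂(volume.restrict (Icc a b)), v t =ᵐ[(μ t : Measure (Torus d))] w t := by
  filter_upwards [(h.solvesContinuityEquation hpq hv hab).ae_integral_inner_eq
    hw.continuityEquation h.continuous, hw.norm_le,
    ae_restrict_of_ae (h.ae_hasMetricDerivAt hpq hv)] with t h1 h2 h3
  obtain ⟨hwp, m, hm, hle⟩ := h2
  refine (hv.tangent t h3.1).ae_eq hpq hwp h1 ?_
  rw [tendsto_nhds_unique hm ((hasMetricDerivAt_iff hpq.pos lpn_nonneg).2 h3.2),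
    eLpNorm_eq_lpn hpq.pos hwp] at hle
  exact (ENNReal.ofReal_le_ofReal_iff lpn_nonneg).1 hle

theorem IsWassersteinAC.exists_isACCurve (h : IsWassersteinAC p a b μ) (hp : 1 < p)
    (hab : a ≤ b) : ∃ g ν, IsACCurve p g ν ∧ ∀ t ∈ Icc a b, μ t = ν t := by
  obtain ⟨g, hg, hle⟩ := h
  have hp0 : 0 < p := by linarith
  let c : ℝ → ℝ := fun t => projIcc a b hab t
  have hc : ∀ t, c t ∈ Icc a b := fun t => (projIcc a b hab t).2
  have hc_mono : Monotone c := fun s t hst => monotone_projIcc hab hst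
  let g' : ℝ → ℝ := (Icc a b).indicator fun t => |g t|
  have hg'0 : ∀ t, 0 ≤ g' t := fun t => indicator_nonneg (fun _ _ => abs_nonneg _) t
  have hg' : Integrable g' := (integrable_indicator_iff measurableSet_Icc).2 hg.abs
  refine ⟨g', fun t => μ (c t), ⟨hp, hg'0, hg', fun s t hst => ?_⟩, fun t ht => ?_⟩
  · have h1 := hle (c s) (hc s) (c t) (hc t) (hc_mono hst)
    have hsub : Ioc (c s) (c t) ⊆ Icc a b := fun x hx =>
      ⟨(hc s).1.trans hx.1.le, hx.2.trans (hc t).2⟩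
    have hsub' : Ioc (c s) (c t) ⊆ Ioc s t := fun x hx => by
      have hxs : max a (min b s) < x := hx.1
      have hxt : x ≤ max a (min b t) := hx.2
      have hxb := (hsub hx).2
      rw [max_lt_iff, min_lt_iff] at hxs
      rw [le_max_iff, le_min_iff] at hxt
      refine ⟨hxs.2.resolve_left (not_lt.2 hxb), (hxt.resolve_left (not_le.2 hxs.1)).2⟩
    have h2 : ∫ τ in (c s)..(c t), g τ ≤ ∫ τ in s..t, g' τ := by
      rw [intervalIntegral.integral_of_le (hc_mono hst), intervalIntegral.integral_of_le hst]
      calc ∫ τ in Ioc (c s) (c t), g τ ≤ ∫ τ in Ioc (c s) (c t), g' τ := by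
            refine setIntegral_mono_on (hg.mono_set hsub) hg'.integrableOn measurableSet_Ioc
              fun x hx => ?_
            simp only [g', indicator_of_mem (hsub hx)]
            exact le_abs_self _
        _ ≤ ∫ τ in Ioc s t, g' τ :=
            setIntegral_mono_set hg'.integrableOn (ae_of_all _ hg'0) (ae_of_all _ hsub')
    rw [wasserstein_eq hp0] at h1
    have h3 : 0 ≤ ∫ τ in s..t, g' τ := intervalIntegral.integral_nonneg hst fun τ _ => hg'0 τ
    exact (ENNReal.ofReal_le_ofReal_iff h3).1 (h1.trans (ENNReal.ofReal_le_ofReal h2))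
  · simp only [c, projIcc_of_mem hab ht]

theorem IsACCurve.integral_formula (h : IsACCurve p g μ) (hpq : p.HolderConjugate q)
    (hv : IsVelocity p q μ v) {U : ProbabilityMeasure (Torus d) → ℝ}
    (hU : IsWassersteinLipschitz p U) {P : ProbabilityMeasure (Torus d) → Torus d → Tangent d}
    (hP : IsTransportDerivative p q U P) (hw : ∀ᵐ t ∂(volume.restrict (Icc a b)),
      v t =ᵐ[(μ t : Measure (Torus d))] w t) (hab : a ≤ b) :
    (∀ᵐ τ ∂(volume.restrict (Icc a b)),
      Integrable (fun x => inner ℝ (P (μ τ) x) (w τ x)) (μ τ : Measure (Torus d))) ∧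
    IntegrableOn
      (fun τ => ∫ x, inner ℝ (P (μ τ) x) (w τ x) ∂(μ τ : Measure (Torus d))) (Icc a b) ∧
    ∀ s ∈ Icc a b, ∀ t ∈ Icc a b, U (μ t) - U (μ s) =
      ∫ τ in s..t, ∫ x, inner ℝ (P (μ τ) x) (w τ x) ∂(μ τ : Measure (Torus d)) := by
  obtain ⟨h1, hac⟩ := h.chain_rule hpq hv hU hP
  have h2 : ∀ᵐ t ∂(volume.restrict (Icc a b)), deriv (fun s => U (μ s)) t =
      ∫ x, inner ℝ (P (μ t) x) (w t x) ∂(μ t : Measure (Torus d)) := by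
    filter_upwards [ae_restrict_of_ae h1, hw] with t h3 h4
    rw [h3]
    refine integral_congr_ae ?_
    filter_upwards [h4] with x hx
    rw [hx]
  refine ⟨?_, ?_, fun s hs t ht => ?_⟩
  · filter_upwards [ae_restrict_of_ae h.ae_goodTime, hw] with t h3 h4
    refine (integrable_inner_of_memLp hpq.symm (hP.memLp (μ t))
      (hv.tangent t h3).memLp).congr ?_
    filter_upwards [h4] with x hx
    rw [hx]
  · have h3 := (intervalIntegrable_iff_integrableOn_Icc_of_le hab).1
      (hac a b).intervalIntegrable_deriv
    exact h3.congr h2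
  · rw [← (hac s t).integral_deriv_eq_sub]
    refine intervalIntegral.integral_congr_ae ?_
    rw [ae_restrict_iff' measurableSet_Icc] at h2
    filter_upwards [h2] with τ h3 hτ
    exact h3 (uIcc_subset_Icc hs ht (uIoc_subset_uIcc hτ))

end MinimalVelocity

theorem mainTheorem7 (d : ℕ) (p q : ℝ) (hpq : p.HolderConjugate q)
    (U : ProbabilityMeasure (Torus d) → ℝ) (hU : IsWassersteinLipschitz p U)
    (P : ProbabilityMeasure (Torus d) → Torus d → Tangent d)
    (hP : IsTransportDerivative p q U P)
    (a b : ℝ) (hab : a ≤ b) (μ : ℝ → ProbabilityMeasure (Torus d))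
    (hμ : IsWassersteinAC p a b μ) :
    -- existence and uniqueness of the velocity field
    (∃ v : ℝ → Torus d → Tangent d, IsMinimalVelocity p a b μ v) ∧
    (∀ v w : ℝ → Torus d → Tangent d,
      IsMinimalVelocity p a b μ v → IsMinimalVelocity p a b μ w →
        ∀ᵐ t ∂(volume.restrict (Icc a b)), v t =ᵐ[(μ t : Measure (Torus d))] w t) ∧
    -- the integral formula, with all its integrals convergent
    (∀ v : ℝ → Torus d → Tangent d, IsMinimalVelocity p a b μ v →
      (∀ᵐ τ ∂(volume.restrict (Icc a b)),
        Integrable (fun x => inner ℝ (P (μ τ) x) (v τ x)) (μ τ : Measure (Torus d))) ∧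
      IntegrableOn
        (fun τ => ∫ x, inner ℝ (P (μ τ) x) (v τ x) ∂(μ τ : Measure (Torus d))) (Icc a b) ∧
      ∀ s ∈ Icc a b, ∀ t ∈ Icc a b,
        U (μ t) - U (μ s) =
          ∫ τ in s..t, ∫ x, inner ℝ (P (μ τ) x) (v τ x) ∂(μ τ : Measure (Torus d))) := by
  obtain ⟨g, ν, h, hμν⟩ := hμ.exists_isACCurve hpq.lt hab
  obtain ⟨u, hum, hut⟩ := h.exists_velocity hpq
  have hu : IsVelocity p q ν u := ⟨hum, hut⟩
  have hνμ : ∀ t ∈ Icc a b, ν t = μ t := fun t ht => (hμν t ht).symm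
  have key : ∀ v, IsMinimalVelocity p a b μ v →
      ∀ᵐ t ∂(volume.restrict (Icc a b)), u t =ᵐ[(ν t : Measure (Torus d))] v t := fun v hv =>
    h.ae_eq_of_isMinimalVelocity hpq hu hab (hv.congr hμν)
  refine ⟨⟨u, (h.isMinimalVelocity hpq hu hab).congr hνμ⟩, fun v w hv hw => ?_, fun v hv => ?_⟩
  · filter_upwards [key v hv, key w hw, ae_restrict_mem measurableSet_Icc] with t h1 h2 ht
    rw [hμν t ht]
    exact h1.symm.trans h2
  · obtain ⟨h1, h2, h3⟩ := h.integral_formula hpq hu hU hP (key v hv) hab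
    refine ⟨?_, ?_, fun s hs t ht => ?_⟩
    · filter_upwards [h1, ae_restrict_mem measurableSet_Icc] with t h4 ht
      rw [hμν t ht]
      exact h4
    · exact h2.congr_fun (fun t ht => by simp only [hμν t ht]) measurableSet_Icc
    · rw [hμν s hs, hμν t ht, h3 s hs t ht]
      refine intervalIntegral.integral_congr fun τ hτ => ?_
      simp only [hμν τ (uIcc_subset_Icc hs ht hτ)]
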